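/- Let $k$ be a commutative ring, $\mathbb T\subset\mathbb C$ the circle group, embedded in $O(2)=\mathbb T\rtimes C_2$ as the rotations, and let $r\in O(2)$ be the reflection corresponding to complex conjugation. For a space $Y$ let $S_*(Y)$ denote the singular chain complex of $Y$ with coefficients in $k$. For a topological group $G$ and a left $G$-space $Y$ write $Y_{hG}=EG\times_G Y$, where $EG$ is any contractible $G$-space such that $EG\to EG/G$ is a (locally trivial) principal $G$-bundle. The graded algebra $H_*(\mathbb T;k)$ is $k[B]/(B^2)$ with $|B|=1$, and $H_*(O(2);k)$ is generated by $B$ and an element $R$ of degree $0$ with $B^2=0$, $R^2=1$, $RB=-BR$. Let $E\mathbb T_*=k[u^{-1}]\otimes H_*(\mathbb T;k)$, $|u^{-1}|=2$, with $d(u^{-q}\otimes 1)=u^{-q+1}\otimes B$ and $d(u^{-q}\otimes B)=0$, and let $EO(2)_*=E\mathbb T_*\otimes (EC_2)_*$, where $(EC_2)_*=kC_2\otimes k[v^{-1}]$, $|v^{-1}|=1$, is the periodic resolution of the trivial $kC_2$-module. For a differential graded module $M$ over $H_*(\mathbb T;k)$, respectively over $H_*(O(2);k)$, put $M_{h\mathbb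 T}=E\mathbb T_*\otimes_{H_*(\mathbb T;k)}M$, respectively $M_{hO(2)}=EO(2)_*\otimes_{H_*(O(2);k)}M$. Explicitly, $M_{h\mathbb T}=M[u^{-1}]$ with differential $$u^{-q}m\mapsto u^{-q}dm+u^{-q+1}Bm,$$ and $M_{hO(2)}=M[v^{-1},u^{-1}]$ with differential $$v^{-p}u^{-q}m\mapsto(-1)^p\bigl(v^{-p}u^{-q}dm+v^{-p}u^{-q+1}Bm\bigr)+v^{-p+1}u^{-q}\bigl((-1)^qR+(-1)^p\bigr)m,$$ where terms with a positive power of $u$ or $v$ are zero. Let $X$ be a left $O(2)$-space with action map $\mu$. Let $z\in S_1(\mathbb T)$ be a fundamental cycle, that is, a cycle in the homology class of the loop $(t_0,t_1)\mapsto e^{2\pi i t_0}$. Then $Bc=\mu_*(z\times c)$, where $\times$ is the Eilenberg--Zilber shuffle product, makes $S_*(X)$ a differential graded $H_*(\mathbb T;k)$-module. If moreover $z$ is chosen such that complex conjugation maps $z$ to $-z$ (such $z$ exist, for example a difference of two arcs joining $1$ and $-1$), then $B$ together with $Rc=r_*c$ makes $S_*(X)$ a differential graded $H_*(O(2);k)$-module.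 **Proposition.** For every left $O(2)$-space $X$ there are quasi-isomorphisms $$(S_*(X))_{h\mathbb T}\xrightarrow{\ \simeq\ }S_*(X_{h\mathbb T}),\qquad (S_*(X))_{hO(2)}\xrightarrow{\ \simeq\ }S_*(X_{hO(2)}),$$ the first for every fundamental cycle $z$, the second for every fundamental cycle $z$ that is reversed by conjugation, and both for every choice of $E\mathbb T$, respectively $EO(2)$. -/

import Mathlib

open CategoryTheory Opposite

universe u v w

noncomputable section

namespace HomotopyOrbits

section Simplices
variable (X : Type v) [TopologicalSpace X]

/-- The singular simplicial set of a space. -/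
abbrev Sing : SSet.{v} := TopCat.toSSet.obj (TopCat.of X)

variable {X}

/-- A singular simplex as a continuous map on the standard topological simplex. -/
def toMap {n : SimplexCategoryᵒᵖ} (σ : (Sing X).obj n) :
    C(stdSimplex ℝ (Fin (n.unop.len + 1)), X) :=
  TopCat.toSSetObjEquiv (TopCat.of X) n σ

/-- The singular simplex given by a continuous map on the standard topological simplex. -/
def ofMap {n : SimplexCategoryᵒᵖ} (f : C(stdSimplex ℝ (Fin (n.unop.len + 1)), X)) :
    (Sing X).obj n :=
  (TopCat.toSSetObjEquiv (TopCat.of X) n).symm f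

@[simp] lemma toMap_ofMap {n : SimplexCategoryᵒᵖ}
    (f : C(stdSimplex ℝ (Fin (n.unop.len + 1)), X)) : toMap (ofMap f) = f :=
  (TopCat.toSSetObjEquiv (TopCat.of X) n).apply_symm_apply f

@[simp] lemma ofMap_toMap {n : SimplexCategoryᵒᵖ} (σ : (Sing X).obj n) : ofMap (toMap σ) = σ :=
  (TopCat.toSSetObjEquiv (TopCat.of X) n).symm_apply_apply σ

lemma simplex_ext {n : SimplexCategoryᵒᵖ} {σ τ : (Sing X).obj n}
    (h : ∀ t, toMap σ t = toMap τ t) : σ = τ :=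
  (TopCat.toSSetObjEquiv (TopCat.of X) n).injective (ContinuousMap.ext h)

lemma toMap_map {m n : SimplexCategoryᵒᵖ} (θ : m ⟶ n) (σ : (Sing X).obj m)
    (t : stdSimplex ℝ (Fin (n.unop.len + 1))) :
    toMap ((Sing X).map θ σ) t = toMap σ (stdSimplex.map θ.unop t) := by
  rfl

end Simplices


section Chains
open Simplicial
variable (k : Type u) [CommRing k] (X : Type v) [TopologicalSpace X]

/-- The simplicial `k`-module `k ⊗ Sing X`. -/
def singularModule : SimplicialObject (ModuleCat.{max u v} k) where
  obj n := ModuleCat.of k ((Sing X).obj n →₀ k)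
  map θ := ModuleCat.ofHom (Finsupp.lmapDomain k k ((Sing X).map θ))
  map_id n := ModuleCat.hom_ext (Finsupp.lhom_ext' fun σ => LinearMap.ext_ring (by simp))
  map_comp θ η := ModuleCat.hom_ext (Finsupp.lhom_ext' fun σ => LinearMap.ext_ring (by simp))

/-- The singular chain complex of `X` with coefficients in `k`. -/
def singularChains : ChainComplex (ModuleCat.{max u v} k) ℕ :=
  (AlgebraicTopology.alternatingFaceMapComplex _).obj (singularModule k X)

/-- The module of singular `n`-chains. -/
abbrev Chain (n : ℕ) : Type max u v := (Sing X) _⦋n⦌ →₀ k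

/-- The singular boundary map. -/
def boundary (n : ℕ) : Chain k X (n + 1) →ₗ[k] Chain k X n :=
  ∑ i : Fin (n + 2), (-1 : ℤ) ^ (i : ℕ) • Finsupp.lmapDomain k k ((Sing X).δ i)

lemma singularChains_d (n : ℕ) :
    (singularChains k X).d (n + 1) n = ModuleCat.ofHom (boundary k X n) := by
  refine (AlgebraicTopology.alternatingFaceMapComplex_obj_d _ n).trans ?_
  ext : 1
  simp only [AlgebraicTopology.AlternatingFaceMapComplex.objD, boundary, ModuleCat.hom_sum]
  rfl

end Chains


section Cross
open Simplicial
variable {G : Type w} [TopologicalSpace G] {X : Type v} [TopologicalSpace X]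

/-- The pointwise action of a simplex of `G` on a simplex of `X`. -/
def act [SMul G X] [ContinuousSMul G X] {n : SimplexCategoryᵒᵖ}
    (τ : (Sing G).obj n) (σ : (Sing X).obj n) : (Sing X).obj n :=
  ofMap ⟨fun t => toMap τ t • toMap σ t, by fun_prop⟩

lemma toMap_act [SMul G X] [ContinuousSMul G X] {n : SimplexCategoryᵒᵖ}
    (τ : (Sing G).obj n) (σ : (Sing X).obj n) (t) :
    toMap (act τ σ) t = toMap τ t • toMap σ t := by
  simp [act]

lemma map_act [SMul G X] [ContinuousSMul G X] {m n : SimplexCategoryᵒᵖ} (θ : m ⟶ n)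
    (τ : (Sing G).obj m) (σ : (Sing X).obj m) :
    (Sing X).map θ (act τ σ) = act ((Sing G).map θ τ) ((Sing X).map θ σ) :=
  simplex_ext fun t => by simp only [toMap_map, toMap_act]

/-- The map `[n + 1] → [1]` sending `0, …, i` to `0` and `i + 1, …, n + 1` to `1`, that is, the
composite of all elementary degeneracies other than the `i`-th. -/
def cut {n : ℕ} (i : Fin (n + 1)) : ⦋n + 1⦌ ⟶ ⦋1⦌ :=
  SimplexCategory.mkHom
    ⟨fun j => if (j : ℕ) ≤ i then 0 else 1, fun a b hab => by
      have : (a : ℕ) ≤ b := hab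
      dsimp only
      split_ifs
      · exact le_rfl
      · exact Fin.zero_le _
      · omega
      · exact le_rfl⟩

/-- The `i`-th simplex of the shuffle decomposition of `Δ¹ × Δⁿ`, mapped to `X` by `τ × σ` followed
by the action map. -/
def prism [SMul G X] [ContinuousSMul G X] {n : ℕ} (i : Fin (n + 1)) (τ : (Sing G) _⦋1⦌)
    (σ : (Sing X) _⦋n⦌) : (Sing X) _⦋n + 1⦌ :=
  act ((Sing G).map (cut i).op τ) ((Sing X).σ i σ)

variable (k : Type u) [CommRing k]

/-- The Eilenberg--Zilber shuffle product of a `1`-chain `z` of `G` and an `n`-chain `c` of `X`,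
pushed forward along the action map `μ : G × X → X`; that is, `μ_*(z × c)`. -/
def cross [SMul G X] [ContinuousSMul G X] (n : ℕ) :
    Chain k G 1 →ₗ[k] Chain k X n →ₗ[k] Chain k X (n + 1) :=
  Finsupp.linearCombination k fun τ => Finsupp.linearCombination k fun σ =>
    ∑ i : Fin (n + 1), (-1 : ℤ) ^ (i : ℕ) • Finsupp.single (prism i τ σ) 1

/-- The product of a `0`-chain of `G` and an `n`-chain of `X`. -/
def cross₀ [SMul G X] [ContinuousSMul G X] (n : ℕ) :
    Chain k G 0 →ₗ[k] Chain k X n →ₗ[k] Chain k X n :=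
  Finsupp.linearCombination k fun g => Finsupp.linearCombination k fun σ =>
    Finsupp.single (act ((Sing G).map (SimplexCategory.const ⦋n⦌ ⦋0⦌ 0).op g) σ) 1

section
variable [SMul G X] [ContinuousSMul G X]

lemma act_map_cut {n : ℕ} {m : SimplexCategory} (θ : m ⟶ ⦋n + 1⦌) (i : Fin (n + 1))
    (τ : (Sing G) _⦋1⦌) (σ : (Sing X) _⦋n⦌) :
    (Sing X).map θ.op (prism i τ σ) =
      act ((Sing G).map (θ ≫ cut i).op τ) ((Sing X).map (θ ≫ SimplexCategory.σ i).op σ) := by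
  simp only [prism, map_act, op_comp, Functor.map_comp]
  rfl


lemma act_map (τ : (Sing G) _⦋1⦌) {m n : SimplexCategory} (α : n ⟶ ⦋1⦌) (θ : m ⟶ n)
    (σ : (Sing X).obj (op n)) :
    (Sing X).map θ.op (act ((Sing G).map α.op τ) σ) =
      act ((Sing G).map (θ ≫ α).op τ) ((Sing X).map θ.op σ) := by
  simp only [map_act, op_comp, Functor.map_comp]
  rfl


lemma hom_ext_val {m n : ℕ} {α β : ⦋m⦌ ⟶ ⦋n⦌}
    (h : ∀ j : Fin (m + 1), (α j : Fin (n + 1)).val = (β j : Fin (n + 1)).val) : α = β :=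
  SimplexCategory.Hom.ext _ _ (OrderHom.ext _ _ (funext fun j => Fin.ext (h j)))

lemma comp_val {l m n : ℕ} (α : ⦋l⦌ ⟶ ⦋m⦌) (β : ⦋m⦌ ⟶ ⦋n⦌) (j : Fin (l + 1)) :
    ((α ≫ β) j : Fin (n + 1)).val = (β (α j) : Fin (n + 1)).val := rfl

lemma cut_val {n : ℕ} (i : Fin (n + 1)) (j : Fin (n + 2)) :
    (cut i j : Fin 2).val = if j.val ≤ i.val then 0 else 1 := by
  change (if j.val ≤ i.val then (0 : Fin 2) else 1).val = _
  split_ifs <;> rfl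

lemma δ_val {n : ℕ} (i : Fin (n + 2)) (j : Fin (n + 1)) :
    (SimplexCategory.δ i j : Fin (n + 2)).val = if j.val < i.val then j.val else j.val + 1 := by
  change (i.succAbove j).val = _
  simp only [Fin.succAbove]
  split_ifs with h h' h' <;> simp_all [Fin.lt_def]

lemma σ_val {n : ℕ} (i : Fin (n + 1)) (j : Fin (n + 2)) :
    (SimplexCategory.σ i j : Fin (n + 1)).val = if j.val ≤ i.val then j.val else j.val - 1 := by
  change (i.predAbove j).val = _
  simp only [Fin.predAbove]
  have hlt : i.castSucc < j ↔ i.val < j.val := Iff.rfl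
  split_ifs with h h' h'
  · omega
  · rfl
  · rfl
  · omega

lemma const_val {n : ℕ} (i : Fin 2) (j : Fin (n + 1)) :
    (SimplexCategory.const ⦋n⦌ ⦋1⦌ i j : Fin 2).val = i.val := rfl

lemma δ_zero_cut (n : ℕ) :
    SimplexCategory.δ (0 : Fin (n + 2)) ≫ cut 0 = SimplexCategory.const ⦋n⦌ ⦋1⦌ 1 :=
  hom_ext_val fun j => by
    rw [comp_val, cut_val, δ_val, const_val]
    simp

lemma δ_last_cut (n : ℕ) :
    SimplexCategory.δ (Fin.last (n + 1)) ≫ cut (Fin.last n) =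
      SimplexCategory.const ⦋n⦌ ⦋1⦌ 0 :=
  hom_ext_val fun j => by
    rw [comp_val, cut_val, δ_val, const_val]
    have := j.isLt
    simp only [Fin.val_last, Fin.val_zero]
    split_ifs <;> omega

lemma δ_cut_of_le {n : ℕ} (i : Fin (n + 2)) (j : Fin (n + 1)) (hij : i ≤ j.castSucc) :
    SimplexCategory.δ i.castSucc ≫ cut j.succ = cut j :=
  hom_ext_val fun a => by
    rw [comp_val, cut_val, δ_val, cut_val]
    have : i.val ≤ j.val := hij
    simp only [Fin.val_castSucc, Fin.val_succ]
    split_ifs <;> omega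

lemma δ_cut_self {n : ℕ} (j : Fin (n + 1)) :
    SimplexCategory.δ j.castSucc.succ ≫ cut j.succ =
      SimplexCategory.δ j.castSucc.succ ≫ cut j.castSucc :=
  hom_ext_val fun a => by
    rw [comp_val, comp_val, cut_val, cut_val, δ_val]
    simp only [Fin.val_castSucc, Fin.val_succ]
    split_ifs <;> omega

lemma δ_cut_of_gt {n : ℕ} (i : Fin (n + 2)) (j : Fin (n + 1)) (hij : j.castSucc < i) :
    SimplexCategory.δ i.succ ≫ cut j.castSucc = cut j :=
  hom_ext_val fun a => by
    rw [comp_val, cut_val, δ_val, cut_val]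
    have : j.val < i.val := hij
    simp only [Fin.val_castSucc, Fin.val_succ]
    split_ifs <;> omega

lemma σ_cut_of_le {n : ℕ} (i j : Fin (n + 1)) (hij : i ≤ j) :
    SimplexCategory.σ i.castSucc ≫ cut j = cut j.succ :=
  hom_ext_val fun a => by
    rw [comp_val, cut_val, σ_val, cut_val]
    have : i.val ≤ j.val := hij
    simp only [Fin.val_castSucc, Fin.val_succ]
    split_ifs <;> omega

lemma σ_cut_of_ge {n : ℕ} (i j : Fin (n + 1)) (hij : j ≤ i) :
    SimplexCategory.σ i.succ ≫ cut j = cut j.castSucc :=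
  hom_ext_val fun a => by
    rw [comp_val, cut_val, σ_val, cut_val]
    have : j.val ≤ i.val := hij
    simp only [Fin.val_castSucc, Fin.val_succ]
    split_ifs <;> omega


lemma lmap_comp {A B C : Type v} (f : A → B) (g : B → C) (h : A → C)
    (H : ∀ a, g (f a) = h a) :
    ModuleCat.ofHom (Finsupp.lmapDomain k k f) ≫ ModuleCat.ofHom (Finsupp.lmapDomain k k g) =
      ModuleCat.ofHom (Finsupp.lmapDomain k k h) := by
  obtain rfl : g ∘ f = h := funext H
  exact congrArg ModuleCat.ofHom (Finsupp.lmapDomain_comp k k f g).symm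

/-- The simplicial map given by multiplication with the `i`-th vertex of a `1`-simplex of `G`. -/
def vertexMap (τ : (Sing G) _⦋1⦌) (i : Fin 2) : singularModule k X ⟶ singularModule k X where
  app n := ModuleCat.ofHom (Finsupp.lmapDomain k k
    (act ((Sing G).map (SimplexCategory.const n.unop ⦋1⦌ i).op τ)))
  naturality m n θ := by
    refine (lmap_comp k _ _ _ fun _ => rfl).trans (lmap_comp k _ _ _ fun σ => ?_).symm
    exact act_map τ _ θ.unop σ

/-- The simplicial homotopy underlying multiplication by a `1`-simplex of `G`. -/
def prismHomotopy (τ : (Sing G) _⦋1⦌) :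
    SimplicialObject.Homotopy (vertexMap (X := X) k τ 0) (vertexMap k τ 1) where
  h {n} i := ModuleCat.ofHom (Finsupp.lmapDomain k k (prism i τ))
  h_zero_comp_δ_zero n := lmap_comp k _ _ _ fun σ => by
    refine (act_map_cut (SimplexCategory.δ 0) 0 τ σ).trans ?_
    rw [δ_zero_cut]
    erw [SimplexCategory.δ_comp_σ_self]
    simp
  h_last_comp_δ_last n := lmap_comp k _ _ _ fun σ => by
    refine (act_map_cut (SimplexCategory.δ (Fin.last (n + 1))) (Fin.last n) τ σ).trans ?_
    rw [δ_last_cut]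
    erw [SimplexCategory.δ_comp_σ_succ]
    simp
  h_succ_comp_δ_castSucc_of_lt i j hij :=
    (lmap_comp k _ _ _ fun _ => rfl).trans (lmap_comp k _ _ _ fun σ => by
      refine Eq.symm ((act_map_cut (SimplexCategory.δ i.castSucc) j.succ τ σ).trans ?_)
      rw [δ_cut_of_le i j hij, SimplexCategory.δ_comp_σ_of_le hij]
      simp only [op_comp, Functor.map_comp]
      rfl).symm
  h_succ_comp_δ_castSucc_succ j :=
    (lmap_comp k _ _ _ fun _ => rfl).trans (lmap_comp k _ _ _ fun σ => by
      refine (act_map_cut (SimplexCategory.δ j.castSucc.succ) j.castSucc τ σ).trans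
        (Eq.symm ((act_map_cut (SimplexCategory.δ j.castSucc.succ) j.succ τ σ).trans ?_))
      rw [δ_cut_self j]
      erw [SimplexCategory.δ_comp_σ_self, SimplexCategory.δ_comp_σ_succ]).symm
  h_castSucc_comp_δ_succ_of_lt i j hij :=
    (lmap_comp k _ _ _ fun _ => rfl).trans (lmap_comp k _ _ _ fun σ => by
      refine Eq.symm ((act_map_cut (SimplexCategory.δ i.succ) j.castSucc τ σ).trans ?_)
      rw [δ_cut_of_gt i j hij, SimplexCategory.δ_comp_σ_of_gt hij]
      simp only [op_comp, Functor.map_comp]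
      rfl).symm
  h_comp_σ_castSucc_of_le i j hij :=
    (lmap_comp k _ _ _ fun _ => rfl).trans (lmap_comp k _ _ _ fun σ => by
      refine Eq.symm ((act_map_cut (SimplexCategory.σ i.castSucc) j τ σ).trans ?_)
      rw [σ_cut_of_le i j hij, SimplexCategory.σ_comp_σ hij]
      simp only [op_comp, Functor.map_comp]
      rfl).symm
  h_comp_σ_succ_of_lt i j hij :=
    (lmap_comp k _ _ _ fun _ => rfl).trans (lmap_comp k _ _ _ fun σ => by
      refine Eq.symm ((act_map_cut (SimplexCategory.σ i.succ) j τ σ).trans ?_)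
      rw [σ_cut_of_ge i j hij, ← SimplexCategory.σ_comp_σ hij]
      simp only [op_comp, Functor.map_comp]
      rfl).symm



lemma cross_single (τ : (Sing G) _⦋1⦌) (n : ℕ) :
    cross (X := X) k n (Finsupp.single τ 1) =
      ∑ i : Fin (n + 1), (-1 : ℤ) ^ (i : ℕ) • Finsupp.lmapDomain k k (prism i τ) := by
  refine Finsupp.lhom_ext' fun σ => LinearMap.ext_ring ?_
  simp [cross]

lemma hom_prismHomotopy (τ : (Sing G) _⦋1⦌) (n : ℕ) :
    (prismHomotopy (X := X) k τ).toChainHomotopy.hom n (n + 1) =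
      -ModuleCat.ofHom (cross k n (Finsupp.single τ 1)) := by
  refine (SimplicialObject.Homotopy.ToChainHomotopy.hom_eq _ n).trans (congrArg _ ?_)
  refine ModuleCat.hom_ext ?_
  rw [cross_single, ModuleCat.hom_sum]
  rfl

lemma boundary_zero_single (τ : (Sing G) _⦋1⦌) :
    boundary k G 0 (Finsupp.single τ 1) =
      Finsupp.single ((Sing G).δ 0 τ) 1 - Finsupp.single ((Sing G).δ 1 τ) 1 := by
  simp [boundary, Fin.sum_univ_two, sub_eq_add_neg]

lemma const_δ (n : ℕ) (i : Fin 2) :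
    SimplexCategory.const ⦋n⦌ ⦋0⦌ 0 ≫ SimplexCategory.δ i =
      SimplexCategory.const ⦋n⦌ ⦋1⦌ (1 - i) := by
  refine hom_ext_val fun a => ?_
  rw [comp_val, δ_val, const_val]
  have h : (SimplexCategory.const ⦋n⦌ ⦋0⦌ 0 a : Fin 1).val = 0 := rfl
  rw [h]
  fin_cases i <;> rfl

lemma cross₀_boundary (τ : (Sing G) _⦋1⦌) (n : ℕ) :
    cross₀ (X := X) k n (boundary k G 0 (Finsupp.single τ 1)) =
      Finsupp.lmapDomain k k (act ((Sing G).map (SimplexCategory.const ⦋n⦌ ⦋1⦌ 1).op τ)) -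
      Finsupp.lmapDomain k k (act ((Sing G).map (SimplexCategory.const ⦋n⦌ ⦋1⦌ 0).op τ)) := by
  have h (i : Fin 2) : (Sing G).map (SimplexCategory.const ⦋n⦌ ⦋0⦌ 0).op ((Sing G).δ i τ) =
      (Sing G).map (SimplexCategory.const ⦋n⦌ ⦋1⦌ (1 - i)).op τ := by
    rw [← const_δ, op_comp, Functor.map_comp]
    rfl
  refine Finsupp.lhom_ext' fun σ => LinearMap.ext_ring ?_
  rw [boundary_zero_single, map_sub]
  simp [cross₀, h]


/-- The Leibniz rule `d (z × c) = dz × c - z × dc` for a `1`-chain `z`. -/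
theorem boundary_cross (n : ℕ) (z : Chain k G 1) (c : Chain k X (n + 1)) :
    boundary k X (n + 1) (cross k (n + 1) z c) =
      cross₀ k (n + 1) (boundary k G 0 z) c - cross k n z (boundary k X n c) := by
  induction z using Finsupp.induction_linear with
  | zero => simp
  | add a b ha hb =>
    simp only [map_add, LinearMap.add_apply, ha, hb]
    abel
  | single τ r =>
    rw [← mul_one r, ← smul_eq_mul, ← Finsupp.smul_single]
    simp only [map_smul, LinearMap.smul_apply, ← smul_sub]
    congr 1
    have H := (prismHomotopy (X := X) k τ).toChainHomotopy.comm (n + 1)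
    rw [dNext_eq (i' := n) (w := by simp), prevD_eq (j' := n + 2) (w := by simp),
      hom_prismHomotopy, hom_prismHomotopy] at H
    erw [singularChains_d, singularChains_d] at H
    rw [cross₀_boundary, LinearMap.sub_apply]
    have H' : Finsupp.lmapDomain k k
        (act ((Sing G).map (SimplexCategory.const ⦋n + 1⦌ ⦋1⦌ 0).op τ)) c =
        -(cross k n (Finsupp.single τ 1) (boundary k X n c)) +
        boundary k X (n + 1) (-(cross k (n + 1) (Finsupp.single τ 1) c)) +
        Finsupp.lmapDomain k k
          (act ((Sing G).map (SimplexCategory.const ⦋n + 1⦌ ⦋1⦌ 1).op τ)) c :=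
      congrArg (fun f => ModuleCat.Hom.hom f c) H
    rw [H', map_neg]
    abel

theorem boundary_cross_zero (z : Chain k G 1) (c : Chain k X 0) :
    boundary k X 0 (cross k 0 z c) = cross₀ k 0 (boundary k G 0 z) c := by
  induction z using Finsupp.induction_linear with
  | zero => simp
  | add a b ha hb => simp only [map_add, LinearMap.add_apply, ha, hb]
  | single τ r =>
    rw [← mul_one r, ← smul_eq_mul, ← Finsupp.smul_single]
    simp only [map_smul, LinearMap.smul_apply]
    congr 1
    have H := (prismHomotopy (X := X) k τ).toChainHomotopy.comm 0
    rw [dNext_eq_zero _ _ (by simp), prevD_eq (j' := 1) (w := by simp), zero_add,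
      hom_prismHomotopy] at H
    erw [singularChains_d] at H
    rw [cross₀_boundary, LinearMap.sub_apply]
    have H' : Finsupp.lmapDomain k k
        (act ((Sing G).map (SimplexCategory.const ⦋0⦌ ⦋1⦌ 0).op τ)) c =
        boundary k X 0 (-(cross k 0 (Finsupp.single τ 1) c)) +
        Finsupp.lmapDomain k k
          (act ((Sing G).map (SimplexCategory.const ⦋0⦌ ⦋1⦌ 1).op τ)) c :=
      congrArg (fun f => ModuleCat.Hom.hom f c) H
    rw [H', map_neg]
    abel

end


lemma prism_prism [CommGroup G] [MulAction G X] [ContinuousSMul G X] {n : ℕ}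
    (i : Fin (n + 1)) (j : Fin (n + 1)) (hij : i ≤ j) (τ τ' : (Sing G) _⦋1⦌) (σ : (Sing X) _⦋n⦌) :
    prism i.castSucc τ (prism j τ' σ) = prism j.succ τ' (prism i τ σ) := by
  have h₁ := act_map_cut (SimplexCategory.σ i.castSucc) j τ' σ
  have h₂ := act_map_cut (SimplexCategory.σ j.succ) i τ σ
  rw [σ_cut_of_le i j hij] at h₁
  rw [σ_cut_of_ge j i hij] at h₂
  rw [SimplexCategory.σ_comp_σ hij] at h₁
  change act _ ((Sing X).map (SimplexCategory.σ i.castSucc).op _) =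
    act _ ((Sing X).map (SimplexCategory.σ j.succ).op _)
  rw [h₁, h₂]
  exact simplex_ext fun t => by simp only [toMap_act, smul_smul, mul_comm]

/-- The square of multiplication by a `1`-chain of a commutative group vanishes. -/
theorem cross_cross [CommGroup G] [MulAction G X] [ContinuousSMul G X] (n : ℕ)
    (z : Chain k G 1) (c : Chain k X n) : cross k (n + 1) z (cross k n z c) = 0 := by
  induction c using Finsupp.induction_linear with
  | zero => simp
  | add a b ha hb => simp only [map_add, ha, hb, add_zero]
  | single σ r =>
    rw [← mul_one r, ← smul_eq_mul, ← Finsupp.smul_single, map_smul, map_smul]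
    suffices h : cross k (n + 1) z (cross k n z (Finsupp.single σ 1)) = 0 by rw [h, smul_zero]
    have key (m : ℕ) (ρ : (Sing X) _⦋m⦌) : cross k m z (Finsupp.single ρ 1) =
        ∑ p ∈ z.support ×ˢ (Finset.univ : Finset (Fin (m + 1))),
        z p.1 • (-1 : ℤ) ^ (p.2 : ℕ) • Finsupp.single (prism p.2 p.1 ρ) 1 := by
      rw [cross, Finsupp.linearCombination_apply, Finsupp.sum, LinearMap.sum_apply,
        Finset.sum_product]
      simp only [LinearMap.smul_apply, Finsupp.linearCombination_single, one_smul,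
        Finset.smul_sum]
    rw [key, map_sum]
    simp only [map_smul, map_zsmul, key, Finset.smul_sum]
    rw [← Finset.sum_product']
    refine Finset.sum_involution
      (fun x _ => if h : x.2.2 ≤ x.1.2.castSucc
        then ((x.2.1, x.2.2.castLT (lt_of_le_of_lt h x.1.2.isLt)), (x.1.1, x.1.2.succ))
        else ((x.2.1, x.2.2.pred (fun h0 => h (h0 ▸ Fin.zero_le _))), (x.1.1, x.1.2.castSucc)))
      ?_ ?_ ?_ ?_
    · rintro ⟨⟨τ', j⟩, ⟨τ, i⟩⟩ -
      dsimp only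
      split_ifs with h
      · obtain ⟨i, rfl⟩ : ∃ i' : Fin (n + 1), i = i'.castSucc :=
          ⟨i.castLT (lt_of_le_of_lt h j.isLt), rfl⟩
        have h' : i ≤ j := h
        dsimp only [Fin.castLT_castSucc]
        rw [prism_prism i j h']
        simp only [Fin.val_castSucc, Fin.val_succ, pow_succ]
        module
      · obtain ⟨i, rfl⟩ : ∃ i' : Fin (n + 1), i = i'.succ :=
          ⟨i.pred (fun h0 => h (h0 ▸ Fin.zero_le _)), by simp⟩
        have h' : j ≤ i := by
          have h2 : ¬ (i : ℕ) + 1 ≤ j := h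
          exact Fin.le_def.2 (by omega)
        simp only [Fin.pred_succ]
        rw [← prism_prism j i h']
        simp only [Fin.val_castSucc, Fin.val_succ, pow_succ]
        module
    · rintro ⟨⟨τ', j⟩, ⟨τ, i⟩⟩ - -
      dsimp only
      split_ifs with h
      · intro he
        have h1 := congrArg (fun x => (x.2.2 : ℕ)) he
        have h2 : (i : ℕ) ≤ j := h
        simp at h1
        omega
      · intro he
        have h1 := congrArg (fun x => (x.2.2 : ℕ)) he
        have h2 : ¬ (i : ℕ) ≤ j := h
        simp at h1
        omega
    · rintro ⟨⟨τ', j⟩, ⟨τ, i⟩⟩ hx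
      dsimp only
      simp only [Finset.mem_product, Finset.mem_univ, and_true] at hx
      split_ifs with h <;> simp only [Finset.mem_product, Finset.mem_univ, hx, and_self]
    · rintro ⟨⟨τ', j⟩, ⟨τ, i⟩⟩ -
      by_cases h : i ≤ j.castSucc
      · have h2 : ¬ (j.succ : Fin (n + 2)) ≤ i := by
          have h3 : (i : ℕ) ≤ j := h
          intro h4
          have h5 : (j : ℕ) + 1 ≤ i := h4
          omega
        simp only [dif_pos h, Fin.castSucc_castLT, dif_neg h2, Fin.pred_succ]
      · have h2 : (j.castSucc : Fin (n + 2)) ≤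
            (i.pred (fun h0 => h (h0 ▸ Fin.zero_le _)) : Fin (n + 1)).castSucc := by
          have h3 : ¬ (i : ℕ) ≤ j := h
          have h4 : (j : ℕ) ≤ (i : ℕ) - 1 := by omega
          exact h4
        simp only [dif_neg h, dif_pos h2, Fin.castLT_castSucc, Fin.succ_pred]

end Cross


section Modules

/-- A non-negatively graded left differential graded module over the graded algebra
`H_*(𝕋; k) = k[B]/(B²)`, `|B| = 1`, with zero differential. -/
structure TModule (k : Type u) [CommRing k] where
  C : ChainComplex (ModuleCat.{w} k) ℕ
  B (n : ℕ) : C.X n →ₗ[k] C.X (n + 1)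
  d_B_zero (x : C.X 0) : C.d 1 0 (B 0 x) = 0
  d_B (n : ℕ) (x : C.X (n + 1)) : C.d (n + 2) (n + 1) (B (n + 1) x) = -B n (C.d (n + 1) n x)
  B_B (n : ℕ) (x : C.X n) : B (n + 1) (B n x) = 0

/-- A non-negatively graded left differential graded module over the graded algebra
`H_*(O(2); k)`, generated by `B` of degree one and `R` of degree zero with the relations
`B² = 0`, `R² = 1`, `RB = -BR`, with zero differential. -/
structure OModule (k : Type u) [CommRing k] extends TModule.{u, w} k where
  R (n : ℕ) : C.X n →ₗ[k] C.X n
  d_R (n : ℕ) (x : C.X (n + 1)) : C.d (n + 1) n (R (n + 1) x) = R n (C.d (n + 1) n x)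
  R_R (n : ℕ) (x : C.X n) : R n (R n x) = x
  R_B (n : ℕ) (x : C.X n) : R (n + 1) (B n x) = -B n (R n x)

variable {k : Type u} [CommRing k]

lemma d_d_apply (C : ChainComplex (ModuleCat.{w} k) ℕ) (n : ℕ) (x : C.X (n + 2)) :
    C.d (n + 1) n (C.d (n + 2) (n + 1) x) = 0 := by
  rw [← ModuleCat.comp_apply, C.d_comp_d]
  rfl

namespace TModule
variable (M : TModule.{u, w} k)

/-- Degree `n` of `M[u⁻¹]`: the (finite) direct sum of the modules `u^{-q} M_j`, `2 q + j = n`. -/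
abbrev OrbitsX (n : ℕ) : Type w := ∀ i : {i : ℕ × ℕ // 2 * i.1 + i.2 = n}, M.C.X i.1.2

/-- The component of `∑ u^{-q} m ↦ ∑ u^{-q+1} B m` in `u^{-q} M_j`. -/
def orbitsB (n q : ℕ) : ∀ j : ℕ, 2 * q + j = n → (M.OrbitsX (n + 1) →ₗ[k] M.C.X j)
  | 0, _ => 0
  | j + 1, h => M.B j ∘ₗ LinearMap.proj (⟨(q + 1, j), by dsimp only; omega⟩ :
      {i : ℕ × ℕ // 2 * i.1 + i.2 = n + 1})

/-- The differential `u^{-q} m ↦ u^{-q} d m + u^{-q+1} B m`. -/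
def orbitsD (n : ℕ) : M.OrbitsX (n + 1) →ₗ[k] M.OrbitsX n :=
  LinearMap.pi fun i =>
    (M.C.d (i.1.2 + 1) i.1.2).hom ∘ₗ
        LinearMap.proj (⟨(i.1.1, i.1.2 + 1), by have := i.2; dsimp only; omega⟩ :
          {i : ℕ × ℕ // 2 * i.1 + i.2 = n + 1}) +
      M.orbitsB n i.1.1 i.1.2 i.2

lemma orbitsD_zero (n : ℕ) (f : M.OrbitsX (n + 1)) (q : ℕ) (h : 2 * q + 0 = n) :
    M.orbitsD n f ⟨(q, 0), h⟩ = M.C.d 1 0 (f ⟨(q, 1), by dsimp only; omega⟩) :=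
  add_zero _

lemma orbitsD_succ (n : ℕ) (f : M.OrbitsX (n + 1)) (q j : ℕ) (h : 2 * q + (j + 1) = n) :
    M.orbitsD n f ⟨(q, j + 1), h⟩ =
      M.C.d (j + 2) (j + 1) (f ⟨(q, j + 2), by dsimp only; omega⟩) +
      M.B j (f ⟨(q + 1, j), by dsimp only; omega⟩) := rfl

lemma orbitsD_orbitsD (n : ℕ) (f : M.OrbitsX (n + 2)) : M.orbitsD n (M.orbitsD (n + 1) f) = 0 := by
  funext ⟨⟨q, j⟩, h⟩
  dsimp only at h
  match j, h with
  | 0, h => simp only [orbitsD_zero, orbitsD_succ, map_add, d_d_apply, d_B_zero]; simp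
  | 1, h =>
    simp only [orbitsD_zero, orbitsD_succ, map_add, d_d_apply, d_B]
    simp
  | j + 2, h =>
    simp only [orbitsD_succ, map_add, d_d_apply, d_B, B_B]
    simp

/-- The algebraic homotopy orbits `M_{h𝕋} = E𝕋_* ⊗ M` over `H_*(𝕋; k)`, where
`E𝕋_* = k[u⁻¹] ⊗ H_*(𝕋; k)` is the normalized two-sided bar construction. As `E𝕋_*` is free over
`H_*(𝕋; k)` on the powers of `u⁻¹` (of degree two), this is `M[u⁻¹]` with the differential
`u^{-q} m ↦ u^{-q} d m + u^{-q+1} B m`. -/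
def homotopyOrbits : ChainComplex (ModuleCat.{w} k) ℕ :=
  ChainComplex.of (fun n => ModuleCat.of k (M.OrbitsX n)) (fun n => ModuleCat.ofHom (M.orbitsD n))
    fun n => ModuleCat.hom_ext (LinearMap.ext (M.orbitsD_orbitsD n))

end TModule

namespace OModule
variable (M : OModule.{u, w} k)

/-- Degree `n` of `M[v⁻¹, u⁻¹]`: the (finite) direct sum of the modules `v^{-p} u^{-q} M_j`,
`p + 2 q + j = n`. -/
abbrev OrbitsX (n : ℕ) : Type w :=
  ∀ i : {i : ℕ × ℕ × ℕ // i.1 + 2 * i.2.1 + i.2.2 = n}, M.C.X i.1.2.2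

/-- The component of `∑ v^{-p} u^{-q} m ↦ ∑ v^{-p} u^{-q+1} B m` in `v^{-p} u^{-q} M_j`. -/
def orbitsB (n p q : ℕ) : ∀ j : ℕ, p + 2 * q + j = n → (M.OrbitsX (n + 1) →ₗ[k] M.C.X j)
  | 0, _ => 0
  | j + 1, h => M.B j ∘ₗ LinearMap.proj (⟨(p, q + 1, j), by dsimp only; omega⟩ :
      {i : ℕ × ℕ × ℕ // i.1 + 2 * i.2.1 + i.2.2 = n + 1})

/-- The differential
`v^{-p} u^{-q} m ↦ (-1)^p (v^{-p} u^{-q} d m + v^{-p} u^{-q+1} B m)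
  + v^{-p+1} u^{-q} ((-1)^q R + (-1)^p) m`. -/
def orbitsD (n : ℕ) : M.OrbitsX (n + 1) →ₗ[k] M.OrbitsX n :=
  LinearMap.pi fun i =>
    (-1 : ℤ) ^ i.1.1 • ((M.C.d (i.1.2.2 + 1) i.1.2.2).hom ∘ₗ
        LinearMap.proj (⟨(i.1.1, i.1.2.1, i.1.2.2 + 1), by have := i.2; dsimp only; omega⟩ :
          {i : ℕ × ℕ × ℕ // i.1 + 2 * i.2.1 + i.2.2 = n + 1}) +
      M.orbitsB n i.1.1 i.1.2.1 i.1.2.2 i.2) +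
    ((-1 : ℤ) ^ i.1.2.1 • M.R i.1.2.2 + (-1 : ℤ) ^ (i.1.1 + 1) • LinearMap.id) ∘ₗ
        LinearMap.proj (⟨(i.1.1 + 1, i.1.2.1, i.1.2.2), by have := i.2; dsimp only; omega⟩ :
          {i : ℕ × ℕ × ℕ // i.1 + 2 * i.2.1 + i.2.2 = n + 1})

lemma orbitsD_zero (n : ℕ) (f : M.OrbitsX (n + 1)) (p q : ℕ) (h : p + 2 * q + 0 = n) :
    M.orbitsD n f ⟨(p, q, 0), h⟩ =
      (-1 : ℤ) ^ p • M.C.d 1 0 (f ⟨(p, q, 1), by dsimp only; omega⟩) +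
      ((-1 : ℤ) ^ q • M.R 0 (f ⟨(p + 1, q, 0), by dsimp only; omega⟩) +
        (-1 : ℤ) ^ (p + 1) • f ⟨(p + 1, q, 0), by dsimp only; omega⟩) := by
  rw [← add_zero (M.C.d 1 0 _)]
  rfl

lemma orbitsD_succ (n : ℕ) (f : M.OrbitsX (n + 1)) (p q j : ℕ) (h : p + 2 * q + (j + 1) = n) :
    M.orbitsD n f ⟨(p, q, j + 1), h⟩ =
      (-1 : ℤ) ^ p • (M.C.d (j + 2) (j + 1) (f ⟨(p, q, j + 2), by dsimp only; omega⟩) +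
        M.B j (f ⟨(p, q + 1, j), by dsimp only; omega⟩)) +
      ((-1 : ℤ) ^ q • M.R (j + 1) (f ⟨(p + 1, q, j + 1), by dsimp only; omega⟩) +
        (-1 : ℤ) ^ (p + 1) • f ⟨(p + 1, q, j + 1), by dsimp only; omega⟩) := rfl

lemma orbitsD_orbitsD (n : ℕ) (f : M.OrbitsX (n + 2)) : M.orbitsD n (M.orbitsD (n + 1) f) = 0 := by
  funext ⟨⟨p, q, j⟩, h⟩
  dsimp only at h
  match j, h with
  | 0, h =>
    simp only [orbitsD_zero, orbitsD_succ, map_add, map_zsmul, d_d_apply, M.d_B_zero, M.d_R, M.R_R,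
      pow_succ, Pi.zero_apply]
    obtain hp | hp := neg_one_pow_eq_or ℤ p <;> obtain hq | hq := neg_one_pow_eq_or ℤ q <;>
      rw [hp, hq] <;> module
  | 1, h =>
    simp only [orbitsD_zero, orbitsD_succ, map_add, map_zsmul, d_d_apply, M.d_B, M.d_R, M.R_R,
      M.R_B, pow_succ, Pi.zero_apply]
    obtain hp | hp := neg_one_pow_eq_or ℤ p <;> obtain hq | hq := neg_one_pow_eq_or ℤ q <;>
      rw [hp, hq] <;> module
  | j + 2, h =>
    simp only [orbitsD_succ, map_add, map_zsmul, d_d_apply, M.d_B, M.B_B, M.d_R, M.R_R,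
      M.R_B, pow_succ, Pi.zero_apply]
    obtain hp | hp := neg_one_pow_eq_or ℤ p <;> obtain hq | hq := neg_one_pow_eq_or ℤ q <;>
      rw [hp, hq] <;> module

/-- The algebraic homotopy orbits `M_{hO(2)} = EO(2)_* ⊗ M` over `H_*(O(2); k)`, where
`EO(2)_* = E𝕋_* ⊗ (EC₂)_*` with `(EC₂)_* = k C₂ ⊗ k[v⁻¹]` the periodic resolution. As `EO(2)_*` is
free over `H_*(O(2); k)` on the monomials `v^{-p} u^{-q}` (of degree `p + 2 q`), this is
`M[v⁻¹, u⁻¹]` with the differential of `orbitsD`. -/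
def homotopyOrbits : ChainComplex (ModuleCat.{w} k) ℕ :=
  ChainComplex.of (fun n => ModuleCat.of k (M.OrbitsX n)) (fun n => ModuleCat.ofHom (M.orbitsD n))
    fun n => ModuleCat.hom_ext (LinearMap.ext (M.orbitsD_orbitsD n))

end OModule

end Modules

section Actions
open Simplicial

section Push
variable (k : Type u) [CommRing k] {X Y : Type v} [TopologicalSpace X] [TopologicalSpace Y]

/-- The map on singular chains induced by a continuous map. -/
def push (f : C(X, Y)) (n : ℕ) : Chain k X n →ₗ[k] Chain k Y n :=
  Finsupp.lmapDomain k k ((TopCat.toSSet.map (TopCat.ofHom f)).app (op ⦋n⦌))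

lemma toMap_toSSet_map (f : C(X, Y)) {n : SimplexCategoryᵒᵖ} (σ : (Sing X).obj n) (t) :
    toMap ((TopCat.toSSet.map (TopCat.ofHom f)).app n σ) t = f (toMap σ t) := rfl

lemma boundary_push (f : C(X, Y)) (n : ℕ) (c : Chain k X (n + 1)) :
    boundary k Y n (push k f (n + 1) c) = push k f n (boundary k X n c) := by
  induction c using Finsupp.induction_linear with
  | zero => simp
  | add a b ha hb => simp only [map_add, ha, hb]
  | single σ r =>
    simp only [boundary, LinearMap.sum_apply, LinearMap.smul_apply, map_sum, map_zsmul, push,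
      Finsupp.lmapDomain_apply, Finsupp.mapDomain_single]
    rfl

lemma push_cross {G : Type w} [TopologicalSpace G] [SMul G X] [ContinuousSMul G X]
    (φ : C(G, G)) (f : C(X, X)) (h : ∀ g x, f (g • x) = φ g • f x) (n : ℕ) (z : Chain k G 1)
    (c : Chain k X n) :
    push k f (n + 1) (cross k n z c) = cross k n (push k φ 1 z) (push k f n c) := by
  induction z using Finsupp.induction_linear with
  | zero => simp
  | add a b ha hb => simp only [map_add, LinearMap.add_apply, ha, hb]
  | single τ r =>
    induction c using Finsupp.induction_linear with
    | zero => simp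
    | add a b ha hb => simp only [map_add, ha, hb]
    | single σ s =>
      have key (i : Fin (n + 1)) :
          (TopCat.toSSet.map (TopCat.ofHom f)).app (op ⦋n + 1⦌) (prism i τ σ) =
            prism i ((TopCat.toSSet.map (TopCat.ofHom φ)).app (op ⦋1⦌) τ)
              ((TopCat.toSSet.map (TopCat.ofHom f)).app (op ⦋n⦌) σ) := by
        refine simplex_ext fun t => ?_
        rw [toMap_toSSet_map, prism, toMap_act, h, prism, toMap_act]
        rfl
      simp only [cross, Finsupp.linearCombination_single, LinearMap.smul_apply, map_smul, map_sum,
        map_zsmul, push, Finsupp.lmapDomain_apply, Finsupp.mapDomain_single, key]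

end Push

/-- The orthogonal group `O(2)`. -/
abbrev O2 : Type := Matrix.orthogonalGroup (Fin 2) ℝ

/-- The inclusion of the circle group `𝕋` into `O(2)` as the group of rotations. -/
def rotation : Circle →* O2 where
  toFun z := ⟨!![(z : ℂ).re, -(z : ℂ).im; (z : ℂ).im, (z : ℂ).re], by
    have h := Circle.normSq_coe z
    rw [Complex.normSq_apply] at h
    rw [Matrix.mem_orthogonalGroup_iff]
    ext i j
    fin_cases i <;> fin_cases j <;> simp [Matrix.mul_apply, Fin.sum_univ_two] <;> linarith⟩
  map_one' := by
    ext i j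
    fin_cases i <;> fin_cases j <;> simp
  map_mul' z w := by
    ext i j
    fin_cases i <;> fin_cases j <;>
      simp <;> ring

lemma continuous_rotation : Continuous rotation := by
  refine Continuous.subtype_mk ?_ _
  refine continuous_matrix fun i j => ?_
  fin_cases i <;> fin_cases j <;> simp <;> fun_prop

/-- The reflection `diag(1, -1)` in `O(2)`, which is complex conjugation on `ℝ² = ℂ`. -/
def reflection : O2 :=
  ⟨!![1, 0; 0, -1], by
    rw [Matrix.mem_orthogonalGroup_iff]
    ext i j
    fin_cases i <;> fin_cases j <;> simp [Matrix.mul_apply, Fin.sum_univ_two]⟩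

lemma reflection_mul_self : reflection * reflection = 1 := by
  ext i j
  fin_cases i <;> fin_cases j <;> simp [reflection]

lemma reflection_mul_rotation (z : Circle) :
    reflection * rotation z = rotation z⁻¹ * reflection := by
  ext i j
  fin_cases i <;> fin_cases j <;>
    simp [reflection, rotation]

/-- The underlying `𝕋`-space of an `O(2)`-space. -/
def Res (X : Type v) : Type v := X

instance (X : Type v) [TopologicalSpace X] : TopologicalSpace (Res X) :=
  inferInstanceAs (TopologicalSpace X)

instance (X : Type v) [MulAction O2 X] : MulAction Circle (Res X) :=
  MulAction.compHom X rotation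

lemma Res.smul_def {X : Type v} [MulAction O2 X] (z : Circle) (x : Res X) :
    z • x = (rotation z • (show X from x) : X) := rfl

instance (X : Type v) [TopologicalSpace X] [MulAction O2 X] [ContinuousSMul O2 X] :
    ContinuousSMul Circle (Res X) :=
  ⟨by
    have h : Continuous fun p : Circle × X => rotation p.1 • p.2 :=
      (continuous_rotation.comp continuous_fst).smul continuous_snd
    exact h⟩

/-- The affine singular simplex `t ↦ exp (2 π i ∑ aⱼ tⱼ)` of the circle. -/
def expSimplex {n : ℕ} (a : Fin (n + 1) → ℝ) : (Sing Circle) _⦋n⦌ :=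
  ofMap (n := op ⦋n⦌) ⟨fun t : stdSimplex ℝ (Fin (n + 1)) =>
    Circle.exp (2 * Real.pi * ∑ j, a j * t j), by
      have h (j : Fin (n + 1)) : Continuous fun t : stdSimplex ℝ (Fin (n + 1)) => t j :=
        (continuous_apply j).comp continuous_subtype_val
      exact Circle.exp.continuous.comp
        (continuous_const.mul (continuous_finsetSum _ fun j _ => continuous_const.mul (h j)))⟩

/-- The loop `[𝕋]`, `(t₀, t₁) ↦ exp (2 π i t₀)`, as a singular `1`-simplex of the circle. -/
def circleLoop : (Sing Circle) _⦋1⦌ := expSimplex ![1, 0]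

lemma toMap_circleLoop (t : stdSimplex ℝ (Fin 2)) :
    toMap circleLoop t = Circle.exp (2 * Real.pi * t 0) := by
  simp [circleLoop, expSimplex, Fin.sum_univ_two]

lemma toMap_expSimplex {n : ℕ} (a : Fin (n + 1) → ℝ) (t : stdSimplex ℝ (Fin (n + 1))) :
    toMap (expSimplex a) t = Circle.exp (2 * Real.pi * ∑ j, a j * t j) := by
  simp [expSimplex]

lemma map_expSimplex {m n : ℕ} (θ : ⦋m⦌ ⟶ ⦋n⦌) (a : Fin (n + 1) → ℝ) :
    (Sing Circle).map θ.op (expSimplex a) = expSimplex fun j : Fin (m + 1) => a (θ j) := by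
  refine simplex_ext fun t => ?_
  rw [toMap_map]
  refine (toMap_expSimplex a _).trans (Eq.trans ?_ (toMap_expSimplex _ t).symm)
  refine congrArg (fun r => Circle.exp (2 * Real.pi * r)) ?_
  change ∑ j : Fin (n + 1), a j * (FunOnFinite.linearMap ℝ ℝ θ t) j = _
  simp only [FunOnFinite.linearMap_apply_apply, Finset.mul_sum]
  rw [← Finset.sum_fiberwise Finset.univ (fun j : Fin (m + 1) => (θ j : Fin (n + 1)))]
  refine Finset.sum_congr rfl fun i _ => Finset.sum_congr rfl fun j hj => ?_
  rw [(Finset.mem_filter.1 hj).2]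

lemma expSimplex_add_int {n : ℕ} (a : Fin (n + 1) → ℝ) (m : ℤ) :
    expSimplex (fun j => a j + m) = expSimplex a := by
  refine simplex_ext fun t => ?_
  rw [toMap_expSimplex, toMap_expSimplex]
  have h : ∑ j, (a j + m) * t j = ∑ j, a j * t j + m := by
    simp only [add_mul, Finset.sum_add_distrib, ← Finset.mul_sum]
    erw [stdSimplex.sum_eq_one t]
    simp
  rw [h, mul_add, Circle.exp_add, mul_comm (2 * Real.pi) (m : ℝ), Circle.exp_intCast_mul]
  simp

/-- A fundamental cycle of the circle: a singular `1`-cycle in the homology class of the loop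
`circleLoop`. -/
def IsFundamentalCycle {k : Type u} [CommRing k] (z : Chain k Circle 1) : Prop :=
  ∃ w : Chain k Circle 2, z = Finsupp.single circleLoop 1 + boundary k Circle 1 w

/-- Complex conjugation on the circle. -/
def conjugation : C(Circle, Circle) := ⟨fun z => z⁻¹, continuous_inv⟩

lemma boundary_boundary (k : Type u) [CommRing k] (X : Type v) [TopologicalSpace X] (n : ℕ)
    (c : Chain k X (n + 2)) : boundary k X n (boundary k X (n + 1) c) = 0 := by
  have h := (singularChains k X).d_comp_d (n + 2) (n + 1) n
  rw [singularChains_d, singularChains_d] at h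
  exact congrArg (fun f => ModuleCat.Hom.hom f c) h

lemma IsFundamentalCycle.boundary_eq_zero {k : Type u} [CommRing k] {z : Chain k Circle 1}
    (hz : IsFundamentalCycle z) : boundary k Circle 0 z = 0 := by
  obtain ⟨w, rfl⟩ := hz
  rw [map_add, boundary_boundary, add_zero, boundary_zero_single, sub_eq_zero]
  congr 1
  change (Sing Circle).map (SimplexCategory.δ 0).op _ = (Sing Circle).map (SimplexCategory.δ 1).op _
  rw [circleLoop, map_expSimplex, map_expSimplex, ← expSimplex_add_int _ 1]
  congr 1
  funext j
  fin_cases j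
  change (![1, 0] : Fin 2 → ℝ) 1 + (1 : ℤ) = (![1, 0] : Fin 2 → ℝ) 0
  simp

/-- There are fundamental cycles that are reversed by complex conjugation, for example the
difference of the two arcs from `1` to `-1`. -/
theorem exists_isFundamentalCycle (k : Type u) [CommRing k] :
    ∃ z : Chain k Circle 1, IsFundamentalCycle z ∧ push k conjugation 1 z = -z := by
  refine ⟨Finsupp.single (expSimplex ![0, -1 / 2]) 1 - Finsupp.single (expSimplex ![0, 1 / 2]) 1,
    ⟨Finsupp.single (expSimplex ![0, -1 / 2, -1]) 1 - Finsupp.single (expSimplex ![0, 1 / 2, 0]) 1 -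
      Finsupp.single (expSimplex ![0, 0, 0]) 1, ?_⟩, ?_⟩
  · have h (a b c : ℝ) : boundary k Circle 1 (Finsupp.single (expSimplex ![a, b, c]) 1) =
        Finsupp.single (expSimplex ![b, c]) 1 - Finsupp.single (expSimplex ![a, c]) 1 +
          Finsupp.single (expSimplex ![a, b]) 1 := by
      have h' (i : Fin 3) : (Sing Circle).δ i (expSimplex ![a, b, c]) =
          expSimplex fun j : Fin 2 => (![a, b, c] : Fin 3 → ℝ) (i.succAbove j) :=
        map_expSimplex (SimplexCategory.δ i) ![a, b, c]
      have h0 : (fun j : Fin 2 => (![a, b, c] : Fin 3 → ℝ) ((0 : Fin 3).succAbove j)) = ![b, c] := by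
        funext j; fin_cases j <;> rfl
      have h1 : (fun j : Fin 2 => (![a, b, c] : Fin 3 → ℝ) ((1 : Fin 3).succAbove j)) = ![a, c] := by
        funext j; fin_cases j <;> rfl
      have h2 : (fun j : Fin 2 => (![a, b, c] : Fin 3 → ℝ) ((2 : Fin 3).succAbove j)) = ![a, b] := by
        funext j; fin_cases j <;> rfl
      simp [boundary, Fin.sum_univ_three, h', h1, h2]
      abel
    have e1 : expSimplex ![0, -1] = circleLoop := by
      rw [← expSimplex_add_int _ 1, circleLoop]
      congr 1
      funext j; fin_cases j <;> simp
    have e2 : expSimplex ![-1 / 2, -1] = expSimplex ![1 / 2, 0] := by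
      rw [← expSimplex_add_int _ 1]
      congr 1
      funext j; fin_cases j <;> norm_num
    simp only [map_sub, h, e1, e2]
    abel
  · have h (a b : ℝ) : (TopCat.toSSet.map (TopCat.ofHom conjugation)).app (op ⦋1⦌)
        (expSimplex ![a, b]) = expSimplex ![-a, -b] := by
      refine simplex_ext fun t => ?_
      rw [toMap_toSSet_map]
      refine Eq.trans (congrArg _ (toMap_expSimplex _ t))
        (Eq.trans ?_ (toMap_expSimplex _ t).symm)
      refine (Circle.exp_neg _).symm.trans (congrArg _ ?_)
      simp [Fin.sum_univ_two]
      ring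
    rw [map_sub]
    simp only [push, Finsupp.lmapDomain_apply, Finsupp.mapDomain_single, h]
    simp [neg_div]

section Modules
variable {k : Type u} [CommRing k] {z : Chain k Circle 1} (hz : IsFundamentalCycle z)

/-- The singular chains on a `𝕋`-space as a differential graded module over `H_*(𝕋; k)`: the
generator `B` acts by `B c = μ_*(z × c)`, where `z` is a fundamental cycle of `𝕋`. -/
def chainsTModule (Y : Type v) [TopologicalSpace Y] [MulAction Circle Y]
    [ContinuousSMul Circle Y] : TModule.{u, max u v} k where
  C := singularChains k Y
  B n := cross k n z
  d_B_zero x := by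
    rw [singularChains_d]
    refine (boundary_cross_zero k z x).trans ?_
    rw [hz.boundary_eq_zero, map_zero]
    rfl
  d_B n x := by
    rw [singularChains_d, singularChains_d]
    refine (boundary_cross k n z x).trans ?_
    rw [hz.boundary_eq_zero, map_zero]
    exact zero_sub _
  B_B n x := cross_cross k n z x

/-- The action of the reflection on an `O(2)`-space. -/
def reflectionMap (X : Type v) [TopologicalSpace X] [MulAction O2 X] [ContinuousSMul O2 X] :
    C(Res X, Res X) :=
  ⟨fun x => (reflection • (show X from x) : X), continuous_const_smul (T := X) reflection⟩

/-- The singular chains on an `O(2)`-space as a differential graded module over `H_*(O(2); k)`: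
the generator `B` acts by `B c = μ_*(z × c)`, where `z` is a fundamental cycle of `𝕋` that is
reversed by conjugation, and the generator `R` acts through the reflection. -/
def chainsOModule (hz' : push k conjugation 1 z = -z) (X : Type v) [TopologicalSpace X]
    [MulAction O2 X] [ContinuousSMul O2 X] : OModule.{u, max u v} k where
  toTModule := chainsTModule hz (Res X)
  R n := push k (reflectionMap X) n
  d_R n x := by
    change (singularChains k (Res X)).d (n + 1) n _ = push _ _ _ ((singularChains k (Res X)).d (n + 1) n _)
    rw [singularChains_d]
    exact boundary_push k (reflectionMap X) n x
  R_R n x := by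
    refine (LinearMap.congr_fun (Finsupp.lmapDomain_comp k k _ _).symm x).trans ?_
    refine (congrArg (fun g => Finsupp.lmapDomain k k g x) (funext fun σ => ?_)).trans
      (LinearMap.congr_fun (Finsupp.lmapDomain_id k k) x)
    refine simplex_ext fun t => ?_
    have key (x : X) : reflection • reflection • x = x := by
      rw [smul_smul, reflection_mul_self, one_smul]
    exact key _
  R_B n x := by
    refine (push_cross k conjugation (reflectionMap X) (fun g x => ?_) n z x).trans ?_
    · have key (y : X) : reflection • rotation g • y = rotation g⁻¹ • reflection • y := by
        rw [smul_smul, smul_smul, reflection_mul_rotation]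
      exact key x
    · rw [hz', map_neg]
      rfl

end Modules

end Actions

section Borel
variable (G : Type) [Group G] [TopologicalSpace G]

/-- `E` is a universal `G`-space: a contractible space with a continuous action of `G` such that
`E → E/G` is a principal `G`-bundle, that is, `E` is covered by `G`-invariant open subsets that
admit a continuous `G`-equivariant map to `G` (with its action by left multiplication). -/
structure IsUniversalSpace (E : Type v) [TopologicalSpace E] [MulAction G E] : Prop where
  continuousSMul : ContinuousSMul G E
  contractibleSpace : ContractibleSpace E
  exists_equivariant (e : E) : ∃ U : Set E, IsOpen U ∧ e ∈ U ∧ (∀ (g : G), ∀ x ∈ U, g • x ∈ U) ∧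
    ∃ φ : E → G, ContinuousOn φ U ∧ ∀ (g : G), ∀ x ∈ U, φ (g • x) = g * φ x

/-- The Borel construction `E ×_G X`: the orbit space of the diagonal action of `G` on `E × X`.
For a universal `G`-space `E` this is the homotopy orbit space `X_{hG}`. -/
abbrev Borel (E : Type v) (X : Type w) [MulAction G E] [MulAction G X] : Type max v w :=
  Quotient (MulAction.orbitRel G (E × X))

end Borel

section Existence

/-- The space of injective linear maps `ℝ² → ℝ^ℕ`, written as sequences of vectors. -/
def Frames : Type := {x : ℕ → Fin 2 → ℝ // ∀ w : Fin 2 → ℝ, w ≠ 0 → ∃ n, w ⬝ᵥ x n ≠ 0}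

namespace Frames
open Matrix

instance : TopologicalSpace Frames := inferInstanceAs (TopologicalSpace (Subtype _))

lemma orth (A : O2) : (A : Matrix (Fin 2) (Fin 2) ℝ)ᵀ * (A : Matrix (Fin 2) (Fin 2) ℝ) = 1 :=
  (Matrix.mem_orthogonalGroup_iff' (Fin 2) ℝ).1 A.2

lemma orth' (A : O2) : (A : Matrix (Fin 2) (Fin 2) ℝ) * (A : Matrix (Fin 2) (Fin 2) ℝ)ᵀ = 1 :=
  (Matrix.mem_orthogonalGroup_iff (Fin 2) ℝ).1 A.2

instance : MulAction O2 Frames where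
  smul A x := ⟨fun n => (A : Matrix (Fin 2) (Fin 2) ℝ) *ᵥ x.1 n, fun w hw => by
    obtain ⟨n, hn⟩ := x.2 (w ᵥ* (A : Matrix (Fin 2) (Fin 2) ℝ)) (fun h => hw (by
      have h' := congrArg (fun y => y ᵥ* (A : Matrix (Fin 2) (Fin 2) ℝ)ᵀ) h
      simpa [Matrix.vecMul_vecMul, orth'] using h'))
    exact ⟨n, by rwa [Matrix.dotProduct_mulVec]⟩⟩
  one_smul x := Subtype.ext (funext fun n => Matrix.one_mulVec (x.1 n))
  mul_smul A B x := Subtype.ext (funext fun n => (Matrix.mulVec_mulVec (x.1 n) A.1 B.1).symm)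

lemma smul_val (A : O2) (x : Frames) (n : ℕ) :
    (A • x).1 n = (A : Matrix (Fin 2) (Fin 2) ℝ) *ᵥ x.1 n := rfl

instance : ContinuousSMul O2 Frames :=
  ⟨Continuous.subtype_mk (continuous_pi fun n => by
    have h1 : Continuous fun p : O2 × Frames => (p.1 : Matrix (Fin 2) (Fin 2) ℝ) :=
      continuous_subtype_val.comp continuous_fst
    have h2 : Continuous fun p : O2 × Frames => p.2.1 n :=
      (continuous_apply n).comp (continuous_subtype_val.comp continuous_snd)
    exact h1.matrix_mulVec h2) _⟩

/-- The right shift. -/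
def shift (x : ℕ → Fin 2 → ℝ) : ℕ → Fin 2 → ℝ
  | 0 => 0
  | n + 1 => x n

lemma continuous_shift : Continuous shift :=
  continuous_pi fun n => match n with
    | 0 => continuous_const
    | n + 1 => continuous_apply n

lemma shift_mem (t : ℝ) (x : Frames) (w : Fin 2 → ℝ) (hw : w ≠ 0) :
    ∃ n, w ⬝ᵥ ((1 - t) • x.1 n + t • shift x.1 n) ≠ 0 := by
  by_contra! h
  simp only [dotProduct_add, dotProduct_smul, smul_eq_mul] at h
  obtain ⟨n, hn⟩ := x.2 w hw
  by_cases ht : 1 - t = 0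
  · have := h (n + 1)
    have ht' : t = 1 := by linarith
    simp only [ht', shift, sub_self, zero_mul, one_mul, zero_add] at this
    exact hn this
  · apply hn
    clear hn
    induction n with
    | zero =>
      have := h 0
      simpa [shift, ht] using this
    | succ n ih =>
      have := h (n + 1)
      simpa [shift, ht, ih] using this

/-- The straight-line homotopy from the identity to the shift. -/
def shiftHomotopy (p : unitInterval × Frames) : Frames :=
  ⟨fun n => (1 - (p.1 : ℝ)) • p.2.1 n + (p.1 : ℝ) • shift p.2.1 n, shift_mem _ _⟩

lemma continuous_shiftHomotopy : Continuous shiftHomotopy := by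
  have h1 : Continuous fun p : unitInterval × Frames => (p.1 : ℝ) :=
    continuous_subtype_val.comp continuous_fst
  have h2 : Continuous fun p : unitInterval × Frames => p.2.1 :=
    continuous_subtype_val.comp continuous_snd
  exact Continuous.subtype_mk (((continuous_const.sub h1).smul h2).add
    (h1.smul (continuous_shift.comp h2))) _

/-- The standard frame. -/
def std : ℕ → Fin 2 → ℝ
  | 0 => ![1, 0]
  | 1 => ![0, 1]
  | _ => 0

lemma std_mem (t : ℝ) (x : Frames) (w : Fin 2 → ℝ) (hw : w ≠ 0) :
    ∃ n, w ⬝ᵥ ((1 - t) • shift (shift x.1) n + t • std n) ≠ 0 := by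
  by_contra! h
  simp only [dotProduct_add, dotProduct_smul, smul_eq_mul] at h
  by_cases ht : t = 0
  · obtain ⟨n, hn⟩ := x.2 w hw
    have := h (n + 2)
    simp only [ht, shift, sub_zero, zero_mul, one_mul, add_zero] at this
    exact hn this
  · apply hw
    have h0 := h 0
    have h1 := h 1
    simp [shift, std, dotProduct, Fin.sum_univ_two, ht] at h0 h1
    funext i
    fin_cases i
    · exact h0
    · exact h1

def stdHomotopy (p : unitInterval × Frames) : Frames :=
  ⟨fun n => (1 - (p.1 : ℝ)) • shift (shift p.2.1) n + (p.1 : ℝ) • std n, std_mem _ _⟩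

lemma continuous_stdHomotopy : Continuous stdHomotopy := by
  have h1 : Continuous fun p : unitInterval × Frames => (p.1 : ℝ) :=
    continuous_subtype_val.comp continuous_fst
  have h2 : Continuous fun p : unitInterval × Frames => p.2.1 :=
    continuous_subtype_val.comp continuous_snd
  exact Continuous.subtype_mk (((continuous_const.sub h1).smul
    (continuous_shift.comp (continuous_shift.comp h2))).add (h1.smul continuous_const)) _

def shiftMap : C(Frames, Frames) :=
  ⟨fun x => shiftHomotopy (1, x), continuous_shiftHomotopy.comp (by fun_prop)⟩

lemma shiftMap_val (x : Frames) : (shiftMap x).1 = shift x.1 := by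
  funext n
  change (1 - (1 : ℝ)) • x.1 n + (1 : ℝ) • shift x.1 n = _
  simp

instance : Nonempty Frames := ⟨⟨std, fun w hw => by
  by_contra! h
  apply hw
  have h0 := h 0
  have h1 := h 1
  simp [std, dotProduct, Fin.sum_univ_two] at h0 h1
  funext i
  fin_cases i
  · exact h0
  · exact h1⟩⟩

instance : ContractibleSpace Frames := by
  rw [contractible_iff_id_nullhomotopic]
  have e1 : (ContinuousMap.id Frames).Homotopic shiftMap :=
    ⟨{ toFun := shiftHomotopy, continuous_toFun := continuous_shiftHomotopy,
       map_zero_left := fun x => Subtype.ext (funext fun n => by simp [shiftHomotopy]),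
       map_one_left := fun x => rfl }⟩
  have e2 : shiftMap.Homotopic (shiftMap.comp shiftMap) := e1.comp (.refl shiftMap)
  obtain ⟨x₀⟩ : Nonempty Frames := inferInstance
  refine ⟨stdHomotopy (1, x₀), e1.trans (e2.trans ⟨{
    toFun := stdHomotopy, continuous_toFun := continuous_stdHomotopy,
    map_zero_left := fun x => Subtype.ext (funext fun n => ?_),
    map_one_left := fun x => Subtype.ext (funext fun n => ?_) }⟩)⟩
  · simp [stdHomotopy, shiftMap_val]
  · change (1 - (1 : ℝ)) • _ + (1 : ℝ) • std n = (1 - (1 : ℝ)) • _ + (1 : ℝ) • std n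
    simp

/-- The determinant of two of the vectors. -/
def minor (i j : ℕ) (x : Frames) : ℝ := x.1 i 0 * x.1 j 1 - x.1 i 1 * x.1 j 0

lemma continuous_coord (i : ℕ) (a : Fin 2) : Continuous fun x : Frames => x.1 i a :=
  (continuous_apply a).comp ((continuous_apply i).comp continuous_subtype_val)

lemma continuous_minor (i j : ℕ) : Continuous (minor i j) := by
  exact ((continuous_coord i 0).mul (continuous_coord j 1)).sub
    ((continuous_coord i 1).mul (continuous_coord j 0))

lemma exists_minor (x : Frames) : ∃ i j, minor i j x ≠ 0 := by
  obtain ⟨i, hi⟩ := x.2 ![1, 0] (fun h => by simpa using congrFun h 0)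
  obtain ⟨j, hj⟩ := x.2 ![-x.1 i 1, x.1 i 0] (fun h => hi (by
    have := congrFun h 1
    simp at this
    simp [dotProduct, Fin.sum_univ_two, this]))
  refine ⟨i, j, ?_⟩
  simp [dotProduct, Fin.sum_univ_two] at hj
  intro h
  apply hj
  unfold minor at h
  linarith

lemma entries (A : O2) : A.1 0 0 ^ 2 + A.1 1 0 ^ 2 = 1 ∧ A.1 0 1 ^ 2 + A.1 1 1 ^ 2 = 1 ∧
    A.1 0 0 * A.1 0 1 + A.1 1 0 * A.1 1 1 = 0 := by
  have h := orth A
  have h00 := congrFun (congrFun h 0) 0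
  have h01 := congrFun (congrFun h 0) 1
  have h11 := congrFun (congrFun h 1) 1
  simp [Matrix.mul_apply, Fin.sum_univ_two] at h00 h01 h11
  refine ⟨?_, ?_, ?_⟩ <;> linarith

lemma minor_smul (A : O2) (i j : ℕ) (x : Frames) :
    minor i j (A • x) = (A.1 0 0 * A.1 1 1 - A.1 0 1 * A.1 1 0) * minor i j x := by
  simp only [minor, smul_val, mulVec, dotProduct, Fin.sum_univ_two]
  ring


lemma det_sq (A : O2) : (A.1 0 0 * A.1 1 1 - A.1 0 1 * A.1 1 0) ^ 2 = 1 := by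
  obtain ⟨h1, h2, h3⟩ := entries A
  linear_combination h1 * (A.1 0 1 ^ 2 + A.1 1 1 ^ 2) + h2 -
    (A.1 0 0 * A.1 0 1 + A.1 1 0 * A.1 1 1) * h3

/-- The Gram--Schmidt frame of two of the vectors. -/
def gram (i j : ℕ) (x : Frames) : Matrix (Fin 2) (Fin 2) ℝ :=
  let r := √(x.1 i 0 ^ 2 + x.1 i 1 ^ 2)
  let s := minor i j x / |minor i j x|
  !![x.1 i 0 / r, -(s * x.1 i 1 / r); x.1 i 1 / r, s * x.1 i 0 / r]

lemma sq_pos_of_minor {i j : ℕ} {x : Frames} (h : minor i j x ≠ 0) :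
    0 < x.1 i 0 ^ 2 + x.1 i 1 ^ 2 := by
  by_contra! h'
  have h0 : x.1 i 0 = 0 := by nlinarith [sq_nonneg (x.1 i 0), sq_nonneg (x.1 i 1)]
  have h1 : x.1 i 1 = 0 := by nlinarith [sq_nonneg (x.1 i 0), sq_nonneg (x.1 i 1)]
  exact h (by simp [minor, h0, h1])

lemma gram_mem {i j : ℕ} {x : Frames} (h : minor i j x ≠ 0) :
    gram i j x ∈ Matrix.orthogonalGroup (Fin 2) ℝ := by
  rw [Matrix.mem_orthogonalGroup_iff']
  have hr := sq_pos_of_minor h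
  have hr' : √(x.1 i 0 ^ 2 + x.1 i 1 ^ 2) ≠ 0 := (Real.sqrt_pos.2 hr).ne'
  have hr2 := Real.sq_sqrt hr.le
  have hs : (minor i j x / |minor i j x|) ^ 2 = 1 := by
    rw [div_pow, sq_abs, div_self (pow_ne_zero 2 h)]
  unfold gram
  generalize √(x.1 i 0 ^ 2 + x.1 i 1 ^ 2) = r at *
  generalize minor i j x / |minor i j x| = s at *
  ext a b
  fin_cases a <;> fin_cases b <;> simp [Matrix.mul_apply, Fin.sum_univ_two] <;> field_simp
  · linear_combination -hr2
  · ring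
  · ring
  · linear_combination (x.1 i 0 ^ 2 + x.1 i 1 ^ 2) * hs - hr2

lemma gram_smul (A : O2) {i j : ℕ} {x : Frames} :
    gram i j (A • x) = A.1 * gram i j x := by
  have hd := det_sq A
  obtain ⟨h1, h2, h3⟩ := entries A
  have hr : (A • x).1 i 0 ^ 2 + (A • x).1 i 1 ^ 2 = x.1 i 0 ^ 2 + x.1 i 1 ^ 2 := by
    simp only [smul_val, mulVec, dotProduct, Fin.sum_univ_two]
    linear_combination x.1 i 0 ^ 2 * h1 + x.1 i 1 ^ 2 * h2 + 2 * x.1 i 0 * x.1 i 1 * h3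
  have habs : |A.1 0 0 * A.1 1 1 - A.1 0 1 * A.1 1 0| = 1 := by
    rw [← sq_eq_sq₀ (abs_nonneg _) zero_le_one, sq_abs, hd, one_pow]
  have hs : minor i j (A • x) / |minor i j (A • x)| =
      (A.1 0 0 * A.1 1 1 - A.1 0 1 * A.1 1 0) * (minor i j x / |minor i j x|) := by
    rw [minor_smul, abs_mul, habs, one_mul, mul_div_assoc]
  have k1 : (A.1 0 0 * A.1 1 1 - A.1 0 1 * A.1 1 0) * A.1 0 0 = A.1 1 1 := by
    linear_combination A.1 1 1 * h1 - A.1 1 0 * h3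
  have k2 : (A.1 0 0 * A.1 1 1 - A.1 0 1 * A.1 1 0) * A.1 0 1 = -A.1 1 0 := by
    linear_combination A.1 1 1 * h3 - A.1 1 0 * h2
  have k3 : (A.1 0 0 * A.1 1 1 - A.1 0 1 * A.1 1 0) * A.1 1 0 = -A.1 0 1 := by
    linear_combination A.1 0 0 * h3 - A.1 0 1 * h1
  have k4 : (A.1 0 0 * A.1 1 1 - A.1 0 1 * A.1 1 0) * A.1 1 1 = A.1 0 0 := by
    linear_combination A.1 0 0 * h2 - A.1 0 1 * h3
  unfold gram
  rw [hr, hs]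
  generalize √(x.1 i 0 ^ 2 + x.1 i 1 ^ 2) = r
  generalize minor i j x / |minor i j x| = s
  ext a b
  fin_cases a <;> fin_cases b <;>
    simp [Matrix.mul_apply, Fin.sum_univ_two, smul_val, mulVec, dotProduct]
  · ring
  · linear_combination (-s * x.1 i 0 / r) * k3 - (s * x.1 i 1 / r) * k4
  · ring
  · linear_combination (s * x.1 i 0 / r) * k1 + (s * x.1 i 1 / r) * k2

lemma continuousOn_gram (i j : ℕ) : ContinuousOn (gram i j) {x | minor i j x ≠ 0} := by
  intro x hx
  refine ContinuousAt.continuousWithinAt ?_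
  have hr : √(x.1 i 0 ^ 2 + x.1 i 1 ^ 2) ≠ 0 := (Real.sqrt_pos.2 (sq_pos_of_minor hx)).ne'
  have c0 := (continuous_coord i 0).continuousAt (x := x)
  have c1 := (continuous_coord i 1).continuousAt (x := x)
  have cm := (continuous_minor i j).continuousAt (x := x)
  have cr : ContinuousAt (fun x : Frames => √(x.1 i 0 ^ 2 + x.1 i 1 ^ 2)) x :=
    ((c0.pow 2).add (c1.pow 2)).sqrt
  have cs : ContinuousAt (fun x : Frames => minor i j x / |minor i j x|) x :=
    cm.div cm.abs (abs_ne_zero.2 hx)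
  refine continuousAt_pi.2 fun a => continuousAt_pi.2 fun b => ?_
  fin_cases a <;> fin_cases b
  · exact c0.div cr hr
  · exact ((cs.mul c1).div cr hr).neg
  · exact c1.div cr hr
  · exact (cs.mul c0).div cr hr

theorem isUniversalSpace : IsUniversalSpace O2 Frames where
  continuousSMul := inferInstance
  contractibleSpace := inferInstance
  exists_equivariant e := by
    classical
    obtain ⟨i, j, hij⟩ := exists_minor e
    have hU (g : O2) (x : Frames) (hx : minor i j x ≠ 0) : minor i j (g • x) ≠ 0 := by
      rw [minor_smul]
      refine mul_ne_zero (fun h => ?_) hx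
      have := det_sq g
      rw [h] at this
      norm_num at this
    refine ⟨{x | minor i j x ≠ 0}, isOpen_ne_fun (continuous_minor i j) continuous_const, hij, hU,
      fun x => if h : minor i j x ≠ 0 then ⟨gram i j x, gram_mem h⟩ else 1, ?_, ?_⟩
    · rw [Topology.IsInducing.subtypeVal.continuousOn_iff]
      refine (continuousOn_gram i j).congr fun x hx => ?_
      have hx' : minor i j x ≠ 0 := hx
      simp only [Function.comp_apply, dif_pos hx']
    · intro g x hx
      have hx' : minor i j x ≠ 0 := hx
      simp only [dif_pos hx', dif_pos (hU g x hx')]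
      exact Subtype.ext (gram_smul g)

end Frames

lemma IsUniversalSpace.uliftSpace {G : Type} [Group G] [TopologicalSpace G] {E : Type w}
    [TopologicalSpace E] [MulAction G E] (h : IsUniversalSpace G E) :
    IsUniversalSpace G (ULift.{v} E) where
  continuousSMul := by
    have := h.continuousSMul
    exact ⟨continuous_uliftUp.comp
      (continuous_fst.smul (continuous_uliftDown.comp continuous_snd))⟩
  contractibleSpace :=
    have := h.contractibleSpace
    Homeomorph.ulift.contractibleSpace
  exists_equivariant e := by
    obtain ⟨U, hU, he, hs, φ, hφ, hg⟩ := h.exists_equivariant e.down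
    exact ⟨ULift.down ⁻¹' U, hU.preimage continuous_uliftDown, he, fun g x hx => hs g x.down hx,
      fun x => φ x.down, hφ.comp continuous_uliftDown.continuousOn fun _ hx => hx,
      fun g x hx => hg g x.down hx⟩

/-- The first column of an orthogonal matrix, as an element of the circle. -/
def column (A : O2) : Circle :=
  ⟨⟨A.1 0 0, A.1 1 0⟩, by
    refine mem_sphere_zero_iff_norm.2 ?_
    rw [Complex.norm_def, Complex.normSq_apply, Real.sqrt_eq_one]
    have := (Frames.entries A).1
    dsimp only
    linarith⟩

lemma continuous_column : Continuous column := by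
  refine Continuous.subtype_mk ?_ _
  have h (i : Fin 2) : Continuous fun A : O2 => A.1 i 0 :=
    (continuous_apply_apply i 0).comp continuous_subtype_val
  exact Complex.equivRealProdCLM.symm.continuous.comp ((h 0).prodMk (h 1))

lemma coe_column (A : O2) : (column A : ℂ) = ⟨A.1 0 0, A.1 1 0⟩ := rfl

lemma column_rotation_mul (z : Circle) (A : O2) : column (rotation z * A) = z * column A := by
  refine Circle.ext (Complex.ext ?_ ?_) <;>
    simp [coe_column, rotation, Matrix.mul_apply, Fin.sum_univ_two]
  · ring
  · ring

/-- A universal `O(2)`-space is also a universal `𝕋`-space. -/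
theorem IsUniversalSpace.res {E : Type v} [TopologicalSpace E] [MulAction O2 E]
    (h : IsUniversalSpace O2 E) : IsUniversalSpace Circle (Res E) where
  continuousSMul :=
    have := h.continuousSMul
    inferInstance
  contractibleSpace := h.contractibleSpace
  exists_equivariant e := by
    obtain ⟨U, hU, he, hs, φ, hφ, hg⟩ := h.exists_equivariant e
    refine ⟨U, hU, he, fun g x hx => hs (rotation g) x hx, fun x => column (φ x),
      continuous_column.comp_continuousOn hφ, fun g x hx => ?_⟩
    exact (congrArg column (hg (rotation g) x hx)).trans (column_rotation_mul _ _)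

/-- Universal `O(2)`-spaces and universal `𝕋`-spaces exist. -/
theorem exists_isUniversalSpace :
    (∃ (E : Type v) (_ : TopologicalSpace E) (_ : MulAction O2 E), IsUniversalSpace O2 E) ∧
    ∃ (E : Type v) (_ : TopologicalSpace E) (_ : MulAction Circle E), IsUniversalSpace Circle E :=
  ⟨⟨ULift.{v} Frames, inferInstance, inferInstance, Frames.isUniversalSpace.uliftSpace⟩,
    ⟨ULift.{v} (Res Frames), inferInstance, inferInstance,
      Frames.isUniversalSpace.res.uliftSpace⟩⟩

end Existence

end HomotopyOrbits

end

open HomotopyOrbits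

/-! Put `Y = E × X` with the diagonal action of `G`, the circle or `O(2)`. As `E` is contractible,
the equivariant projection `Y → X` is a quasi-isomorphism on singular chains, and filtering by
powers of `u` and `v` shows that algebraic homotopy orbits preserve quasi-isomorphisms. All
complexes involved are degreewise free, so the resulting map `S_*(Y)_{hG} → S_*(X)_{hG}` has an
inverse up to homotopy. It remains to compare `S_*(Y)_{hG}` with `S_*(Y/G)` when `Y → Y/G` is a
principal bundle (`LocallyTrivial`).

For the circle, the comparison map `orbitsTo` is zero on positive powers of `u⁻¹` and sends `u⁰ c`
to the normalized image of `c`. It is a chain map because the simplices of `z × c` become degenerate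
in the orbit space, so normalization kills every `B c`. If `Y` has an equivariant map to the circle,
then `Y` is covered by `ℝ × Y/𝕋`, with deck transformation `T`. The exact sequence `0 → S_*(ℝ × Y/𝕋)
→ S_*(ℝ × Y/𝕋) → S_*(Y) → 0`, whose first map is `1 - T`, together with a lift of `z` to a chain
`z'` on `ℝ` with boundary `[0] - [2π]`, shows that the homology of `S_*(Y)` is two copies of that of
`Y/𝕋`, interchanged by `B` in the expected way. By `TModule.coneAcyclic_of_section`, passing to
homotopy orbits then leaves one copy.

A general principal circle bundle is resolved by the spaces `𝕋^p × Y` with diagonal action. For `p ≥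
1` the first coordinate is an equivariant map to the circle. The alternating sums of the projections
give exact rows, both for the spaces and for their orbit spaces; the latter rests on the fact that
simplices of `Y/𝕋` lift to `Y` and that the simplices of `𝕋` act freely and transitively on the
lifts. A double complex argument (`ConeAcyclic.of_resolution`) transfers the result from `p ≥ 1` to
`p = 0`.

For `O(2)`, one has `M_{hO(2)} = (M_{h𝕋})_{hC₂}`, where the involution acts on `u^{-q} m` by `(-1)^q
R`. The comparison for the circle is compatible with the involutions. Reflection permutes the
simplices of `Y/𝕋` freely, with orbits the simplices of `Y/O(2)`, so `S_*(Y/𝕋)_{hC₂} → S_*(Y/O(2))`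
is a quasi-isomorphism (`InvolutiveComplex.coneAcyclic_augmentation`). -/

noncomputable section
namespace HomotopyOrbits

/-! ### Acyclic mapping cones and quasi-isomorphisms -/

section Algebra
variable {k : Type u} [CommRing k]

/-- An elementwise form of the acyclicity of the mapping cone of a chain map. -/
structure ConeAcyclic {C D : ChainComplex (ModuleCat.{w} k) ℕ} (f : C ⟶ D) : Prop where
  zero (d : D.X 0) : ∃ (c : C.X 0) (d' : D.X 1), f.f 0 c - d = D.d 1 0 d'
  pair (n : ℕ) (c : C.X n) (d : D.X (n + 1)) (hc : ∀ m, C.d n m c = 0)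
    (h : f.f n c = D.d (n + 1) n d) :
    ∃ (c' : C.X (n + 1)) (d' : D.X (n + 2)), C.d (n + 1) n c' = c ∧
      f.f (n + 1) c' - d = D.d (n + 2) (n + 1) d'

lemma d_comp_apply (C : ChainComplex (ModuleCat.{w} k) ℕ) (i j l : ℕ) (x : C.X i) :
    C.d j l (C.d i j x) = 0 := by
  rw [← ModuleCat.comp_apply, C.d_comp_d]
  rfl

lemma f_d_apply {C D : ChainComplex (ModuleCat.{w} k) ℕ} (f : C ⟶ D) (i j : ℕ) (x : C.X i) :
    f.f j (C.d i j x) = D.d i j (f.f i x) := by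
  rw [← ModuleCat.comp_apply, ← ModuleCat.comp_apply, f.comm]

lemma cycle_zero (C : ChainComplex (ModuleCat.{w} k) ℕ) (x : C.X 0) (m : ℕ) : C.d 0 m x = 0 := by
  rw [C.shape _ _ (by simp)]
  rfl

lemma cycle_succ (C : ChainComplex (ModuleCat.{w} k) ℕ) {n : ℕ} {x : C.X (n + 1)}
    (h : C.d (n + 1) n x = 0) (m : ℕ) : C.d (n + 1) m x = 0 := by
  by_cases hm : m = n
  · subst hm; exact h
  · rw [C.shape _ _ (by simpa [ComplexShape.down_Rel] using hm)]
    rfl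

lemma cycle_next (C : ChainComplex (ModuleCat.{w} k) ℕ) {n : ℕ} {x : C.X n}
    (h : C.d n ((ComplexShape.down ℕ).next n) x = 0) (m : ℕ) : C.d n m x = 0 := by
  by_cases hm : (ComplexShape.down ℕ).Rel n m
  · rwa [(ComplexShape.down ℕ).next_eq' hm] at h
  · rw [C.shape _ _ hm]
    rfl

/-- A chain map is acyclic if it is injective and surjective on homology. -/
lemma ConeAcyclic.of_injective_surjective {C D : ChainComplex (ModuleCat.{w} k) ℕ} {f : C ⟶ D}
    (inj : ∀ (n : ℕ) (c : C.X n) (d : D.X (n + 1)), (∀ m, C.d n m c = 0) →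
      f.f n c = D.d (n + 1) n d → ∃ c', C.d (n + 1) n c' = c)
    (surj : ∀ (n : ℕ) (d : D.X n), (∀ m, D.d n m d = 0) → ∃ (c : C.X n) (d' : D.X (n + 1)),
      (∀ m, C.d n m c = 0) ∧ f.f n c - d = D.d (n + 1) n d') : ConeAcyclic f where
  zero d := by
    obtain ⟨c, d', -, h⟩ := surj 0 d (cycle_zero D d)
    exact ⟨c, d', h⟩
  pair n c d hc h := by
    obtain ⟨c₀, h₀⟩ := inj n c d hc h
    -- Any `c₀` bounding `c` leaves the error `f c₀ - d`, which is a cycle. Surjectivity on homology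
    -- provides the cycle `c₁` by which `c₀` has to be corrected.
    obtain ⟨c₁, d', h₁, h₂⟩ := surj (n + 1) (f.f (n + 1) c₀ - d) (cycle_succ D (by
      rw [map_sub, ← f_d_apply, h₀, h, sub_self]))
    refine ⟨c₀ - c₁, -d', ?_, ?_⟩
    · rw [map_sub, h₀, h₁, sub_zero]
    · rw [map_sub, map_neg, ← h₂]
      abel

/-- In positive degrees this is acyclicity of the cone applied to the cone cycle `(0, d)`. -/
lemma ConeAcyclic.exists_cycle {C D : ChainComplex (ModuleCat.{w} k) ℕ} {f : C ⟶ D}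
    (hf : ConeAcyclic f) (n : ℕ) (d : D.X n) (hd : ∀ m, D.d n m d = 0) :
    ∃ (c : C.X n) (d' : D.X (n + 1)), (∀ m, C.d n m c = 0) ∧
      f.f n c - d = D.d (n + 1) n d' := by
  match n with
  | 0 =>
    obtain ⟨c, d', h⟩ := hf.zero d
    exact ⟨c, d', cycle_zero C c, h⟩
  | n + 1 =>
    obtain ⟨c, d', h, h'⟩ := hf.pair n 0 d (by simp) (by rw [hd, map_zero])
    exact ⟨c, d', cycle_succ C h, h'⟩

/-- The linear map on the free module on the elements of `A` determined by a function. -/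
def freeLift {A B : ModuleCat.{max u v} k} (g : A → B) :
    ModuleCat.of k (A →₀ k) ⟶ B := ModuleCat.ofHom (Finsupp.linearCombination k g)

/-- Preimages chosen element by element do not depend linearly on the element. The criteria for
homology "up to refinements" allow `A` to be replaced by the free module on its underlying set, on
which any choice extends linearly. -/
lemma epi_freeLift_id (A : ModuleCat.{max u v} k) : Epi (freeLift (fun a : A => a)) := by
  rw [ModuleCat.epi_iff_surjective]
  intro a
  exact ⟨Finsupp.single a 1, by simp [freeLift]⟩

lemma freeLift_comp {A B D : ModuleCat.{max u v} k} (g : A → B) (h : B ⟶ D) :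
    freeLift g ≫ h = freeLift fun a => h (g a) := by
  refine ModuleCat.hom_ext (Finsupp.lhom_ext' fun σ => LinearMap.ext_ring ?_)
  simp [freeLift]

/-- A chain map with acyclic mapping cone is a quasi-isomorphism. -/
theorem ConeAcyclic.quasiIso {C D : ChainComplex (ModuleCat.{max u v} k) ℕ} {f : C ⟶ D}
    (hf : ConeAcyclic f) : QuasiIso f := by
  rw [quasiIso_iff]
  intro n
  rw [quasiIsoAt_iff_isIso_homologyMap]
  have h1 : Mono (HomologicalComplex.homologyMap f n) := by
    rw [HomologicalComplex.mono_homologyMap_iff_up_to_refinements f (n + 1) n _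
      (ChainComplex.prev ℕ n) rfl]
    intro A x hx y hy
    have key (a : A) : ∃ c : C.X (n + 1), C.d (n + 1) n c = x a := by
      obtain ⟨c', -, h, -⟩ := hf.pair n (x a) (y a)
        (cycle_next C (congrArg (fun g => ModuleCat.Hom.hom g a) hx))
        (congrArg (fun g => ModuleCat.Hom.hom g a) hy)
      exact ⟨c', h⟩
    choose g hg using key
    refine ⟨_, freeLift (fun a : A => a), epi_freeLift_id A, freeLift g, ?_⟩
    rw [freeLift_comp, freeLift_comp]
    simp only [hg]
  have h2 : Epi (HomologicalComplex.homologyMap f n) := by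
    rw [HomologicalComplex.epi_homologyMap_iff_up_to_refinements f (n + 1) n _
      (ChainComplex.prev ℕ n) rfl]
    intro A y hy
    have key (a : A) := hf.exists_cycle n (y a)
      (cycle_next D (congrArg (fun g => ModuleCat.Hom.hom g a) hy))
    choose g e hg he using key
    refine ⟨_, freeLift (fun a : A => a), epi_freeLift_id A, freeLift g, ?_, -freeLift e, ?_⟩
    · rw [freeLift_comp]
      simp only [hg]
      refine ModuleCat.hom_ext (Finsupp.lhom_ext' fun σ => LinearMap.ext_ring ?_)
      simp [freeLift]
    · rw [Preadditive.neg_comp, freeLift_comp, freeLift_comp, freeLift_comp]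
      simp only [← he]
      refine ModuleCat.hom_ext (Finsupp.lhom_ext' fun σ => LinearMap.ext_ring ?_)
      simp [freeLift]
  exact isIso_of_mono_of_epi _

/-- A quasi-isomorphism of degreewise projective complexes can be inverted. -/
lemma exists_quasiIso_inv {C D : ChainComplex (ModuleCat.{max u v} k) ℕ}
    [∀ n, Module.Projective k (C.X n)] [∀ n, Module.Projective k (D.X n)] (f : C ⟶ D)
    (hf : QuasiIso f) : ∃ g : D ⟶ C, QuasiIso g := by
  have (n : ℕ) : Projective (C.X n) := (IsProjective.iff_projective (C.X n)).1 inferInstance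
  have (n : ℕ) : Projective (D.X n) := (IsProjective.iff_projective (D.X n)).1 inferInstance
  -- Between bounded below complexes of projectives a quasi-isomorphism is a homotopy equivalence,
  -- so a homotopy inverse will do.
  obtain ⟨e, -⟩ := (ChainComplex.quasiIso_iff_of_projective f).1 hf
  exact ⟨e.inv, e.symm.quasiIso_hom⟩

end Algebra
end HomotopyOrbits
end

noncomputable section
namespace HomotopyOrbits

/-! ### Filtrations, and homotopy orbits for the circle -/

section Filtration
variable {k : Type u} [CommRing k]

/-- Acyclicity of the mapping cone can be checked by successively removing leading terms. -/
lemma ConeAcyclic.of_filtration {C D : ChainComplex (ModuleCat.{w} k) ℕ} {f : C ⟶ D}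
    (V : ℕ → ∀ n, C.X n → Prop) (W : ℕ → ∀ n, D.X n → Prop)
    (hV : ∀ n c, V 0 n c → c = 0) (hW : ∀ n d, W 0 n d → d = 0)
    (ex : ∀ n c d, ∃ P, V P n c ∧ W P (n + 1) d)
    (zero : ∀ d : D.X 0, ∃ (c : C.X 0) (d' : D.X 1), f.f 0 c - d = D.d 1 0 d')
    (step : ∀ P n c d, V (P + 1) n c → W (P + 1) (n + 1) d → (∀ m, C.d n m c = 0) →
      f.f n c = D.d (n + 1) n d → ∃ s t, V P n (c - C.d (n + 1) n s) ∧
        W P (n + 1) (d - f.f (n + 1) s + D.d (n + 2) (n + 1) t)) : ConeAcyclic f where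
  zero := zero
  pair n c d hc h := by
    obtain ⟨P, hP, hP'⟩ := ex n c d
    induction P generalizing c d with
    | zero =>
      obtain rfl := hV n c hP
      obtain rfl := hW _ d hP'
      exact ⟨0, 0, by simp, by simp⟩
    | succ P ih =>
      -- The boundary of `(s, t)` in the cone is `(∂s, f s - ∂t)`. Subtracting it leaves a cone
      -- cycle of lower filtration, to which induction applies.
      obtain ⟨s, t, hs, ht⟩ := step P n c d hP hP' hc h
      obtain ⟨c', d', h1, h2⟩ := ih (c - C.d (n + 1) n s) _
        (fun m => by rw [map_sub, hc, d_comp_apply, sub_zero])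
        (by rw [map_sub, map_add, map_sub, d_comp_apply, f_d_apply, h, add_zero]) hs ht
      refine ⟨c' + s, d' + t, by rw [map_add, h1, sub_add_cancel], ?_⟩
      rw [map_add, map_add, ← h2]
      abel

end Filtration

namespace TModule
variable {k : Type u} [CommRing k]

/-- A morphism of differential graded `H_*(𝕋; k)`-modules. -/
structure Hom (M N : TModule.{u, w} k) where
  f : M.C ⟶ N.C
  f_B (n : ℕ) (x : M.C.X n) : f.f (n + 1) (M.B n x) = N.B n (f.f n x)

variable {M N : TModule.{u, w} k}

lemma homotopyOrbits_d (M : TModule.{u, w} k) (n : ℕ) :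
    M.homotopyOrbits.d (n + 1) n = ModuleCat.ofHom (M.orbitsD n) :=
  ChainComplex.of_d (fun n => ModuleCat.of k (M.OrbitsX n)) (fun n => ModuleCat.ofHom (M.orbitsD n)) n

lemma homotopyOrbits_d_apply (M : TModule.{u, w} k) (n : ℕ) (x : M.OrbitsX (n + 1)) :
    M.homotopyOrbits.d (n + 1) n x = M.orbitsD n x := by
  rw [homotopyOrbits_d]
  rfl

/-- The chain map on homotopy orbits induced by a family of maps that commutes with the
differentials. -/
def orbitsHom {C : ChainComplex (ModuleCat.{w} k) ℕ} (M : TModule.{u, w} k)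
    (f : ∀ n, M.OrbitsX n →ₗ[k] C.X n)
    (h : ∀ n x, C.d (n + 1) n (f (n + 1) x) = f n (M.orbitsD n x)) : M.homotopyOrbits ⟶ C where
  f n := ModuleCat.ofHom (f n)
  comm' i j hij := by
    obtain rfl : j + 1 = i := hij
    rw [homotopyOrbits_d]
    exact ModuleCat.hom_ext (LinearMap.ext fun x => h j x)

/-- The component of the differential. -/
lemma orbitsD_apply (M : TModule.{u, w} k) (n : ℕ) (x : M.OrbitsX (n + 1)) (q j : ℕ)
    (h : 2 * q + j = n) : M.orbitsD n x ⟨(q, j), h⟩ =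
      M.C.d (j + 1) j (x ⟨(q, j + 1), by dsimp only; omega⟩) + M.orbitsB n q j h x := rfl

lemma orbitsB_eq_zero (M : TModule.{u, w} k) (n : ℕ) (x : M.OrbitsX (n + 1)) (q j : ℕ)
    (h : 2 * q + j = n) (hx : ∀ i, i.1.1 = q + 1 → x i = 0) : M.orbitsB n q j h x = 0 := by
  cases j with
  | zero => rfl
  | succ j =>
    exact (congrArg (M.B j) (hx ⟨(q + 1, j), by dsimp only; omega⟩ rfl)).trans (map_zero _)

/-- The element `u^{-q} x` of the homotopy orbits. -/
def monomial (M : TModule.{u, w} k) {n : ℕ} (q j : ℕ) (h : 2 * q + j = n) (x : M.C.X j) :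
    M.OrbitsX n :=
  Pi.single (M := fun i : {i : ℕ × ℕ // 2 * i.1 + i.2 = n} => M.C.X i.1.2) ⟨(q, j), h⟩ x

lemma monomial_same (M : TModule.{u, w} k) {n : ℕ} (q j : ℕ) (h : 2 * q + j = n) (x : M.C.X j) :
    M.monomial q j h x ⟨(q, j), h⟩ = x := Pi.single_eq_same _ _

lemma monomial_ne (M : TModule.{u, w} k) {n : ℕ} (q j : ℕ) (h : 2 * q + j = n) (x : M.C.X j)
    (i : {i : ℕ × ℕ // 2 * i.1 + i.2 = n}) (hi : i.1.1 ≠ q) : M.monomial q j h x i = 0 :=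
  Pi.single_eq_of_ne (fun e => hi (by rw [e])) _

lemma orbitsD_monomial_same (M : TModule.{u, w} k) {n : ℕ} (q j : ℕ) (h : 2 * q + j = n)
    (x : M.C.X (j + 1)) :
    M.orbitsD n (M.monomial q (j + 1) (by omega) x) ⟨(q, j), h⟩ = M.C.d (j + 1) j x := by
  rw [orbitsD_apply, monomial_same, orbitsB_eq_zero, add_zero]
  intro i hi
  exact M.monomial_ne _ _ _ _ _ (by omega)

/-- The differential is triangular: `d` preserves the power of `u⁻¹` and `B` lowers it. Corrections
made at one power therefore do not disturb the higher powers already dealt with. -/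
lemma orbitsD_monomial_of_lt (M : TModule.{u, w} k) {n : ℕ} (q j : ℕ) (h : 2 * q + j = n + 1)
    (x : M.C.X j) (i : {i : ℕ × ℕ // 2 * i.1 + i.2 = n}) (hi : q < i.1.1) :
    M.orbitsD n (M.monomial q j h x) i = 0 := by
  obtain ⟨⟨q', j'⟩, h'⟩ := i
  dsimp only at hi
  rw [orbitsD_apply, monomial_ne _ _ _ _ _ _ (by dsimp only; omega), orbitsB_eq_zero, map_zero,
    add_zero]
  intro i hi
  exact M.monomial_ne _ _ _ _ _ (by omega)

/-- The map on homotopy orbits induced by a morphism, in each degree. -/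
def Hom.orbitsLin (φ : Hom M N) (n : ℕ) : M.OrbitsX n →ₗ[k] N.OrbitsX n :=
  LinearMap.pi fun i => (φ.f.f i.1.2).hom ∘ₗ LinearMap.proj i

lemma Hom.orbitsLin_apply (φ : Hom M N) (n : ℕ) (x : M.OrbitsX n)
    (i : {i : ℕ × ℕ // 2 * i.1 + i.2 = n}) : φ.orbitsLin n x i = φ.f.f i.1.2 (x i) := rfl

lemma Hom.orbitsD_orbitsLin (φ : Hom M N) (n : ℕ) (x : M.OrbitsX (n + 1)) :
    N.orbitsD n (φ.orbitsLin (n + 1) x) = φ.orbitsLin n (M.orbitsD n x) := by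
  funext ⟨⟨q, j⟩, h⟩
  dsimp only at h
  cases j with
  | zero => simp only [orbitsLin_apply, orbitsD_zero, f_d_apply]
  | succ j => simp only [orbitsLin_apply, orbitsD_succ, map_add, f_d_apply, φ.f_B]

/-- The map on homotopy orbits induced by a morphism. -/
def Hom.orbitsMap (φ : Hom M N) : M.homotopyOrbits ⟶ N.homotopyOrbits :=
  M.orbitsHom (fun n => (φ.orbitsLin n : M.OrbitsX n →ₗ[k] N.OrbitsX n)) fun n x =>
    (N.homotopyOrbits_d_apply n _).trans (φ.orbitsD_orbitsLin n x)

/-- Homotopy orbits preserve quasi-isomorphisms. -/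
theorem Hom.coneAcyclic_orbitsMap (φ : Hom M N) (hφ : ConeAcyclic φ.f) :
    ConeAcyclic φ.orbitsMap := by
  refine .of_filtration (fun P n c => ∀ i, P ≤ i.1.1 → (show M.OrbitsX n from c) i = 0)
    (fun P n d => ∀ i, P ≤ i.1.1 → (show N.OrbitsX n from d) i = 0)
    (fun n c h => funext fun i => h i (Nat.zero_le _))
    (fun n c h => funext fun i => h i (Nat.zero_le _))
    -- Elements of degree at most `n + 1` involve no power of `u⁻¹` beyond `n + 1`, so both
    -- vanishing conditions are vacuous at `n + 2`.
    (fun n c d => ⟨n + 2, fun i hi => ?_, fun i hi => ?_⟩) (fun d => ?_) ?_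
  · have := i.2
    omega
  · have := i.2
    omega
  · obtain ⟨c, d', h⟩ := hφ.zero ((show N.OrbitsX 0 from d) ⟨(0, 0), rfl⟩)
    refine ⟨M.monomial 0 0 rfl c, N.monomial 0 1 rfl d', ?_⟩
    rw [homotopyOrbits_d_apply]
    funext ⟨⟨q, j⟩, h'⟩
    obtain ⟨rfl, rfl⟩ : q = 0 ∧ j = 0 := by dsimp only at h'; omega
    refine Eq.trans ?_ (N.orbitsD_monomial_same 0 0 rfl d').symm
    rw [← h]
    change φ.f.f 0 (M.monomial 0 0 rfl c ⟨(0, 0), rfl⟩) - _ = _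
    rw [monomial_same]
  · intro P n c d hc hd hcyc h
    change M.OrbitsX n at c
    change N.OrbitsX (n + 1) at d
    rw [homotopyOrbits_d_apply] at h
    have e1 (s : M.OrbitsX (n + 1)) (i : {i : ℕ × ℕ // 2 * i.1 + i.2 = n}) :
        (show M.OrbitsX n from (show M.homotopyOrbits.X n from c) -
          M.homotopyOrbits.d (n + 1) n s) i = c i - M.orbitsD n s i :=
      congrArg (fun y : M.OrbitsX n => (c - y) i) (M.homotopyOrbits_d_apply n s)
    have e2 (s : M.OrbitsX (n + 1)) (t : N.OrbitsX (n + 2))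
        (i : {i : ℕ × ℕ // 2 * i.1 + i.2 = n + 1}) :
        (show N.OrbitsX (n + 1) from (show N.homotopyOrbits.X (n + 1) from d) - φ.orbitsMap.f (n + 1) s +
          N.homotopyOrbits.d (n + 2) (n + 1) t) i =
          d i - φ.f.f i.1.2 (s i) + N.orbitsD (n + 1) t i :=
      congrArg (fun y : N.OrbitsX (n + 1) => (d - (show N.OrbitsX (n + 1) from
        φ.orbitsMap.f (n + 1) s) + y) i) (N.homotopyOrbits_d_apply (n + 1) t)
    -- The coefficients of `u^{-P}` in `c` and `d` are the leading ones. Since nothing above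
    -- contributes a `B` term, they form a cycle in the cone of `φ` itself, hence a boundary there;
    -- placing the bounding elements at `u^{-P}` removes the leading coefficients.
    by_cases h2 : 2 * P ≤ n
    · obtain ⟨j, rfl⟩ := Nat.exists_eq_add_of_le h2
      obtain ⟨c', d', h3, h4⟩ := hφ.pair j (c ⟨(P, j), rfl⟩) (d ⟨(P, j + 1), rfl⟩)
        (fun m => by
          match j with
          | 0 => exact cycle_zero _ _ _
          | j + 1 =>
            refine cycle_succ _ ?_ m
            have h5 := hcyc (2 * P + j)
            have h6 : M.orbitsD (2 * P + j) c ⟨(P, j), rfl⟩ = 0 := by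
              rw [← homotopyOrbits_d_apply]
              exact congrFun h5 _
            rwa [orbitsD_apply, orbitsB_eq_zero, add_zero] at h6
            exact fun i hi => hc i hi.ge)
        (by
          have h5 := congrFun h ⟨(P, j), rfl⟩
          rw [orbitsD_apply, orbitsB_eq_zero, add_zero] at h5
          · exact h5
          · exact fun i hi => hd i hi.ge)
      refine ⟨M.monomial P (j + 1) rfl c', N.monomial P (j + 2) rfl d', fun i hi => ?_,
        fun i hi => ?_⟩
      · refine (e1 _ _).trans ?_
        obtain hi | hi := hi.eq_or_lt
        · obtain ⟨⟨q, j'⟩, h5⟩ := i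
          dsimp only at hi h5
          obtain ⟨rfl, rfl⟩ : q = P ∧ j' = j := by omega
          rw [orbitsD_monomial_same, h3, sub_self]
        · rw [orbitsD_monomial_of_lt _ _ _ _ _ _ hi, hc i hi, sub_zero]
      · refine (e2 _ _ _).trans ?_
        obtain hi | hi := hi.eq_or_lt
        · obtain ⟨⟨q, j'⟩, h5⟩ := i
          dsimp only at hi h5
          obtain ⟨rfl, rfl⟩ : q = P ∧ j' = j + 1 := by omega
          rw [orbitsD_monomial_same, monomial_same, ← h4]
          abel
        · rw [orbitsD_monomial_of_lt _ _ _ _ _ _ hi, hd i hi,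
            monomial_ne _ _ _ _ _ _ hi.ne', map_zero, sub_zero, add_zero]
    · have hc' (i : {i : ℕ × ℕ // 2 * i.1 + i.2 = n}) (hi : P ≤ i.1.1) : False := by
        have := i.2
        omega
      -- Here only `d` has a term at `u^{-P}`, with coefficient in degree zero, so the degree zero
      -- part of the acyclicity of the cone is needed.
      by_cases h3 : 2 * P = n + 1
      · obtain ⟨c', d', h4⟩ := hφ.zero (d ⟨(P, 0), h3⟩)
        refine ⟨M.monomial P 0 h3 c', N.monomial P 1 (by omega) d', fun i hi => (hc' i hi).elim,
          fun i hi => ?_⟩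
        refine (e2 _ _ _).trans ?_
        obtain ⟨⟨q, j'⟩, h5⟩ := i
        dsimp only at hi h5
        obtain ⟨rfl, rfl⟩ : q = P ∧ j' = 0 := by omega
        rw [N.orbitsD_monomial_same q 0 h3 d', monomial_same, ← h4]
        abel
      · refine ⟨0, 0, fun i hi => (hc' i hi).elim, fun i hi => ?_⟩
        have := i.2
        omega

end TModule
end HomotopyOrbits
end

/-! ### Complexes with an involution and their homotopy orbits -/

noncomputable section
namespace HomotopyOrbits

/-- A chain complex with an action of the group of order two. -/
structure InvolutiveComplex (k : Type u) [CommRing k] where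
  C : ChainComplex (ModuleCat.{w} k) ℕ
  ρ : C ⟶ C
  ρ_ρ (n : ℕ) (x : C.X n) : ρ.f n (ρ.f n x) = x

namespace InvolutiveComplex
variable {k : Type u} [CommRing k] (M : InvolutiveComplex.{u, w} k)

/-- Degree `n` of `M[v⁻¹]`. -/
abbrev OrbitsX (n : ℕ) : Type w := ∀ i : {i : ℕ × ℕ // i.1 + i.2 = n}, M.C.X i.1.2

/-- The differential `v^{-p} m ↦ (-1)^p v^{-p} d m + v^{-p+1} (ρ + (-1)^p) m`. -/
def orbitsD (n : ℕ) : M.OrbitsX (n + 1) →ₗ[k] M.OrbitsX n :=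
  LinearMap.pi fun i =>
    (-1 : ℤ) ^ i.1.1 • ((M.C.d (i.1.2 + 1) i.1.2).hom ∘ₗ
        LinearMap.proj (⟨(i.1.1, i.1.2 + 1), by have := i.2; dsimp only; omega⟩ :
          {i : ℕ × ℕ // i.1 + i.2 = n + 1})) +
    ((M.ρ.f i.1.2).hom + (-1 : ℤ) ^ (i.1.1 + 1) • LinearMap.id) ∘ₗ
        LinearMap.proj (⟨(i.1.1 + 1, i.1.2), by have := i.2; dsimp only; omega⟩ :
          {i : ℕ × ℕ // i.1 + i.2 = n + 1})

lemma orbitsD_apply (n : ℕ) (x : M.OrbitsX (n + 1)) (p j : ℕ) (h : p + j = n) :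
    M.orbitsD n x ⟨(p, j), h⟩ =
      (-1 : ℤ) ^ p • M.C.d (j + 1) j (x ⟨(p, j + 1), by dsimp only; omega⟩) +
      (M.ρ.f j (x ⟨(p + 1, j), by dsimp only; omega⟩) +
        (-1 : ℤ) ^ (p + 1) • x ⟨(p + 1, j), by dsimp only; omega⟩) := rfl

lemma orbitsD_orbitsD (n : ℕ) (x : M.OrbitsX (n + 2)) : M.orbitsD n (M.orbitsD (n + 1) x) = 0 := by
  funext ⟨⟨p, j⟩, h⟩
  simp only [orbitsD_apply, map_add, map_zsmul, d_d_apply, f_d_apply, M.ρ_ρ, pow_succ,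
    Pi.zero_apply]
  obtain hp | hp := neg_one_pow_eq_or ℤ p <;> rw [hp] <;> module

/-- The homotopy orbits for the action of the group of order two. -/
def homotopyOrbits : ChainComplex (ModuleCat.{w} k) ℕ :=
  ChainComplex.of (fun n => ModuleCat.of k (M.OrbitsX n)) (fun n => ModuleCat.ofHom (M.orbitsD n))
    fun n => ModuleCat.hom_ext (LinearMap.ext (M.orbitsD_orbitsD n))

lemma homotopyOrbits_d (n : ℕ) :
    M.homotopyOrbits.d (n + 1) n = ModuleCat.ofHom (M.orbitsD n) :=
  ChainComplex.of_d (fun n => ModuleCat.of k (M.OrbitsX n)) (fun n => ModuleCat.ofHom (M.orbitsD n)) n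

lemma homotopyOrbits_d_apply (n : ℕ) (x : M.OrbitsX (n + 1)) :
    M.homotopyOrbits.d (n + 1) n x = M.orbitsD n x := by
  rw [homotopyOrbits_d]
  rfl

/-- The chain map on homotopy orbits given by a family of maps that commutes with the
differentials. -/
def orbitsHom {C : ChainComplex (ModuleCat.{w} k) ℕ}
    (f : ∀ n, M.OrbitsX n →ₗ[k] C.X n)
    (h : ∀ n x, C.d (n + 1) n (f (n + 1) x) = f n (M.orbitsD n x)) : M.homotopyOrbits ⟶ C where
  f n := ModuleCat.ofHom (f n)
  comm' i j hij := by
    obtain rfl : j + 1 = i := hij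
    rw [homotopyOrbits_d]
    exact ModuleCat.hom_ext (LinearMap.ext fun x => h j x)

/-- The element `v^{-p} x` of the homotopy orbits. -/
def monomial {n : ℕ} (p j : ℕ) (h : p + j = n) (x : M.C.X j) : M.OrbitsX n :=
  Pi.single (M := fun i : {i : ℕ × ℕ // i.1 + i.2 = n} => M.C.X i.1.2) ⟨(p, j), h⟩ x

lemma monomial_same {n : ℕ} (p j : ℕ) (h : p + j = n) (x : M.C.X j) :
    M.monomial p j h x ⟨(p, j), h⟩ = x := Pi.single_eq_same _ _

lemma monomial_ne {n : ℕ} (p j : ℕ) (h : p + j = n) (x : M.C.X j)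
    (i : {i : ℕ × ℕ // i.1 + i.2 = n}) (hi : i.1.1 ≠ p) : M.monomial p j h x i = 0 :=
  Pi.single_eq_of_ne (fun e => hi (by rw [e])) _

lemma orbitsD_monomial_same {n : ℕ} (p j : ℕ) (h : p + j = n) (x : M.C.X (j + 1)) :
    M.orbitsD n (M.monomial p (j + 1) (by omega) x) ⟨(p, j), h⟩ =
      (-1 : ℤ) ^ p • M.C.d (j + 1) j x := by
  rw [orbitsD_apply, monomial_same, monomial_ne _ _ _ _ _ _ (by simp), map_zero, smul_zero,
    add_zero, add_zero]

lemma orbitsD_monomial_pred {n : ℕ} (p j : ℕ) (h : p + j = n) (x : M.C.X j) :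
    M.orbitsD n (M.monomial (p + 1) j (by omega) x) ⟨(p, j), h⟩ =
      M.ρ.f j x + (-1 : ℤ) ^ (p + 1) • x := by
  rw [orbitsD_apply, monomial_same, monomial_ne _ _ _ _ _ _ (by simp), map_zero, smul_zero,
    zero_add]

lemma orbitsD_monomial_ne {n : ℕ} (p j : ℕ) (h : p + j = n + 1) (x : M.C.X j)
    (i : {i : ℕ × ℕ // i.1 + i.2 = n}) (hi : i.1.1 ≠ p) (hi' : i.1.1 + 1 ≠ p) :
    M.orbitsD n (M.monomial p j h x) i = 0 := by
  obtain ⟨⟨q', j'⟩, h'⟩ := i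
  dsimp only at hi hi'
  rw [orbitsD_apply, monomial_ne _ _ _ _ _ _ hi, monomial_ne _ _ _ _ _ _ hi', map_zero,
    map_zero, smul_zero, smul_zero, add_zero, add_zero]

/-- A morphism of complexes with an involution. -/
structure Hom (M N : InvolutiveComplex.{u, w} k) where
  f : M.C ⟶ N.C
  f_ρ (n : ℕ) (x : M.C.X n) : f.f n (M.ρ.f n x) = N.ρ.f n (f.f n x)

variable {M} {N : InvolutiveComplex.{u, w} k}

/-- The map on homotopy orbits induced by a morphism, in each degree. -/
def Hom.orbitsLin (φ : Hom M N) (n : ℕ) : M.OrbitsX n →ₗ[k] N.OrbitsX n :=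
  LinearMap.pi fun i => (φ.f.f i.1.2).hom ∘ₗ LinearMap.proj i

lemma Hom.orbitsLin_apply (φ : Hom M N) (n : ℕ) (x : M.OrbitsX n)
    (i : {i : ℕ × ℕ // i.1 + i.2 = n}) : φ.orbitsLin n x i = φ.f.f i.1.2 (x i) := rfl

lemma Hom.orbitsD_orbitsLin (φ : Hom M N) (n : ℕ) (x : M.OrbitsX (n + 1)) :
    N.orbitsD n (φ.orbitsLin (n + 1) x) = φ.orbitsLin n (M.orbitsD n x) := by
  funext ⟨⟨p, j⟩, h⟩
  simp only [orbitsLin_apply, orbitsD_apply, map_add, map_zsmul, f_d_apply, φ.f_ρ]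

/-- The map on homotopy orbits induced by a morphism. -/
def Hom.orbitsMap (φ : Hom M N) : M.homotopyOrbits ⟶ N.homotopyOrbits :=
  M.orbitsHom (fun n => (φ.orbitsLin n : M.OrbitsX n →ₗ[k] N.OrbitsX n)) fun n x =>
    (N.homotopyOrbits_d_apply n _).trans (φ.orbitsD_orbitsLin n x)

/-- Homotopy orbits preserve quasi-isomorphisms. -/
theorem Hom.coneAcyclic_orbitsMap (φ : Hom M N) (hφ : ConeAcyclic φ.f) :
    ConeAcyclic φ.orbitsMap := by
  have sgn (p : ℕ) {A : Type w} [AddCommGroup A] (a : A) :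
      (-1 : ℤ) ^ p • (-1 : ℤ) ^ p • a = a := by
    rw [smul_smul, ← pow_add, Even.neg_one_pow ⟨p, rfl⟩, one_smul]
  refine .of_filtration (fun P n c => ∀ i, P ≤ i.1.1 → (show M.OrbitsX n from c) i = 0)
    (fun P n d => ∀ i, P ≤ i.1.1 → (show N.OrbitsX n from d) i = 0)
    (fun n c h => funext fun i => h i (Nat.zero_le _))
    (fun n c h => funext fun i => h i (Nat.zero_le _))
    (fun n c d => ⟨n + 2, fun i hi => ?_, fun i hi => ?_⟩) (fun d => ?_) ?_
  · have := i.2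
    omega
  · have := i.2
    omega
  · obtain ⟨c, d', h⟩ := hφ.zero ((show N.OrbitsX 0 from d) ⟨(0, 0), rfl⟩)
    refine ⟨M.monomial 0 0 rfl c, N.monomial 0 1 rfl d', ?_⟩
    rw [homotopyOrbits_d_apply]
    funext ⟨⟨q, j⟩, h'⟩
    obtain ⟨rfl, rfl⟩ : q = 0 ∧ j = 0 := by dsimp only at h'; omega
    refine Eq.trans ?_ (N.orbitsD_monomial_same 0 0 rfl d').symm
    rw [← h, pow_zero, one_smul]
    change φ.f.f 0 (M.monomial 0 0 rfl c ⟨(0, 0), rfl⟩) - _ = _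
    rw [monomial_same]
  · intro P n c d hc hd hcyc h
    change M.OrbitsX n at c
    change N.OrbitsX (n + 1) at d
    rw [homotopyOrbits_d_apply] at h
    have e1 (s : M.OrbitsX (n + 1)) (i : {i : ℕ × ℕ // i.1 + i.2 = n}) :
        (show M.OrbitsX n from (show M.homotopyOrbits.X n from c) -
          M.homotopyOrbits.d (n + 1) n s) i = c i - M.orbitsD n s i :=
      congrArg (fun y : M.OrbitsX n => (c - y) i) (M.homotopyOrbits_d_apply n s)
    have e2 (s : M.OrbitsX (n + 1)) (t : N.OrbitsX (n + 2))
        (i : {i : ℕ × ℕ // i.1 + i.2 = n + 1}) :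
        (show N.OrbitsX (n + 1) from (show N.homotopyOrbits.X (n + 1) from d) -
          φ.orbitsMap.f (n + 1) s + N.homotopyOrbits.d (n + 2) (n + 1) t) i =
          d i - φ.f.f i.1.2 (s i) + N.orbitsD (n + 1) t i :=
      congrArg (fun y : N.OrbitsX (n + 1) => (d - (show N.OrbitsX (n + 1) from
        φ.orbitsMap.f (n + 1) s) + y) i) (N.homotopyOrbits_d_apply (n + 1) t)
    by_cases h2 : P ≤ n
    · obtain ⟨j, rfl⟩ := Nat.exists_eq_add_of_le h2
      -- In the row `v^{-P}` the differential is `(-1)^P d`. Twisting `c` here and `d'` below by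
      -- this sign turns the leading coefficients into a cone cycle for the untwisted differential.
      obtain ⟨c', d', h3, h4⟩ := hφ.pair j ((-1 : ℤ) ^ P • c ⟨(P, j), rfl⟩) (d ⟨(P, j + 1), rfl⟩)
        (fun m => by
          match j with
          | 0 => exact cycle_zero _ _ _
          | j + 1 =>
            refine cycle_succ _ ?_ m
            have h5 := hcyc (P + j)
            have h6 : M.orbitsD (P + j) c ⟨(P, j), rfl⟩ = 0 := by
              rw [← homotopyOrbits_d_apply]
              exact congrFun h5 _
            rw [orbitsD_apply, hc ⟨(P + 1, j), _⟩ le_rfl, map_zero, smul_zero, add_zero,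
              add_zero] at h6
            rwa [map_zsmul])
        (by
          have h5 := congrFun h ⟨(P, j), rfl⟩
          rw [orbitsD_apply, hd ⟨(P + 1, j), _⟩ le_rfl, map_zero, smul_zero, add_zero,
              add_zero] at h5
          rw [map_zsmul]
          refine (congrArg _ h5).trans (sgn _ _))
      refine ⟨M.monomial P (j + 1) rfl c',
        N.monomial P (j + 2) rfl ((-1 : ℤ) ^ P • d'), fun i hi => ?_,
        fun i hi => ?_⟩
      · refine (e1 _ _).trans ?_
        obtain hi | hi := hi.eq_or_lt
        · obtain ⟨⟨q, j'⟩, h5⟩ := i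
          dsimp only at hi h5
          obtain ⟨rfl, rfl⟩ : q = P ∧ j' = j := by omega
          rw [orbitsD_monomial_same, h3, sgn, sub_self]
        · rw [orbitsD_monomial_ne _ _ _ _ _ _ hi.ne' (by omega), hc i hi, sub_zero]
      · refine (e2 _ _ _).trans ?_
        obtain hi | hi := hi.eq_or_lt
        · obtain ⟨⟨q, j'⟩, h5⟩ := i
          dsimp only at hi h5
          obtain ⟨rfl, rfl⟩ : q = P ∧ j' = j + 1 := by omega
          rw [orbitsD_monomial_same, monomial_same, map_zsmul, sgn, ← h4]
          abel
        · rw [orbitsD_monomial_ne _ _ _ _ _ _ hi.ne' (by omega), hd i hi,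
            monomial_ne _ _ _ _ _ _ hi.ne', map_zero, sub_zero, add_zero]
    · have hc' (i : {i : ℕ × ℕ // i.1 + i.2 = n}) (hi : P ≤ i.1.1) : False := by
        have := i.2
        omega
      by_cases h3 : P = n + 1
      · obtain ⟨c', d', h4⟩ := hφ.zero (d ⟨(P, 0), h3⟩)
        refine ⟨M.monomial P 0 h3 c', N.monomial P 1 (by omega) ((-1 : ℤ) ^ P • d'),
          fun i hi => (hc' i hi).elim, fun i hi => ?_⟩
        refine (e2 _ _ _).trans ?_
        obtain ⟨⟨q, j'⟩, h5⟩ := i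
        dsimp only at hi h5
        obtain ⟨rfl, rfl⟩ : q = P ∧ j' = 0 := by omega
        rw [N.orbitsD_monomial_same q 0 h3 _, monomial_same, map_zsmul, sgn, ← h4]
        abel
      · refine ⟨0, 0, fun i hi => (hc' i hi).elim, fun i hi => ?_⟩
        have := i.2
        omega

/-- The map from the homotopy orbits to a target on which the involution is trivial. -/
def augmentation {A : ChainComplex (ModuleCat.{w} k) ℕ} (g : M.C ⟶ A)
    (hg : ∀ n x, g.f n (M.ρ.f n x) = g.f n x) : M.homotopyOrbits ⟶ A :=
  M.orbitsHom (fun n => (g.f n).hom ∘ₗ LinearMap.proj (⟨(0, n), by simp⟩ :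
      {i : ℕ × ℕ // i.1 + i.2 = n})) fun n x => by
    change A.d (n + 1) n (g.f (n + 1) (x ⟨(0, n + 1), by simp⟩)) =
      g.f n (M.orbitsD n x ⟨(0, n), by simp⟩)
    rw [orbitsD_apply, pow_zero, one_smul, map_add, map_add, hg, f_d_apply, map_zsmul]
    simp

lemma augmentation_apply {A : ChainComplex (ModuleCat.{w} k) ℕ} (g : M.C ⟶ A)
    (hg : ∀ n x, g.f n (M.ρ.f n x) = g.f n x) (n : ℕ) (x : M.OrbitsX n) :
    (augmentation g hg).f n x = g.f n (x ⟨(0, n), by simp⟩) := rfl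

/-- The lowest occurring coefficient, at `v^{-(P+1)}`, is annihilated by `ρ ± 1`, because the
coefficient of the boundary at `v^{-P}` vanishes. By hypothesis it is then in the image of `ρ ∓ 1`,
so it can be removed by an element at `v^{-(P+2)}`. This changes only coefficients at higher powers,
and the degree bounds the number of repetitions. The vanishing of `c'` below `P + 2` ensures that an
augmentation does not see it. -/
lemma exists_of_orbitsD_eq_zero
    (h₁ : ∀ n x, M.ρ.f n x - x = 0 → ∃ y, M.ρ.f n y + y = x)
    (h₂ : ∀ n x, M.ρ.f n x + x = 0 → ∃ y, M.ρ.f n y - y = x) (r P n : ℕ) (hr : P + r = n)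
    (c : M.OrbitsX n) (hc : ∀ i, i.1.1 < P + 1 → c i = 0)
    (hcyc : ∀ m, M.homotopyOrbits.d n m c = 0) :
    ∃ c' : M.OrbitsX (n + 1), M.orbitsD n c' = c ∧ ∀ i, i.1.1 < P + 2 → c' i = 0 := by
  induction r generalizing P c with
  | zero => exact ⟨0, by
      rw [map_zero]
      exact (funext fun i => hc i (by have := i.2; omega)).symm, fun _ _ => rfl⟩
  | succ r ih =>
    obtain rfl : n = P + r + 1 := by omega
    have h3 : M.orbitsD (P + r) c ⟨(P, r), rfl⟩ = 0 := by
      rw [← homotopyOrbits_d_apply]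
      exact congrFun (hcyc (P + r)) _
    rw [orbitsD_apply, hc ⟨(P, r + 1), _⟩ (Nat.lt_succ_self _), map_zero, smul_zero, zero_add] at h3
    -- The parity of `P` decides which of the two exactness hypotheses of the periodic resolution
    -- applies.
    obtain ⟨y, hy⟩ : ∃ y : M.C.X r, M.ρ.f r y + (-1 : ℤ) ^ (P + 2) • y =
        c ⟨(P + 1, r), by dsimp only; omega⟩ := by
      obtain hp | hp := neg_one_pow_eq_or ℤ P
      · rw [pow_succ, hp, one_mul, neg_one_smul, ← sub_eq_add_neg] at h3
        obtain ⟨y, hy⟩ := h₁ _ _ h3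
        exact ⟨y, by rw [← hy, pow_add, hp]; norm_num⟩
      · rw [pow_succ, hp, neg_mul_neg, one_mul, one_smul] at h3
        obtain ⟨y, hy⟩ := h₂ _ _ h3
        exact ⟨y, by rw [← hy, pow_add, hp, sub_eq_add_neg]; norm_num⟩
    let s : M.OrbitsX (P + r + 1 + 1) := M.monomial (P + 2) r (by omega) y
    obtain ⟨c', h4, h5⟩ := ih (P + 1) (by omega) (c - M.orbitsD _ s) (fun i hi => by
        obtain ⟨⟨q, j⟩, h6⟩ := i
        dsimp only at hi h6
        obtain hi | hi := (Nat.lt_succ_iff.1 hi).eq_or_lt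
        · obtain ⟨rfl, rfl⟩ : q = P + 1 ∧ j = r := by omega
          rw [Pi.sub_apply, orbitsD_monomial_pred, hy, sub_self]
        · rw [Pi.sub_apply, orbitsD_monomial_ne _ _ _ _ _ _ (by dsimp only; omega)
            (by dsimp only; omega), hc _ hi, sub_zero]) (fun m => by
        rw [← homotopyOrbits_d_apply]
        refine (map_sub (M.homotopyOrbits.d (P + r + 1) m).hom _ _).trans ?_
        refine (congrArg₂ (· - ·) (hcyc m) (d_comp_apply _ _ _ _ _)).trans (sub_zero _))
    refine ⟨c' + s, by rw [map_add, h4, sub_add_cancel], fun i hi => ?_⟩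
    rw [Pi.add_apply, h5 i (by omega), zero_add]
    exact M.monomial_ne _ _ _ _ _ (by omega)

/-- For a free action, the homotopy orbits are quasi-isomorphic to the orbits. -/
theorem coneAcyclic_augmentation {A : ChainComplex (ModuleCat.{w} k) ℕ} (g : M.C ⟶ A)
    (hg : ∀ n x, g.f n (M.ρ.f n x) = g.f n x) (hs : ∀ n, Function.Surjective (g.f n))
    (h₀ : ∀ n x, g.f n x = 0 → ∃ y, M.ρ.f n y - y = x)
    (h₁ : ∀ n x, M.ρ.f n x - x = 0 → ∃ y, M.ρ.f n y + y = x)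
    (h₂ : ∀ n x, M.ρ.f n x + x = 0 → ∃ y, M.ρ.f n y - y = x) :
    ConeAcyclic (augmentation g hg) where
  zero d := by
    obtain ⟨c, hc⟩ := hs 0 d
    refine ⟨M.monomial 0 0 rfl c, 0, ?_⟩
    rw [map_zero, sub_eq_zero, ← hc]
    exact congrArg _ (M.monomial_same 0 0 rfl c)
  pair n c d hcyc h := by
    change M.OrbitsX n at c
    -- Lift `d` to `d₁`, placed at `v⁰`. What remains of `c` at `v⁰` is `c₀ - ∂d₁`, which lies in
    -- the kernel of `g` and hence equals `ρ y - y`; the element `v⁻¹ y` removes it. The rest has no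
    -- `v⁰` coefficient and is bounded by a `c'` invisible to the augmentation.
    obtain ⟨d₁, hd₁⟩ := hs (n + 1) d
    let s : M.OrbitsX (n + 1) := M.monomial 0 (n + 1) (by omega) d₁
    have h3 : M.orbitsD n s ⟨(0, n), by simp⟩ = M.C.d (n + 1) n d₁ := by
      refine (M.orbitsD_monomial_same 0 n _ d₁).trans ?_
      rw [pow_zero, one_smul]
    obtain ⟨y, hy⟩ := h₀ n (c ⟨(0, n), by simp⟩ - M.C.d (n + 1) n d₁) (by
      rw [map_sub, f_d_apply, hd₁, ← h, sub_eq_zero]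
      rfl)
    let t : M.OrbitsX (n + 1) := M.monomial 1 n (by omega) y
    have h4 : M.orbitsD n t ⟨(0, n), by simp⟩ = M.ρ.f n y - y := by
      refine (M.orbitsD_monomial_pred 0 n _ y).trans ?_
      simp [sub_eq_add_neg]
    obtain ⟨c', h5, h6⟩ := exists_of_orbitsD_eq_zero h₁ h₂ n 0 n (zero_add n)
      (c - M.orbitsD n s - M.orbitsD n t) (fun i hi => by
        obtain ⟨⟨q, j⟩, h7⟩ := i
        dsimp only at hi h7
        obtain ⟨rfl, rfl⟩ : q = 0 ∧ j = n := by omega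
        rw [Pi.sub_apply, Pi.sub_apply, h3, h4, hy, sub_self]) (fun m => by
        rw [← homotopyOrbits_d_apply, ← homotopyOrbits_d_apply]
        refine (map_sub (M.homotopyOrbits.d n m).hom _ _).trans ?_
        refine (congrArg₂ (· - ·) (map_sub (M.homotopyOrbits.d n m).hom _ _)
          (d_comp_apply _ _ _ _ _)).trans ((sub_zero _).trans ?_)
        refine (congrArg₂ (· - ·) (hcyc m) (d_comp_apply _ _ _ _ _)).trans (sub_zero _))
    refine ⟨c' + t + s, 0, ?_, ?_⟩
    · refine (M.homotopyOrbits_d_apply n _).trans ?_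
      rw [map_add, map_add, h5]
      abel
    · rw [map_zero, sub_eq_zero, ← hd₁]
      refine (augmentation_apply g hg (n + 1) _).trans ?_
      have h7 : t ⟨(0, n + 1), by simp⟩ = 0 := M.monomial_ne _ _ _ _ _ (by simp)
      have h8 : s ⟨(0, n + 1), by simp⟩ = d₁ := M.monomial_same _ _ _ _
      rw [Pi.add_apply, Pi.add_apply, h6 _ (by dsimp only; omega), h7, h8]
      simp only [zero_add]

end InvolutiveComplex

/-! ### Homotopy orbits for `O(2)` as iterated homotopy orbits -/

namespace OModule
variable {k : Type u} [CommRing k] (M : OModule.{u, w} k)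

/-- The involution `u^{-q} m ↦ (-1)^q u^{-q} R m` of the homotopy orbits for the circle. -/
def orbitsR (n : ℕ) : M.toTModule.OrbitsX n →ₗ[k] M.toTModule.OrbitsX n :=
  LinearMap.pi fun i => (-1 : ℤ) ^ i.1.1 • M.R i.1.2 ∘ₗ LinearMap.proj i

lemma orbitsR_apply (n : ℕ) (x : M.toTModule.OrbitsX n) (i : {i : ℕ × ℕ // 2 * i.1 + i.2 = n}) :
    M.orbitsR n x i = (-1 : ℤ) ^ i.1.1 • M.R i.1.2 (x i) := rfl

/-- The sign `(-1)^q` in the involution is what makes this hold: `B` anticommutes with `R` and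
lowers `q` by one. -/
lemma orbitsD_orbitsR (n : ℕ) (x : M.toTModule.OrbitsX (n + 1)) :
    M.toTModule.orbitsD n (M.orbitsR (n + 1) x) = M.orbitsR n (M.toTModule.orbitsD n x) := by
  funext ⟨⟨q, j⟩, h⟩
  dsimp only at h
  cases j with
  | zero => simp only [orbitsR_apply, TModule.orbitsD_zero, map_zsmul, M.d_R]
  | succ j =>
    simp only [orbitsR_apply, TModule.orbitsD_succ, map_zsmul, M.d_R, map_add, M.R_B, pow_succ]
    module

lemma orbitsR_orbitsR (n : ℕ) (x : M.toTModule.OrbitsX n) : M.orbitsR n (M.orbitsR n x) = x := by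
  funext i
  rw [orbitsR_apply, orbitsR_apply, map_zsmul, M.R_R, smul_smul, ← pow_add,
    Even.neg_one_pow ⟨_, rfl⟩, one_smul]

/-- The homotopy orbits for the circle, as a complex with an involution. -/
def circleOrbits : InvolutiveComplex.{u, w} k where
  C := M.toTModule.homotopyOrbits
  ρ := M.toTModule.orbitsHom (fun n => (M.orbitsR n : M.toTModule.OrbitsX n →ₗ[k] _)) fun n x =>
    (M.toTModule.homotopyOrbits_d_apply n _).trans (M.orbitsD_orbitsR n x)
  ρ_ρ n x := M.orbitsR_orbitsR n x

lemma homotopyOrbits_d (n : ℕ) :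
    M.homotopyOrbits.d (n + 1) n = ModuleCat.ofHom (M.orbitsD n) :=
  ChainComplex.of_d (fun n => ModuleCat.of k (M.OrbitsX n)) (fun n => ModuleCat.ofHom (M.orbitsD n)) n

/-- The monomials `v^{-p} u^{-q}`, sorted by the power of `v`. -/
def orbitsEquiv (n : ℕ) : M.OrbitsX n ≃ₗ[k] M.circleOrbits.OrbitsX n where
  toFun x := fun i : {i : ℕ × ℕ // i.1 + i.2 = n} => show M.toTModule.OrbitsX i.1.2 from
    fun j => x ⟨(i.1.1, j.1.1, j.1.2), by
      have := i.2
      have := j.2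
      dsimp only
      omega⟩
  map_add' _ _ := rfl
  map_smul' _ _ := rfl
  invFun y := fun i => (show M.toTModule.OrbitsX (2 * i.1.2.1 + i.1.2.2) from
    y ⟨(i.1.1, 2 * i.1.2.1 + i.1.2.2), by have := i.2; dsimp only; omega⟩)
      ⟨(i.1.2.1, i.1.2.2), rfl⟩
  left_inv _ := rfl
  right_inv y := by
    funext ⟨⟨p, m⟩, h⟩
    refine funext fun (⟨⟨q, j⟩, h'⟩ : {i : ℕ × ℕ // 2 * i.1 + i.2 = m}) => ?_
    subst h'
    rfl

lemma orbitsEquiv_apply (n : ℕ) (x : M.OrbitsX n) (p m q j : ℕ) (h : p + m = n)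
    (h' : 2 * q + j = m) :
    (show M.toTModule.OrbitsX m from M.orbitsEquiv n x ⟨(p, m), h⟩) ⟨(q, j), h'⟩ =
      x ⟨(p, q, j), by dsimp only; omega⟩ := rfl

lemma orbitsD_orbitsEquiv (n : ℕ) (x : M.OrbitsX (n + 1)) :
    M.circleOrbits.orbitsD n (M.orbitsEquiv (n + 1) x) = M.orbitsEquiv n (M.orbitsD n x) := by
  funext ⟨⟨p, m⟩, h⟩
  refine funext fun (⟨⟨q, j⟩, h'⟩ : {i : ℕ × ℕ // 2 * i.1 + i.2 = m}) => ?_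
  dsimp only at h
  let y : M.toTModule.OrbitsX (m + 1) := M.orbitsEquiv (n + 1) x ⟨(p, m + 1), by dsimp only; omega⟩
  let y' : M.toTModule.OrbitsX m := M.orbitsEquiv (n + 1) x ⟨(p + 1, m), by dsimp only; omega⟩
  have e : (show M.toTModule.OrbitsX m from
      M.circleOrbits.orbitsD n (M.orbitsEquiv (n + 1) x) ⟨(p, m), h⟩) =
      (-1 : ℤ) ^ p • M.toTModule.orbitsD m y + (M.orbitsR m y' + (-1 : ℤ) ^ (p + 1) • y') := by
    rw [← TModule.homotopyOrbits_d_apply]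
    rfl
  refine (congrFun e ⟨(q, j), h'⟩).trans ?_
  refine Eq.trans ?_ (orbitsEquiv_apply M n _ p m q j h h').symm
  cases j with
  | zero =>
    rw [orbitsD_zero, Pi.add_apply, Pi.smul_apply, TModule.orbitsD_zero]
    rfl
  | succ j =>
    rw [orbitsD_succ, Pi.add_apply, Pi.smul_apply, TModule.orbitsD_succ]
    rfl

/-- The homotopy orbits for `O(2)` are the homotopy orbits for the group of order two of the
homotopy orbits for the circle. -/
def homotopyOrbitsIso : M.homotopyOrbits ≅ M.circleOrbits.homotopyOrbits :=
  HomologicalComplex.Hom.isoOfComponents (fun n => (M.orbitsEquiv n).toModuleIso) fun i j hij => by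
    obtain rfl : j + 1 = i := hij
    rw [InvolutiveComplex.homotopyOrbits_d, homotopyOrbits_d]
    exact ModuleCat.hom_ext (LinearMap.ext fun x => M.orbitsD_orbitsEquiv j x)

/-- A morphism of differential graded `H_*(O(2); k)`-modules. -/
structure Hom (M N : OModule.{u, w} k) extends TModule.Hom M.toTModule N.toTModule where
  f_R (n : ℕ) (x : M.C.X n) : f.f n (M.R n x) = N.R n (f.f n x)

lemma Hom.orbitsLin_orbitsR {M N : OModule.{u, w} k} (φ : Hom M N) (n : ℕ)
    (x : M.toTModule.OrbitsX n) :
    φ.toHom.orbitsLin n (M.orbitsR n x) = N.orbitsR n (φ.toHom.orbitsLin n x) := by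
  funext i
  rw [TModule.Hom.orbitsLin_apply, orbitsR_apply, orbitsR_apply, map_zsmul, φ.f_R]
  rfl

/-- The map on homotopy orbits for the circle induced by a morphism. -/
def Hom.circleOrbitsHom {M N : OModule.{u, w} k} (φ : Hom M N) :
    InvolutiveComplex.Hom M.circleOrbits N.circleOrbits where
  f := φ.toHom.orbitsMap
  f_ρ n x := by
    exact φ.orbitsLin_orbitsR n x

end OModule
end HomotopyOrbits
end

noncomputable section
namespace HomotopyOrbits
open Simplicial

/-! ### Functoriality of the shuffle product -/

section Push
variable (k : Type u) [CommRing k] {X Y Z : Type v} [TopologicalSpace X] [TopologicalSpace Y]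
  [TopologicalSpace Z]

lemma chain_hom_ext {M : Type*} [AddCommMonoid M] [Module k M] {n : ℕ} {f g : Chain k X n →ₗ[k] M}
    (h : ∀ σ, f (Finsupp.single σ 1) = g (Finsupp.single σ 1)) : f = g :=
  Finsupp.lhom_ext' fun σ => LinearMap.ext_ring (h σ)

/-- Composition of a singular simplex with a continuous map. -/
def compSimplex (f : C(X, Y)) {n : SimplexCategoryᵒᵖ} (σ : (Sing X).obj n) : (Sing Y).obj n :=
  (TopCat.toSSet.map (TopCat.ofHom f)).app n σ

lemma toMap_compSimplex (f : C(X, Y)) {n : SimplexCategoryᵒᵖ} (σ : (Sing X).obj n) (t) :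
    toMap (compSimplex f σ) t = f (toMap σ t) := rfl

lemma map_compSimplex (f : C(X, Y)) {m n : SimplexCategoryᵒᵖ} (θ : m ⟶ n) (σ : (Sing X).obj m) :
    (Sing Y).map θ (compSimplex f σ) = compSimplex f ((Sing X).map θ σ) := rfl

lemma push_single (f : C(X, Y)) (n : ℕ) (σ : (Sing X) _⦋n⦌) (r : k) :
    push k f n (Finsupp.single σ r) = Finsupp.single (compSimplex f σ) r :=
  Finsupp.mapDomain_single

lemma push_push (f : C(X, Y)) (g : C(Y, Z)) (n : ℕ) (c : Chain k X n) :
    push k g n (push k f n c) = push k (g.comp f) n c := by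
  refine LinearMap.congr_fun (f := push k g n ∘ₗ push k f n) (chain_hom_ext k fun σ => ?_) c
  rw [LinearMap.comp_apply, push_single, push_single, push_single]
  rfl

lemma push_id (n : ℕ) (c : Chain k X n) : push k (ContinuousMap.id X) n c = c := by
  refine LinearMap.congr_fun (g := LinearMap.id) (chain_hom_ext k fun σ => ?_) c
  rw [push_single]
  rfl

/-- The chain map induced by a continuous map. -/
def pushHom (f : C(X, Y)) : singularChains k X ⟶ singularChains k Y where
  f n := ModuleCat.ofHom (push k f n)
  comm' i j hij := by
    obtain rfl : j + 1 = i := hij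
    rw [singularChains_d, singularChains_d]
    exact ModuleCat.hom_ext (LinearMap.ext fun x => boundary_push k f j x)

lemma singularChains_d_apply (n : ℕ) (c : Chain k X (n + 1)) :
    (singularChains k X).d (n + 1) n c = boundary k X n c := by
  rw [singularChains_d]
  rfl

variable {G G' : Type w} [TopologicalSpace G] [TopologicalSpace G'] [SMul G X]
  [ContinuousSMul G X] [SMul G' Y] [ContinuousSMul G' Y]

lemma compSimplex_act (φ : C(G, G')) (f : C(X, Y)) (h : ∀ g x, f (g • x) = φ g • f x)
    {n : SimplexCategoryᵒᵖ} (τ : (Sing G).obj n) (σ : (Sing X).obj n) :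
    compSimplex f (act τ σ) = act (compSimplex φ τ) (compSimplex f σ) :=
  simplex_ext fun t => by
    rw [toMap_compSimplex, toMap_act, toMap_act, h]
    rfl

lemma bilinear_ext {A B M : Type*} [AddCommMonoid M] [Module k M]
    {f g : (A →₀ k) →ₗ[k] (B →₀ k) →ₗ[k] M}
    (h : ∀ a b, f (Finsupp.single a 1) (Finsupp.single b 1) =
      g (Finsupp.single a 1) (Finsupp.single b 1)) : f = g :=
  Finsupp.lhom_ext' fun a => LinearMap.ext_ring (Finsupp.lhom_ext' fun b =>
    LinearMap.ext_ring (h a b))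

lemma cross_single_single {G : Type w} [TopologicalSpace G] [SMul G X] [ContinuousSMul G X] (n : ℕ)
    (τ : (Sing G) _⦋1⦌) (σ : (Sing X) _⦋n⦌) :
    cross k n (Finsupp.single τ 1) (Finsupp.single σ 1) =
      ∑ i : Fin (n + 1), (-1 : ℤ) ^ (i : ℕ) • Finsupp.single (prism i τ σ) (1 : k) := by
  simp [cross]

/-- Compatibility of the shuffle product with maps that are equivariant along a map of groups. -/
lemma push_cross_of_equivariant (φ : C(G, G')) (f : C(X, Y)) (h : ∀ g x, f (g • x) = φ g • f x)
    (n : ℕ) (z : Chain k G 1) (c : Chain k X n) :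
    push k f (n + 1) (cross k n z c) = cross k n (push k φ 1 z) (push k f n c) := by
  refine LinearMap.congr_fun₂ (f := (cross k n).compr₂ (push k f (n + 1)))
    (g := (cross k n).compl₁₂ (push k φ 1) (push k f n)) (bilinear_ext k fun τ σ => ?_) z c
  rw [LinearMap.compr₂_apply, LinearMap.compl₁₂_apply, push_single, push_single,
    cross_single_single, cross_single_single, map_sum]
  refine Finset.sum_congr rfl fun i _ => ?_
  rw [map_zsmul, push_single, prism, compSimplex_act φ f h]
  rfl

/-- On a cycle the second term of the Leibniz rule disappears, which merges the formulas in degree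
zero and in positive degree. -/
lemma boundary_cross_of_cycle {G : Type w} [TopologicalSpace G] [SMul G X] [ContinuousSMul G X]
    (n : ℕ) (z : Chain k G 1) (c : Chain k X n) (hc : ∀ m, (singularChains k X).d n m c = 0) :
    boundary k X n (cross k n z c) = cross₀ k n (boundary k G 0 z) c := by
  cases n with
  | zero => exact boundary_cross_zero k z c
  | succ n =>
    have h : boundary k X n c = 0 := (singularChains_d_apply k n c).symm.trans (hc n)
    rw [boundary_cross, h, map_zero, sub_zero]

end Push

/-! ### Homotopy invariance of singular chains -/

section Homotopy
variable (k : Type u) [CommRing k] {Y : Type v} [TopologicalSpace Y]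

/-- The tautological singular `1`-simplex of the unit interval. -/
def unitEdge : (Sing unitInterval) _⦋1⦌ :=
  ofMap (n := op ⦋1⦌) ⟨fun t : stdSimplex ℝ (Fin 2) => ⟨t 1, t.2.1 1, by
    have h : t 0 + t 1 = 1 := by
      rw [← Fin.sum_univ_two (fun i => t i)]
      exact stdSimplex.sum_eq_one t
    have h' : 0 ≤ t 0 := t.2.1 0
    linarith⟩, by
      have : Continuous fun t : stdSimplex ℝ (Fin 2) => t 1 :=
        (continuous_apply 1).comp continuous_subtype_val
      exact this.subtype_mk _⟩

lemma toMap_unitEdge (t : stdSimplex ℝ (Fin 2)) : (toMap unitEdge t : ℝ) = t 1 := by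
  simp [unitEdge]

lemma stdSimplex_map_const {n : ℕ} (i j : Fin 2) (t : stdSimplex ℝ (Fin (n + 1))) :
    stdSimplex.map (fun a : Fin (n + 1) => SimplexCategory.const ⦋n⦌ ⦋1⦌ i a) t j =
      if i = j then 1 else 0 := by
  change FunOnFinite.linearMap ℝ ℝ _ t j = _
  rw [FunOnFinite.linearMap_apply_apply]
  change ∑ a ∈ Finset.univ.filter (fun a : Fin (n + 1) => i = j), t a = _
  split_ifs with h
  · simp only [h, Finset.filter_true]
    exact stdSimplex.sum_eq_one t
  · simp only [h, Finset.filter_false, Finset.sum_empty]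

lemma toMap_map_const_unitEdge (n : ℕ) (i : Fin 2) (t : stdSimplex ℝ (Fin (n + 1))) :
    toMap ((Sing unitInterval).map (SimplexCategory.const ⦋n⦌ ⦋1⦌ i).op unitEdge) t =
      if i = 1 then 1 else 0 := by
  refine Subtype.ext ?_
  rw [toMap_map, toMap_unitEdge]
  refine (stdSimplex_map_const i 1 t).trans ?_
  split_ifs <;> rfl

/-- Homotopic self-maps have homologous values on cycles. -/
theorem exists_boundary_eq_of_homotopy (H : C(unitInterval × Y, Y)) (f g : C(Y, Y))
    (h₀ : ∀ y, H (0, y) = f y) (h₁ : ∀ y, H (1, y) = g y) (n : ℕ) (c : Chain k Y n)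
    (hc : ∀ m, (singularChains k Y).d n m c = 0) :
    ∃ e : Chain k Y (n + 1), boundary k Y n e = push k g n c - push k f n c := by
  -- The shuffle product needs only a continuous scalar multiplication, without any axioms of an
  -- action. The homotopy itself is taken as multiplication by points of the interval, and the
  -- Leibniz rule for the tautological edge gives the prism formula.
  let _ : SMul unitInterval Y := ⟨fun t y => H (t, y)⟩
  have : ContinuousSMul unitInterval Y := ⟨H.continuous⟩
  refine ⟨cross k n (Finsupp.single unitEdge 1) c, ?_⟩
  rw [boundary_cross_of_cycle k n _ c hc, cross₀_boundary]
  have key (i : Fin 2) (f : C(Y, Y)) (h : ∀ y, H (if i = 1 then 1 else 0, y) = f y) :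
      Finsupp.lmapDomain k k (act (X := Y)
        ((Sing unitInterval).map (SimplexCategory.const ⦋n⦌ ⦋1⦌ i).op unitEdge)) = push k f n := by
    refine congrArg (Finsupp.lmapDomain k k) (funext fun σ => simplex_ext fun t => ?_)
    rw [toMap_act, toMap_map_const_unitEdge]
    exact h _
  rw [key 1 g h₁, key 0 f h₀]
  rfl

/-- Projecting away a contractible factor is a quasi-isomorphism on singular chains. -/
theorem coneAcyclic_pushHom_snd (X E : Type v) [TopologicalSpace X] 
    [TopologicalSpace E] [ContractibleSpace E] :
    ConeAcyclic (pushHom k (ContinuousMap.snd : C(E × X, X))) := by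
  obtain ⟨e₀, ⟨H⟩⟩ := (contractible_iff_id_nullhomotopic E).1 inferInstance
  let i : C(X, E × X) := ⟨fun x => (e₀, x), by fun_prop⟩
  refine .of_injective_surjective (fun n c d hc h => ?_) fun n d hd => ?_
  · change Chain k (E × X) n at c
    change Chain k X (n + 1) at d
    -- The contraction of `E` deforms the identity of `E × X` into the projection followed by the
    -- inclusion at `e₀`.
    obtain ⟨e, he⟩ := exists_boundary_eq_of_homotopy k
      ⟨fun p => (H (p.1, p.2.1), p.2.2), by fun_prop⟩ (ContinuousMap.id (E × X))
      (i.comp ContinuousMap.snd) (fun y => by simp) (fun y => by simp [i]) n c hc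
    rw [push_id, ← push_push] at he
    have h' : push k ContinuousMap.snd n c = boundary k X n d :=
      Eq.trans h (singularChains_d_apply k n d)
    refine ⟨push k i (n + 1) d - e, ?_⟩
    refine (singularChains_d_apply k n _).trans ?_
    rw [map_sub, he, h', boundary_push]
    abel
  · change Chain k X n at d
    refine ⟨push k i n d, 0, fun m => ?_, ?_⟩
    · refine (f_d_apply (pushHom k i) n m d).symm.trans ?_
      rw [hd, map_zero]
    · rw [map_zero]
      refine sub_eq_zero_of_eq ?_
      exact (push_push k i _ n d).trans (push_id k n d)

end Homotopy

section Equivariant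
variable {k : Type u} [CommRing k] {z : Chain k Circle 1} (hz : IsFundamentalCycle z)
  {X Y : Type v} [TopologicalSpace X] [TopologicalSpace Y]
  [MulAction Circle X] [ContinuousSMul Circle X] [MulAction Circle Y] [ContinuousSMul Circle Y]

/-- The morphism of `H_*(𝕋; k)`-modules induced by an equivariant map. -/
def chainsTHom (f : C(X, Y)) (hf : ∀ (g : Circle) (x : X), f (g • x) = g • f x) :
    TModule.Hom (chainsTModule hz X) (chainsTModule hz Y) where
  f := pushHom k f
  f_B n x := by
    refine (push_cross_of_equivariant k (ContinuousMap.id Circle) f hf n z x).trans ?_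
    rw [push_id]
    rfl

end Equivariant

end HomotopyOrbits
end

noncomputable section
namespace HomotopyOrbits
open Simplicial

/-! ### Normalized chains and the comparison map -/

section Normalize
variable (k : Type u) [CommRing k] {X Y : Type v} [TopologicalSpace X] [TopologicalSpace Y]

/-- The idempotent endomorphism of the singular chain complex that annihilates degenerate
simplices. -/
def normalizeHom (X : Type v) [TopologicalSpace X] : singularChains k X ⟶ singularChains k X :=
  AlgebraicTopology.DoldKan.PInfty (X := singularModule k X)

/-- The map `normalizeHom` in degree `n`. -/
def normalize (X : Type v) [TopologicalSpace X] (n : ℕ) : Chain k X n →ₗ[k] Chain k X n :=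
  ((normalizeHom k X).f n).hom

lemma boundary_normalize (n : ℕ) (c : Chain k X (n + 1)) :
    boundary k X n (normalize k X (n + 1) c) = normalize k X n (boundary k X n c) := by
  rw [← singularChains_d_apply, ← singularChains_d_apply]
  exact (f_d_apply (normalizeHom k X) (n + 1) n c).symm

/-- The map of simplicial modules induced by a continuous map. -/
def singularModuleMap (f : C(X, Y)) : singularModule k X ⟶ singularModule k Y where
  app n := ModuleCat.ofHom (Finsupp.lmapDomain k k (compSimplex f))
  naturality m n θ := by
    refine (lmap_comp k _ _ _ fun _ => rfl).trans (lmap_comp k _ _ _ fun σ => ?_).symm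
    exact map_compSimplex f θ σ

lemma normalize_push (f : C(X, Y)) (n : ℕ) (c : Chain k X n) :
    normalize k Y n (push k f n c) = push k f n (normalize k X n c) :=
  congrArg (fun g => ModuleCat.Hom.hom g c)
    (AlgebraicTopology.DoldKan.PInfty_f_naturality n (singularModuleMap k f))

lemma normalize_degenerate (n : ℕ) (i : Fin (n + 1)) (σ : (Sing X) _⦋n⦌) :
    normalize k X (n + 1) (Finsupp.single ((Sing X).σ i σ) 1) = 0 := by
  have h := congrArg (fun g => ModuleCat.Hom.hom g (Finsupp.single σ (1 : k)))
    (AlgebraicTopology.DoldKan.σ_comp_PInfty (singularModule k X) i)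
  refine Eq.trans (congrArg (normalize k X (n + 1)) ?_) h
  exact Finsupp.mapDomain_single.symm

/-- Normalization is chain homotopic to the identity, by the homotopy `homotopyPInftyToId`. It thus
costs nothing on homology. -/
lemma exists_boundary_eq_normalize_sub (n : ℕ) (c : Chain k X n)
    (hc : ∀ m, (singularChains k X).d n m c = 0) :
    ∃ e : Chain k X (n + 1), boundary k X n e = normalize k X n c - c := by
  let h := AlgebraicTopology.DoldKan.homotopyPInftyToId (singularModule k X)
  refine ⟨(h.hom n (n + 1)).hom c, ?_⟩
  have H : normalize k X n c = _ := congrArg (fun g => ModuleCat.Hom.hom g c) (h.comm n)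
  rw [prevD_eq (j' := n + 1) (w := by simp)] at H
  have H2 : (ModuleCat.Hom.hom (dNext n h.hom)) c = 0 := by
    cases n with
    | zero =>
      rw [dNext_eq_zero _ _ (by simp)]
      rfl
    | succ n =>
      rw [dNext_eq (i' := n) (w := by simp)]
      exact (congrArg (ModuleCat.Hom.hom (h.hom n (n + 1))) (hc n)).trans (map_zero _)
  have H3 : normalize k X n c = (show Chain k X n from ModuleCat.Hom.hom (dNext n h.hom) c) +
    (show Chain k X n from (singularChains k X).d (n + 1) n
      (ModuleCat.Hom.hom (h.hom n (n + 1)) c)) + c := H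
  rw [H3]
  refine Eq.trans ?_ (add_sub_cancel_right _ _).symm
  refine Eq.trans ?_ (congrArg₂ (· + ·) H2.symm rfl)
  exact Eq.trans (singularChains_d_apply k n _).symm (zero_add _).symm

/-- The `i`-th prism is `σᵢ` of the given simplex, multiplied pointwise by elements of `G`. An
invariant map forgets these elements, so its image is degenerate. -/
lemma normalize_push_cross {G : Type w} [TopologicalSpace G] [SMul G X] [ContinuousSMul G X]
    (f : C(X, Y)) (h : ∀ (g : G) (x : X), f (g • x) = f x) (n : ℕ) (z : Chain k G 1)
    (c : Chain k X n) : normalize k Y (n + 1) (push k f (n + 1) (cross k n z c)) = 0 := by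
  refine LinearMap.congr_fun₂ (f := (cross k n).compr₂ (normalize k Y (n + 1) ∘ₗ
    push k f (n + 1))) (g := 0) (bilinear_ext k fun τ σ => ?_) z c
  rw [LinearMap.compr₂_apply, LinearMap.comp_apply, cross_single_single, map_sum, map_sum]
  refine Finset.sum_eq_zero fun i _ => ?_
  have e : compSimplex f (prism i τ σ) = (Sing Y).σ i (compSimplex f σ) := by
    refine simplex_ext fun t => ?_
    rw [toMap_compSimplex, prism, toMap_act, h]
    rfl
  rw [map_zsmul, map_zsmul, push_single, e, normalize_degenerate, smul_zero]

end Normalize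

section Quotient
variable {k : Type u} [CommRing k] {z : Chain k Circle 1} (hz : IsFundamentalCycle z)
  {X Y : Type v} [TopologicalSpace X] [TopologicalSpace Y]
  [MulAction Circle X] [ContinuousSMul Circle X]

/-- The chain map from the homotopy orbits of the singular chains to the singular chains on a
space on which the circle acts trivially. -/
def orbitsTo (f : C(X, Y)) (hf : ∀ (g : Circle) (x : X), f (g • x) = f x) :
    (chainsTModule hz X).homotopyOrbits ⟶ singularChains k Y :=
  (chainsTModule hz X).orbitsHom (fun n => (normalize k Y n ∘ₗ push k f n) ∘ₗ
    (LinearMap.proj (⟨(0, n), by simp⟩ : {i : ℕ × ℕ // 2 * i.1 + i.2 = n}) :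
      (chainsTModule hz X).OrbitsX n →ₗ[k] Chain k X n)) fun n x => by
    refine (singularChains_d_apply k n _).trans ?_
    let y : Chain k X (n + 1) := x ⟨(0, n + 1), by simp⟩
    -- The coefficient of the boundary at `u⁰` contains, besides the boundary of the `u⁰`
    -- coefficient, only `B` of the coefficient at `u⁻¹`, and normalization kills the image of the
    -- latter.
    have e : normalize k Y n (push k f n ((chainsTModule hz X).orbitsD n x ⟨(0, n), by simp⟩)) =
        normalize k Y n (push k f n (boundary k X n y)) := by
      cases n with
      | zero =>
        rw [TModule.orbitsD_zero]
        exact congrArg (fun c => normalize k Y 0 (push k f 0 c)) (singularChains_d_apply k 0 y)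
      | succ n =>
        rw [TModule.orbitsD_succ]
        refine Eq.trans (map_add (normalize k Y (n + 1) ∘ₗ push k f (n + 1)) _ _) ?_
        refine Eq.trans (congrArg₂ (· + ·) (congrArg (fun c => normalize k Y (n + 1)
          (push k f (n + 1) c)) (singularChains_d_apply k (n + 1) y))
          (normalize_push_cross k f hf n z _)) (add_zero _)
    refine Eq.trans ?_ e.symm
    rw [← boundary_push, ← boundary_normalize]
    rfl

lemma orbitsTo_apply (f : C(X, Y)) (hf : ∀ (g : Circle) (x : X), f (g • x) = f x) (n : ℕ)
    (x : (chainsTModule hz X).OrbitsX n) : (orbitsTo hz f hf).f n x =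
      normalize k Y n (push k f n (x ⟨(0, n), by simp⟩)) := rfl

end Quotient

end HomotopyOrbits
end

noncomputable section
namespace HomotopyOrbits
open Simplicial

/-- A `G`-space that is covered by invariant open subsets admitting an equivariant map to `G`. -/
def LocallyTrivial (G : Type) [Group G] [TopologicalSpace G] (Y : Type v) [TopologicalSpace Y]
    [MulAction G Y] : Prop :=
  ∀ y : Y, ∃ U : Set Y, IsOpen U ∧ y ∈ U ∧ (∀ (g : G), ∀ x ∈ U, g • x ∈ U) ∧
    ∃ φ : Y → G, ContinuousOn φ U ∧ ∀ (g : G), ∀ x ∈ U, φ (g • x) = g * φ x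

/-! ### Principal bundles and the lifting of singular simplices -/

section LocallyTrivial
variable {G : Type} [Group G] [TopologicalSpace G] {Y : Type v} [TopologicalSpace Y]
  [MulAction G Y]

/-- Local trivializations pull back along equivariant maps. This passes the property from `E` to `E
× X` and from `Y` to its products with tori. -/
lemma LocallyTrivial.comap (h : LocallyTrivial G Y) {Z : Type w} [TopologicalSpace Z]
    [MulAction G Z] (f : Z → Y) (hf : Continuous f) (he : ∀ (g : G) (z : Z), f (g • z) = g • f z) :
    LocallyTrivial G Z := by
  intro z
  obtain ⟨U, hU, hz, hg, φ, hφ, hφg⟩ := h (f z)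
  exact ⟨f ⁻¹' U, hU.preimage hf, hz, fun g x hx => by
      rw [Set.mem_preimage, he]
      exact hg g _ hx, fun x => φ (f x), hφ.comp hf.continuousOn fun _ hx => hx,
    fun g x hx => (congrArg φ (he g x)).trans (hφg g _ hx)⟩

lemma LocallyTrivial.eq_one_of_smul_eq (h : LocallyTrivial G Y) {g : G} {y : Y}
    (hg : g • y = y) : g = 1 := by
  obtain ⟨U, -, hy, -, φ, -, hφ⟩ := h y
  have := hφ g y hy
  rw [hg] at this
  exact (mul_eq_right.1 this.symm)

lemma LocallyTrivial.eq_of_smul_eq (h : LocallyTrivial G Y) {g g' : G} {y : Y}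
    (hg : g • y = g' • y) : g = g' := by
  have h1 : (g'⁻¹ * g) • y = y := by rw [mul_smul, hg, inv_smul_smul]
  have h2 := h.eq_one_of_smul_eq h1
  rwa [inv_mul_eq_one, eq_comm] at h2

/-- Two maps to a principal bundle with the same composition to the orbit space differ by a unique
continuous map to the group. -/
lemma LocallyTrivial.exists_smul_eq [IsTopologicalGroup G] (h : LocallyTrivial G Y) {K : Type w}
    [TopologicalSpace K] (f f' : C(K, Y)) (hf : ∀ t, ∃ g : G, g • f t = f' t) :
    ∃ γ : C(K, G), ∀ t, γ t • f t = f' t := by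
  choose γ hγ using hf
  refine ⟨⟨γ, continuous_iff_continuousAt.2 fun t => ?_⟩, hγ⟩
  obtain ⟨U, hU, ht, hg, φ, hφ, hφg⟩ := h (f t)
  have ht' : f' t ∈ U := hγ t ▸ hg _ _ ht
  have c1 : ContinuousAt (fun s => φ (f s)) t :=
    (hφ.continuousAt (hU.mem_nhds ht)).comp f.continuous.continuousAt
  have c2 : ContinuousAt (fun s => φ (f' s)) t :=
    ContinuousAt.comp (g := φ) (hφ.continuousAt (hU.mem_nhds ht')) f'.continuous.continuousAt
  -- Over the trivializing set around `f t`, equivariance of `φ` forces `γ = φ(f') φ(f)⁻¹`, which is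
  -- continuous.
  refine (c2.mul c1.inv).congr ?_
  filter_upwards [f.continuous.continuousAt.preimage_mem_nhds (hU.mem_nhds ht)] with s hs
  have hs' : f s ∈ U := hs
  change φ (f' s) * (φ (f s))⁻¹ = γ s
  rw [← hγ s, hφg _ _ hs', mul_inv_cancel_right]

/-- The orbit space of a principal bundle has local sections. -/
lemma LocallyTrivial.exists_section [ContinuousSMul G Y] [IsTopologicalGroup G]
    (h : LocallyTrivial G Y) (b : Quotient (MulAction.orbitRel G Y)) :
    ∃ V : Set (Quotient (MulAction.orbitRel G Y)), IsOpen V ∧ b ∈ V ∧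
      ∃ s : Quotient (MulAction.orbitRel G Y) → Y, ContinuousOn s V ∧
        ∀ b', Quotient.mk _ (s b') = b' := by
  obtain ⟨y, rfl⟩ := Quotient.exists_rep b
  obtain ⟨U, hU, hy, hg, φ, hφ, hφg⟩ := h y
  have hq : IsOpenQuotientMap (Quotient.mk (MulAction.orbitRel G Y)) :=
    MulAction.isOpenQuotientMap_quotientMk
  -- The chosen representative `x` is moved to `φ(x)⁻¹ x`. Over `U` this point does not depend on
  -- the representative, so it is continuous although the choice is not.
  refine ⟨Quotient.mk _ '' U, hq.isOpenMap U hU, Set.mem_image_of_mem _ hy,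
    fun b' => (φ b'.out)⁻¹ • b'.out, ?_, fun b' => ?_⟩
  · rintro _ ⟨x, hx, rfl⟩
    refine ContinuousAt.continuousWithinAt ?_
    rw [← hq.continuousAt_comp_iff]
    have c1 : ContinuousAt φ x := hφ.continuousAt (hU.mem_nhds hx)
    refine (c1.inv.smul continuousAt_id).congr ?_
    filter_upwards [hU.mem_nhds hx] with x' hx'
    have : Quotient.mk (MulAction.orbitRel G Y) (Quotient.mk (MulAction.orbitRel G Y) x').out =
        Quotient.mk _ x' := Quotient.out_eq _
    obtain ⟨g, hg'⟩ := Quotient.exact this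
    change (φ x')⁻¹ • x' = (φ (Quotient.mk _ x').out)⁻¹ • (Quotient.mk _ x').out
    have hg'' : g • x' = (Quotient.mk (MulAction.orbitRel G Y) x').out := hg'
    rw [← hg'', hφg g x' hx', smul_smul, mul_inv_rev, inv_mul_cancel_right]
  · refine Eq.trans (Quotient.sound ?_) (Quotient.out_eq b')
    exact ⟨(φ b'.out)⁻¹, rfl⟩

/-- A map to an orbit space has a lift on a subset. -/
def LiftsOn {K : Type*} [TopologicalSpace K] (F : K → Quotient (MulAction.orbitRel G Y))
    (s : Set K) : Prop :=
  ∃ f : K → Y, ContinuousOn f s ∧ ∀ x ∈ s, Quotient.mk _ (f x) = F x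

/-- On the common wall of the two halves the lifts differ by a continuous map to `G`. Extending this
map constantly in the direction `i` and multiplying the second lift by it makes the two lifts agree
on the wall. -/
lemma LocallyTrivial.liftsOn_Icc_of_split [ContinuousSMul G Y] [IsTopologicalGroup G]
    (h : LocallyTrivial G Y) {ι : Type} [DecidableEq ι]
    (F : (ι → ℝ) → Quotient (MulAction.orbitRel G Y)) (a b : ι → ℝ) (i : ι) (m : ℝ)
    (ha : a i ≤ m) (hb : m ≤ b i) (h₁ : LiftsOn F (Set.Icc a (Function.update b i m)))
    (h₂ : LiftsOn F (Set.Icc (Function.update a i m) b)) : LiftsOn F (Set.Icc a b) := by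
  obtain ⟨f, hf, hF⟩ := h₁
  obtain ⟨f', hf', hF'⟩ := h₂
  -- The projection of the box onto the wall `x i = m`; both lifts are defined on its image.
  let r : (ι → ℝ) → ι → ℝ := fun x => Function.update x i m
  have hr : Continuous r := continuous_id.update i continuous_const
  have m1 {x} (hx : x ∈ Set.Icc a b) (hi : x i ≤ m) : x ∈ Set.Icc a (Function.update b i m) := by
    refine ⟨hx.1, fun j => ?_⟩
    by_cases hj : j = i
    · subst hj; simpa using hi
    · simpa [hj] using hx.2 j
  have m2 {x} (hx : x ∈ Set.Icc a b) (hi : m ≤ x i) : x ∈ Set.Icc (Function.update a i m) b := by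
    refine ⟨fun j => ?_, hx.2⟩
    by_cases hj : j = i
    · subst hj; simpa using hi
    · simpa [hj] using hx.1 j
  have m0 {x} (hx : x ∈ Set.Icc a b) : r x ∈ Set.Icc a b := by
    refine ⟨fun j => ?_, fun j => ?_⟩ <;> by_cases hj : j = i
    · subst hj; simpa [r] using ha
    · simpa [r, hj] using hx.1 j
    · subst hj; simpa [r] using hb
    · simpa [r, hj] using hx.2 j
  have hri (x) : r x i = m := by simp [r]
  let K := {x : ι → ℝ // x ∈ Set.Icc a b}
  have c1 : Continuous fun x : K => f (r x) :=
    hf.comp_continuous (hr.comp continuous_subtype_val) fun x => m1 (m0 x.2) (hri _).le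
  have c2 : Continuous fun x : K => f' (r x) :=
    hf'.comp_continuous (hr.comp continuous_subtype_val) fun x => m2 (m0 x.2) (hri _).ge
  obtain ⟨γ, hγ⟩ := h.exists_smul_eq ⟨_, c2⟩ ⟨_, c1⟩ fun x => by
    refine Quotient.exact (s := MulAction.orbitRel G Y) ?_
    exact (hF _ (m1 (m0 x.2) (hri _).le)).trans (hF' _ (m2 (m0 x.2) (hri _).ge)).symm
  have hγ' (x : K) : γ x • f' (r x) = f (r x) := hγ x
  classical
  refine ⟨fun x => if hx : x ∈ Set.Icc a b then if x i ≤ m then f x else γ ⟨x, hx⟩ • f' x else f x,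
    ?_, ?_⟩
  · rw [continuousOn_iff_continuous_domRestrict]
    have e : (Set.Icc a b).domRestrict (fun x => if hx : x ∈ Set.Icc a b then
        if x i ≤ m then f x else γ ⟨x, hx⟩ • f' x else f x) =
        fun x : K => if x.1 i ≤ m then f x else γ x • f' x := by
      funext x
      exact dif_pos x.2
    rw [e]
    have ci : Continuous fun x : K => x.1 i := (continuous_apply i).comp continuous_subtype_val
    refine continuous_if_le ci continuous_const ?_ ?_ ?_
    · exact hf.comp continuous_subtype_val.continuousOn fun x hx => m1 x.2 hx
    · exact γ.continuous.continuousOn.smul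
        (hf'.comp continuous_subtype_val.continuousOn fun x hx => m2 x.2 hx)
    · intro x hx
      have : r x = x.1 := by
        change Function.update x.1 i m = x.1
        rw [← hx, Function.update_eq_self]
      rw [← this, ← hγ' x, this]
  · intro x hx
    dsimp only
    rw [dif_pos hx]
    split_ifs with hi
    · exact hF x (m1 hx hi)
    · refine Eq.trans (Quotient.sound ?_) (hF' x (m2 hx (not_le.1 hi).le))
      exact ⟨γ ⟨x, hx⟩, rfl⟩

/-- Maps from a box to the orbit space of a principal bundle lift. -/
lemma LocallyTrivial.liftsOn_box [ContinuousSMul G Y] [IsTopologicalGroup G]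
    (h : LocallyTrivial G Y) {ι : Type} [Fintype ι]
    (F : (ι → ℝ) → Quotient (MulAction.orbitRel G Y)) (hF : Continuous F)
    (I : BoxIntegral.Box ι) : LiftsOn F (BoxIntegral.Box.Icc I) := by
  classical
  -- Compactness in the form of bisection: it suffices that lifts exist on small boxes near every
  -- point and that lifts on the `2^ι` halves in all directions can be glued to a lift on the box.
  refine BoxIntegral.Box.subbox_induction_on' (p := fun J => LiftsOn F (BoxIntegral.Box.Icc J)) I
    (fun J _ hJ => ?_) fun z _ => ?_
  · let c : ι → ℝ := fun i => (J.lower i + J.upper i) / 2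
    have hc (i : ι) : J.lower i ≤ c i ∧ c i ≤ J.upper i := by
      have := J.lower_lt_upper i
      constructor <;> simp only [c] <;> linarith
    -- The set `T` records the directions already glued, in which the box has full width. In the
    -- other directions `s` selects the upper half and its complement the lower half. Adding `i` to
    -- `T` glues the boxes for `s \ {i}` and `insert i s`.
    suffices H : ∀ (T : Finset ι) (s : Set ι), LiftsOn F (Set.Icc
        (fun i => if i ∈ T then J.lower i else if i ∈ s then c i else J.lower i)
        (fun i => if i ∈ T then J.upper i else if i ∈ s then J.upper i else c i)) by
      have := H Finset.univ ∅
      simp only [Finset.mem_univ, if_true] at this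
      exact this
    intro T
    induction T using Finset.induction_on with
    | empty =>
      intro s
      have h1 := hJ s
      simp only [Finset.notMem_empty, if_false]
      convert h1 using 1
      refine congrArg₂ Set.Icc (funext fun j => ?_) (funext fun j => ?_) <;>
        by_cases hj : j ∈ s <;> simp [BoxIntegral.Box.splitCenterBox, hj, c]
    | insert i T hi ih =>
      intro s
      refine h.liftsOn_Icc_of_split F _ _ i (c i) ?_ ?_ ?_ ?_
      · simpa using (hc i).1
      · simpa using (hc i).2
      · convert ih (s \ {i}) using 2
        · funext j
          by_cases hj : j = i
          · subst hj; simp [hi]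
          · simp [hj]
        · funext j
          by_cases hj : j = i
          · subst hj; simp [hi]
          · simp [hj]
      · convert ih (insert i s) using 2
        · funext j
          by_cases hj : j = i
          · subst hj; simp [hi]
          · simp [hj]
        · funext j
          by_cases hj : j = i
          · subst hj; simp [hi]
          · simp [hj]
  -- Boxes mapped into the domain of a local section lift by composition with it.
  · obtain ⟨V, hV, hz, s, hs, hsb⟩ := h.exists_section (F z)
    refine ⟨F ⁻¹' V, mem_nhdsWithin_of_mem_nhds ((hV.preimage hF).mem_nhds hz), fun J _ _ _ hJ _ =>
      ⟨fun x => s (F x), hs.comp hF.continuousOn hJ, fun x _ => hsb _⟩⟩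

end LocallyTrivial

section Retraction

/-- A retraction of `ℝ^{n+1}` onto the standard simplex. -/
def simplexRetraction (n : ℕ) (x : Fin (n + 1) → ℝ) : stdSimplex ℝ (Fin (n + 1)) :=
  -- Take positive parts. If they add up to less than one, the deficit is distributed equally over
  -- the coordinates; otherwise the vector is divided by its sum.
  ⟨fun i => (max (x i) 0 + max 0 (1 - ∑ j, max (x j) 0) / (n + 1)) / max (∑ j, max (x j) 0) 1, by
    have h1 : 0 < max (∑ j, max (x j) 0) 1 := lt_max_of_lt_right one_pos
    refine ⟨fun i => by positivity, ?_⟩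
    rw [← Finset.sum_div, Finset.sum_add_distrib, Finset.sum_const, Finset.card_univ,
      Fintype.card_fin, nsmul_eq_mul, div_eq_one_iff_eq h1.ne']
    push_cast
    rw [mul_div_cancel₀ _ (by positivity)]
    obtain h | h := le_total (∑ j, max (x j) 0) 1
    · rw [max_eq_right h, max_eq_right (by linarith)]
      ring
    · rw [max_eq_left h, max_eq_left (by linarith), add_zero]⟩

lemma continuous_simplexRetraction (n : ℕ) : Continuous (simplexRetraction n) := by
  refine Continuous.subtype_mk (continuous_pi fun i => ?_) _
  have h1 (x : Fin (n + 1) → ℝ) : max (∑ j, max (x j) 0) 1 ≠ 0 :=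
    (lt_max_of_lt_right one_pos).ne'
  fun_prop (disch := exact h1 _)

lemma simplexRetraction_val (n : ℕ) (t : stdSimplex ℝ (Fin (n + 1))) :
    simplexRetraction n t.1 = t := by
  refine Subtype.ext (funext fun i => ?_)
  have h1 (j : Fin (n + 1)) : max (t.1 j) 0 = t.1 j := max_eq_left (t.2.1 j)
  have h2 : ∑ j, t.1 j = 1 := t.2.2
  simp only [simplexRetraction, h1, h2]
  simp

end Retraction

section Lift
variable {G : Type} [Group G] [TopologicalSpace G] {Y : Type v} [TopologicalSpace Y]
  [MulAction G Y]

/-- The projection to the orbit space. -/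
def toOrbits (G : Type) [Group G] [TopologicalSpace G] (Y : Type v) [TopologicalSpace Y]
    [MulAction G Y] : C(Y, Quotient (MulAction.orbitRel G Y)) :=
  ⟨Quotient.mk _, continuous_quotient_mk'⟩

lemma toOrbits_smul (g : G) (y : Y) : toOrbits G Y (g • y) = toOrbits G Y y :=
  Quotient.sound ⟨g, rfl⟩

lemma exists_smul_of_toOrbits_eq {y y' : Y} (h : toOrbits G Y y' = toOrbits G Y y) :
    ∃ g : G, g • y = y' :=
  Quotient.exact h

variable [ContinuousSMul G Y]

lemma LocallyTrivial.act_injective (h : LocallyTrivial G Y) {n : SimplexCategoryᵒᵖ}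
    {γ γ' : (Sing G).obj n} {τ : (Sing Y).obj n} (e : act γ τ = act γ' τ) : γ = γ' :=
  simplex_ext fun t => h.eq_of_smul_eq (y := toMap τ t) (by
    rw [← toMap_act, ← toMap_act, e])

lemma compSimplex_toOrbits_act {n : SimplexCategoryᵒᵖ} (γ : (Sing G).obj n) (τ : (Sing Y).obj n) :
    compSimplex (toOrbits G Y) (act γ τ) = compSimplex (toOrbits G Y) τ :=
  simplex_ext fun t => by
    rw [toMap_compSimplex, toMap_act, toOrbits_smul, toMap_compSimplex]

variable [IsTopologicalGroup G]

/-- Singular simplices of the orbit space of a principal bundle lift. -/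
theorem LocallyTrivial.exists_lift (h : LocallyTrivial G Y) {n : ℕ}
    (σ : (Sing (Quotient (MulAction.orbitRel G Y))) _⦋n⦌) :
    ∃ τ : (Sing Y) _⦋n⦌, compSimplex (toOrbits G Y) τ = σ := by
  -- The simplex is extended over all of `ℝ^{n+1}` along the retraction, so that lifting over boxes
  -- applies. Any box containing the standard simplex would serve; below it is `[-1, 2]^{n+1}`.
  let F : (Fin (n + 1) → ℝ) → Quotient (MulAction.orbitRel G Y) :=
    fun x => toMap σ (simplexRetraction n x)
  have hF : Continuous F := (toMap σ).continuous.comp (continuous_simplexRetraction n)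
  obtain ⟨f, hf, hfF⟩ := h.liftsOn_box F hF ⟨fun _ => -1, fun _ => 2, fun _ => by norm_num⟩
  have hm (t : stdSimplex ℝ (Fin (n + 1))) : t.1 ∈ Set.Icc (fun _ : Fin (n + 1) => (-1 : ℝ))
      fun _ => 2 :=
    ⟨fun i => by have := t.2.1 i; dsimp only; linarith,
      fun i => by
        have h1 : t.1 i ≤ ∑ j, t.1 j :=
          Finset.single_le_sum (fun j _ => t.2.1 j) (Finset.mem_univ i)
        have h2 : ∑ j, t.1 j = 1 := t.2.2
        dsimp only
        linarith⟩
  refine ⟨ofMap (n := op ⦋n⦌) ⟨fun t : stdSimplex ℝ (Fin (n + 1)) => f t.1,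
    hf.comp_continuous continuous_subtype_val hm⟩, simplex_ext fun t => ?_⟩
  rw [toMap_compSimplex, toMap_ofMap]
  refine (hfF _ (hm t)).trans ?_
  exact congrArg (toMap σ) (simplexRetraction_val n t)

/-- Singular simplices over the same simplex of the orbit space differ by a simplex of the
group. -/
theorem LocallyTrivial.exists_act_eq (h : LocallyTrivial G Y) {n : SimplexCategoryᵒᵖ}
    {τ τ' : (Sing Y).obj n} (e : compSimplex (toOrbits G Y) τ = compSimplex (toOrbits G Y) τ') :
    ∃ γ : (Sing G).obj n, act γ τ = τ' := by
  obtain ⟨γ, hγ⟩ := h.exists_smul_eq (toMap τ) (toMap τ') fun t =>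
    exists_smul_of_toOrbits_eq (congrArg (fun σ => toMap σ t) e.symm)
  refine ⟨ofMap γ, simplex_ext fun t => ?_⟩
  rw [toMap_act, toMap_ofMap, hγ]

end Lift

section CircleLift

/-- The straight-line contraction of the standard simplex to a vertex. -/
def simplexContraction (n : ℕ) (p : unitInterval × stdSimplex ℝ (Fin (n + 1))) :
    stdSimplex ℝ (Fin (n + 1)) :=
  ⟨(1 - p.1 : ℝ) • (stdSimplex.vertex (S := ℝ) (0 : Fin (n + 1))).1 + (p.1 : ℝ) • p.2.1,
    (convex_stdSimplex ℝ (Fin (n + 1))) (stdSimplex.vertex (S := ℝ) (0 : Fin (n + 1))).2 p.2.2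
      (sub_nonneg.2 p.1.2.2) p.1.2.1 (by ring)⟩

lemma continuous_simplexContraction (n : ℕ) : Continuous (simplexContraction n) := by
  have h1 : Continuous fun p : unitInterval × stdSimplex ℝ (Fin (n + 1)) => (p.1 : ℝ) :=
    continuous_subtype_val.comp continuous_fst
  have h2 : Continuous fun p : unitInterval × stdSimplex ℝ (Fin (n + 1)) => p.2.1 :=
    continuous_subtype_val.comp continuous_snd
  exact Continuous.subtype_mk (((continuous_const.sub h1).smul continuous_const).add
    (h1.smul h2)) _

/-- Singular simplices of the circle lift to the real line. -/
theorem exists_exp_lift {n : ℕ} (τ : (Sing Circle) _⦋n⦌) :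
    ∃ ρ : (Sing ℝ) _⦋n⦌, compSimplex Circle.exp ρ = τ := by
  -- Contracting the standard simplex to its zeroth vertex presents `τ` as the end of a homotopy
  -- starting at a constant map. The constant map lifts, so homotopy lifting for the covering
  -- `Circle.exp` lifts `τ`.
  let H : C(unitInterval × stdSimplex ℝ (Fin (n + 1)), Circle) :=
    (toMap τ).comp ⟨_, continuous_simplexContraction n⟩
  obtain ⟨a, ha⟩ := Circle.exp_surjective (toMap τ (stdSimplex.vertex (S := ℝ) (0 : Fin (n + 1))))
  have H0 (t) : H (0, t) = Circle.exp (ContinuousMap.const _ a t) := by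
    rw [ContinuousMap.const_apply, ha]
    refine congrArg (toMap τ) (Subtype.ext ?_)
    simp [simplexContraction]
  let L := Circle.isCoveringMap_exp.liftHomotopy H (ContinuousMap.const _ a) H0
  refine ⟨ofMap (n := op ⦋n⦌) (L.comp ⟨fun t : stdSimplex ℝ (Fin (n + 1)) =>
    ((1 : unitInterval), t), by fun_prop⟩), simplex_ext fun t => ?_⟩
  rw [toMap_compSimplex, toMap_ofMap]
  refine (congrFun (Circle.isCoveringMap_exp.liftHomotopy_lifts H _ H0) (1, t)).trans ?_
  refine congrArg (toMap τ) (Subtype.ext ?_)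
  simp [simplexContraction]

end CircleLift

end HomotopyOrbits
end

noncomputable section
namespace HomotopyOrbits
open Simplicial

/-! ### A criterion for modules whose homology is induced -/

namespace TModule
variable {k : Type u} [CommRing k] (M : TModule.{u, w} k)

lemma orbitsD_monomial_pred {n : ℕ} (q j : ℕ) (h : 2 * (q + 1) + j = n + 1) (x : M.C.X j) :
    M.orbitsD n (M.monomial (q + 1) j h x) ⟨(q, j + 1), by dsimp only; omega⟩ = M.B j x := by
  rw [orbitsD_succ, monomial_same, monomial_ne _ _ _ _ _ _ (by simp), map_zero, zero_add]

/-- For a cycle `x`, the boundary of `u^{-(q+1)} x` is just `u^{-q} B x`, which makes `u^{-(q+1)} x`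
the means of removing `B x` at `u^{-q}`. -/
lemma orbitsD_monomial_eq_zero {n : ℕ} (q j : ℕ) (h : 2 * (q + 1) + j = n + 1) (x : M.C.X j)
    (hx : ∀ m, M.C.d j m x = 0) (i : {i : ℕ × ℕ // 2 * i.1 + i.2 = n}) (hi : q < i.1.1) :
    M.orbitsD n (M.monomial (q + 1) j h x) i = 0 := by
  obtain h' | h' : q + 1 = i.1.1 ∨ q + 1 < i.1.1 := by omega
  · obtain ⟨⟨q', j'⟩, h''⟩ := i
    dsimp only at h'
    subst h'
    obtain rfl : j = j' + 1 := by dsimp only at h''; omega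
    rw [orbitsD_monomial_same, hx]
  · exact M.orbitsD_monomial_of_lt _ _ _ _ _ h'

lemma orbits_ext {n : ℕ} {x y : M.OrbitsX n} (h : ∀ q j (h : 2 * q + j = n),
    x ⟨(q, j), h⟩ = y ⟨(q, j), h⟩) : x = y :=
  funext fun ⟨⟨q, j⟩, e⟩ => h q j e

lemma cycle_apply {n : ℕ} (x : M.OrbitsX n) (hx : ∀ m, M.homotopyOrbits.d n m x = 0) (q j : ℕ)
    (h : 2 * q + j = n) (hq : ∀ i, q < i.1.1 → x i = 0) (m : ℕ) :
    M.C.d j m (x ⟨(q, j), h⟩) = 0 := by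
  cases j with
  | zero => exact cycle_zero _ _ _
  | succ j =>
    refine cycle_succ _ ?_ m
    obtain rfl : n = 2 * q + j + 1 := by omega
    have h1 := congrFun ((M.homotopyOrbits_d_apply (2 * q + j) x).symm.trans (hx _)) ⟨(q, j), rfl⟩
    rw [orbitsD_apply, orbitsB_eq_zero _ _ _ _ _ _ fun i hi => hq i (by omega), add_zero] at h1
    exact h1

/-- A coefficient above `u⁰` of a cycle is not arbitrary: the coefficient below it shows that its
image under `B` bounds. Together with the hypothesis `hB` of the criterion below, this forces
leading terms to be removable. -/
lemma cycle_apply_B {n : ℕ} (x : M.OrbitsX n) (hx : ∀ m, M.homotopyOrbits.d n m x = 0) (q j : ℕ)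
    (h : 2 * (q + 1) + j = n) : M.B j (x ⟨(q + 1, j), h⟩) =
      -M.C.d (j + 2) (j + 1) (x ⟨(q, j + 2), by dsimp only; omega⟩) := by
  obtain rfl : n = 2 * q + j + 1 + 1 := by omega
  have h1 := congrFun ((M.homotopyOrbits_d_apply (2 * q + j + 1) x).symm.trans (hx _))
    ⟨(q, j + 1), rfl⟩
  rw [orbitsD_succ] at h1
  exact eq_neg_of_add_eq_zero_right h1

variable {D : ChainComplex (ModuleCat.{w} k) ℕ}

/-- A criterion for a map from homotopy orbits to be a quasi-isomorphism, which applies if `M` is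
induced up from `D`. -/
theorem coneAcyclic_of_section (F : M.homotopyOrbits ⟶ D) (i : D ⟶ M.C)
    (hF : ∀ n (a : D.X n), (∀ m, D.d n m a = 0) →
      ∃ e, D.d (n + 1) n e = F.f n (M.monomial 0 n (by simp) (i.f n a)) - a)
    (hzero : ∀ x : M.C.X 0, ∃ a e, x = i.f 0 a + M.C.d 1 0 e)
    (hsucc : ∀ n (x : M.C.X (n + 1)), (∀ m, M.C.d (n + 1) m x = 0) → ∃ a a' e,
      (∀ m, D.d (n + 1) m a = 0) ∧ (∀ m, D.d n m a' = 0) ∧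
      x = i.f (n + 1) a + M.B n (i.f n a') + M.C.d (n + 2) (n + 1) e)
    (hB : ∀ n (a : D.X n) e, (∀ m, D.d n m a = 0) →
      M.B n (i.f n a) = M.C.d (n + 2) (n + 1) e → ∃ b, D.d (n + 1) n b = a) :
    ConeAcyclic F := by
  -- Every cycle of the homotopy orbits is homologous to one of the form `u⁰ i(a)` with `a` a cycle.
  -- The induction is on the highest power of `u⁻¹` that occurs.
  have key : ∀ P n (x : M.OrbitsX n), (∀ m, M.homotopyOrbits.d n m x = 0) →
      (∀ i, P < i.1.1 → x i = 0) → ∃ a y, (∀ m, D.d n m a = 0) ∧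
        x = M.monomial 0 n (by simp) (i.f n a) + M.orbitsD n y := by
    intro P
    induction P with
    | zero =>
      intro n x hx hP
      have h0 := M.cycle_apply x hx 0 n (by simp) hP
      cases n with
      | zero =>
        obtain ⟨a, e, h⟩ := hzero (x ⟨(0, 0), rfl⟩)
        refine ⟨a, M.monomial 0 1 (by simp) e, cycle_zero _ _, M.orbits_ext fun q j h' => ?_⟩
        obtain ⟨rfl, rfl⟩ : q = 0 ∧ j = 0 := by omega
        exact h.trans (congrArg₂ (· + ·) (M.monomial_same _ _ _ _).symm
          (M.orbitsD_monomial_same 0 0 rfl e).symm)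
      | succ n =>
        obtain ⟨a, a', e, ha, ha', h⟩ := hsucc n _ h0
        refine ⟨a, M.monomial 0 (n + 2) (by simp) e + M.monomial 1 n (by omega) (i.f n a'), ha,
          M.orbits_ext fun q j h' => ?_⟩
        have hia (m : ℕ) : M.C.d n m (i.f n a') = 0 := by rw [← f_d_apply, ha', map_zero]
        rw [map_add]
        cases q with
        | zero =>
          obtain rfl : j = n + 1 := by omega
          refine h.trans ((add_assoc _ _ _).trans (congrArg₂ (· + ·)
            (M.monomial_same _ _ _ _).symm ((add_comm _ _).trans (congrArg₂ (· + ·)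
            (M.orbitsD_monomial_same 0 (n + 1) (by simp) e).symm
            (M.orbitsD_monomial_pred 0 n (by omega) _).symm))))
        | succ q =>
          rw [Pi.add_apply, Pi.add_apply, M.monomial_ne _ _ _ _ _ (by simp),
            M.orbitsD_monomial_of_lt _ _ _ _ _ (by simp),
            M.orbitsD_monomial_eq_zero 0 n _ _ hia _ (by simp), hP _ (by simp)]
          simp
    | succ P ih =>
      intro n x hx hP
      obtain hn | ⟨j, hj⟩ : n < 2 * (P + 1) ∨ ∃ j, 2 * (P + 1) + j = n := by
        obtain h | h := lt_or_ge n (2 * (P + 1))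
        · exact .inl h
        · exact .inr ⟨n - 2 * (P + 1), by omega⟩
      · refine ih n x hx fun i hi => hP i ?_
        have := i.2
        omega
      -- It suffices to find an element whose boundary agrees with `x` above `u^{-P}`.
      · suffices H : ∃ y : M.OrbitsX (n + 1), ∀ i, P < i.1.1 → x i = M.orbitsD n y i by
          obtain ⟨y, hy⟩ := H
          obtain ⟨a, y', ha, h⟩ := ih n (x - M.orbitsD n y) (fun m => by
            refine (map_sub (M.homotopyOrbits.d n m).hom x (M.orbitsD n y)).trans ?_
            rw [← M.homotopyOrbits_d_apply]
            exact (congrArg₂ (· - ·) (hx m) (d_comp_apply _ _ _ _ _)).trans (sub_zero _))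
            fun i hi => sub_eq_zero_of_eq (hy i hi)
          refine ⟨a, y + y', ha, ?_⟩
          rw [map_add, add_left_comm, ← h, add_sub_cancel]
        have h0 := M.cycle_apply x hx (P + 1) j hj hP
        have h1 := M.cycle_apply_B x hx P j hj
        cases j with
        | zero =>
          obtain ⟨a, e, h⟩ := hzero (x ⟨(P + 1, 0), hj⟩)
          obtain ⟨b, hb⟩ := hB 0 a (-(x ⟨(P, 2), by dsimp only; omega⟩) + M.B 1 e)
            (cycle_zero _ _) (by
              rw [map_add, M.d_B, map_neg, ← h1, h, map_add]
              abel)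
          refine ⟨M.monomial (P + 1) 1 (by omega) (i.f 1 b + e), fun l hi => ?_⟩
          obtain ⟨⟨q, l⟩, hl⟩ := l
          dsimp only at hi hl
          obtain ⟨rfl, rfl⟩ : q = P + 1 ∧ l = 0 := by omega
          rw [M.orbitsD_monomial_same (P + 1) 0 hj, map_add, ← f_d_apply, hb, h]
        | succ j =>
          obtain ⟨a, a', e, ha, ha', h⟩ := hsucc j _ h0
          have hia (m : ℕ) : M.C.d j m (i.f j a') = 0 := by rw [← f_d_apply, ha', map_zero]
          -- The leading coefficient is `i a + B i a' + ∂e`. Applying `B`, and using `B² = 0` and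
          -- `B∂ = -∂B`, one finds `B i a = ∂(B e - x_P)`, where `x_P` is the coefficient at
          -- `u^{-P}`. Hence `a` is a boundary.
          obtain ⟨b, hb⟩ := hB (j + 1) a
            (-(x ⟨(P, j + 3), by dsimp only; omega⟩) + M.B (j + 2) e) ha (by
              rw [map_add, M.d_B, map_neg, ← h1, h, map_add, map_add, M.B_B]
              abel)
          -- The first monomial accounts for `i a + ∂e`. The second sits one power higher and
          -- accounts for `B i a'`; it contributes nothing at its own power because `a'` is a cycle.
          refine ⟨M.monomial (P + 1) (j + 2) (by omega) (i.f (j + 2) b + e) +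
            M.monomial (P + 2) j (by omega) (i.f j a'), fun l hi => ?_⟩
          obtain ⟨⟨q, l⟩, hl⟩ := l
          dsimp only at hi hl
          rw [map_add, Pi.add_apply]
          obtain rfl | hq : q = P + 1 ∨ P + 1 < q := by omega
          · obtain rfl : l = j + 1 := by omega
            rw [M.orbitsD_monomial_same (P + 1) (j + 1) hj, map_add, ← f_d_apply, hb, h,
              M.orbitsD_monomial_pred (P + 1) j]
            abel
          · rw [M.orbitsD_monomial_of_lt _ _ _ _ _ hq,
              M.orbitsD_monomial_eq_zero (P + 1) j _ _ hia _ hq, hP _ hq, add_zero]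
  refine .of_injective_surjective (fun n x d hx h => ?_) fun n d hd => ?_
  · obtain ⟨a, y, ha, e⟩ := key n n x hx fun i hi => by
      have := i.2
      omega
    obtain ⟨e', he'⟩ := hF n a ha
    have h1 : F.f n x = F.f n (M.monomial 0 n (by simp) (i.f n a)) + D.d (n + 1) n (F.f (n + 1) y) := by
      refine ((congrArg (F.f n) e).trans (map_add (F.f n).hom _ _)).trans
        (congrArg _ ((congrArg (F.f n) (M.homotopyOrbits_d_apply n y)).symm.trans
          (f_d_apply F (n + 1) n y)))
    -- From `F x = ∂d` and `F x = a + ∂e' + ∂(F y)` it follows that `a = ∂(d - F y - e')`, so `u⁰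
    -- i(a)` bounds.
    refine ⟨M.monomial 0 (n + 1) (by simp) (i.f (n + 1) (d - F.f (n + 1) y - e')) + y, ?_⟩
    refine (M.homotopyOrbits_d_apply n _).trans ?_
    refine (map_add (M.orbitsD n) _ _).trans (Eq.trans ?_ e.symm)
    refine congrArg (· + M.orbitsD n y) (M.orbits_ext fun q j h' => ?_)
    cases q with
    | zero =>
      obtain rfl : j = n := by omega
      rw [M.orbitsD_monomial_same 0 j (by simp), monomial_same, ← f_d_apply]
      refine congrArg _ ?_
      rw [map_sub, map_sub, he', ← h, h1]
      abel
    | succ q => rw [M.orbitsD_monomial_of_lt _ _ _ _ _ (by simp), M.monomial_ne _ _ _ _ _ (by simp)]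
  · obtain ⟨e, he⟩ := hF n d hd
    refine ⟨M.monomial 0 n (by simp) (i.f n d), e, fun m => ?_, he.symm⟩
    by_cases hm : m + 1 = n
    · subst hm
      refine (M.homotopyOrbits_d_apply m _).trans (M.orbits_ext fun q j h' => ?_)
      cases q with
      | zero =>
        obtain rfl : j = m := by omega
        rw [M.orbitsD_monomial_same 0 j (by simp), ← f_d_apply, hd, map_zero]
        rfl
      | succ q => exact M.orbitsD_monomial_of_lt _ _ _ _ _ (by simp)
    · rw [M.homotopyOrbits.shape _ _ hm]
      rfl

end TModule
end HomotopyOrbits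
end

noncomputable section
namespace HomotopyOrbits
open Simplicial

/-! ### Free modules on sets with a map -/

section Finsupp
variable {k : Type u} [CommRing k] {A A' : Type*}

/-- The kernel of a map of free modules induced by a map of bases is spanned by differences of
basis elements. -/
lemma mem_of_lmapDomain_eq_zero (f : A → A') (P : Submodule k (A →₀ k))
    (h : ∀ a b, f a = f b → Finsupp.single a 1 - Finsupp.single b 1 ∈ P) (x : A →₀ k)
    (hx : Finsupp.lmapDomain k k f x = 0) : x ∈ P := by
  cases isEmpty_or_nonempty A with
  | inl _ =>
    rw [Subsingleton.elim x 0]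
    exact P.zero_mem
  | inr _ =>
    have key (y : A →₀ k) : y - Finsupp.lmapDomain k k (Function.invFun f)
        (Finsupp.lmapDomain k k f y) ∈ P := by
      induction y using Finsupp.induction_linear with
      | zero => simp
      | add y y' hy hy' =>
        rw [map_add, map_add, add_sub_add_comm]
        exact P.add_mem hy hy'
      | single a r =>
        have h1 := P.smul_mem r (h a (Function.invFun f (f a))
          (Function.invFun_eq ⟨a, rfl⟩).symm)
        simpa [smul_sub] using h1
    have := key x
    rwa [hx, map_zero, sub_zero] at this

lemma lmapDomain_surjective (f : A → A') (hf : Function.Surjective f) :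
    Function.Surjective (Finsupp.lmapDomain k k f) :=
  Finsupp.mapDomain_surjective hf

/-- Finitely supported functions that are invariant under a map with infinite orbits vanish. -/
lemma eq_zero_of_lmapDomain_eq (t : A → A) (ht : Function.Injective t) (r : A → ℝ)
    (hr : ∀ a, r a < r (t a)) (x : A →₀ k) (hx : Finsupp.lmapDomain k k t x = x) : x = 0 := by
  by_contra h
  -- Invariance puts `t a` into the support along with `a`, although `r` is larger there.
  obtain ⟨a, ha, hmax⟩ := x.support.exists_max_image r (Finsupp.support_nonempty_iff.2 h)
  have h1 : x (t a) = x a := by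
    conv_lhs => rw [← hx]
    exact Finsupp.mapDomain_apply ht x a
  exact (hmax (t a) (by rwa [Finsupp.mem_support_iff, h1, ← Finsupp.mem_support_iff])).not_gt (hr a)

end Finsupp

/-! ### Lifting the fundamental cycle to the real line -/

section RealLift
variable {k : Type u} [CommRing k]

/-- The lift of `circleLoop` to the real line. -/
def realLoop : (Sing ℝ) _⦋1⦌ :=
  ofMap (n := op ⦋1⦌) ⟨fun t : stdSimplex ℝ (Fin 2) => 2 * Real.pi * t 0,
    continuous_const.mul ((continuous_apply (0 : Fin 2)).comp continuous_subtype_val)⟩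

lemma toMap_realLoop (t : stdSimplex ℝ (Fin 2)) : toMap realLoop t = 2 * Real.pi * t 0 := by
  simp [realLoop]

lemma compSimplex_exp_realLoop : compSimplex Circle.exp realLoop = circleLoop :=
  simplex_ext fun t => by
    rw [toMap_compSimplex]
    refine (congrArg Circle.exp (toMap_realLoop t)).trans (toMap_circleLoop t).symm

lemma toMap_map_const_realLoop (n : ℕ) (i : Fin 2) (t : stdSimplex ℝ (Fin (n + 1))) :
    toMap ((Sing ℝ).map (SimplexCategory.const ⦋n⦌ ⦋1⦌ i).op realLoop) t =
      if i = 0 then 2 * Real.pi else 0 := by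
  rw [toMap_map, toMap_realLoop]
  refine (congrArg (2 * Real.pi * ·) (stdSimplex_map_const i 0 t)).trans ?_
  split_ifs <;> simp

/-- Fundamental cycles lift to `1`-chains of the real line from the period to zero. -/
lemma IsFundamentalCycle.exists_real_lift {z : Chain k Circle 1} (hz : IsFundamentalCycle z) :
    ∃ z' : Chain k ℝ 1, push k Circle.exp 1 z' = z ∧
      ∀ (Z : Type v) [TopologicalSpace Z] [SMul ℝ Z] [ContinuousSMul ℝ Z] (T : C(Z, Z)),
        (∀ x : Z, (0 : ℝ) • x = x) → (∀ x : Z, (2 * Real.pi) • x = T x) → ∀ n c,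
          cross₀ k n (boundary k ℝ 0 z') c = c - push k T n c := by
  obtain ⟨w, rfl⟩ := hz
  -- Although `z` need not lift to a cycle, the `2`-chain relating it to `circleLoop` lifts simplex
  -- by simplex, so the boundary of the lift of `z` is that of `realLoop`, which runs from `2π` to
  -- `0`.
  obtain ⟨w', rfl⟩ : ∃ w', push k Circle.exp 2 w' = w :=
    lmapDomain_surjective _ (fun τ => exists_exp_lift τ) w
  refine ⟨Finsupp.single realLoop 1 + boundary k ℝ 1 w', ?_, fun Z _ _ _ T h0 hT n c => ?_⟩
  · rw [map_add, push_single, compSimplex_exp_realLoop, boundary_push]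
  · rw [map_add, boundary_boundary, add_zero, cross₀_boundary]
    have key (i : Fin 2) (f : C(Z, Z)) (h : ∀ y : Z, (if i = 0 then 2 * Real.pi else 0 : ℝ) • y = f y) :
        Finsupp.lmapDomain k k (act (X := Z)
          ((Sing ℝ).map (SimplexCategory.const ⦋n⦌ ⦋1⦌ i).op realLoop)) = push k f n := by
      refine congrArg (Finsupp.lmapDomain k k) (funext fun σ => simplex_ext fun t => ?_)
      rw [toMap_act, toMap_map_const_realLoop]
      exact h _
    rw [key 1 (ContinuousMap.id Z) h0, key 0 T hT, LinearMap.sub_apply, push_id]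

end RealLift

/-! ### Trivialized circle bundles and their infinite cyclic coverings -/

section Trivialized
variable {Y : Type v} [TopologicalSpace Y] [MulAction Circle Y] [ContinuousSMul Circle Y]
  (κ : C(Y, Circle)) (hκ : ∀ (g : Circle) (y : Y), κ (g • y) = g * κ y)

/-- The section of the projection to the orbit space with values in the fibre of an equivariant
map to the circle. -/
def orbitSection : C(Quotient (MulAction.orbitRel Circle Y), Y) :=
  ⟨Quotient.lift (fun y => (κ y)⁻¹ • y) (by
    rintro _ y ⟨g, rfl⟩
    change (κ (g • y))⁻¹ • g • y = _
    rw [hκ, smul_smul, mul_inv_rev, inv_mul_cancel_right]),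
    Continuous.quotient_lift (by fun_prop) _⟩

lemma orbitSection_toOrbits (y : Y) : orbitSection κ hκ (toOrbits Circle Y y) = (κ y)⁻¹ • y := rfl

lemma toOrbits_orbitSection (b : Quotient (MulAction.orbitRel Circle Y)) :
    toOrbits Circle Y (orbitSection κ hκ b) = b := by
  obtain ⟨y, rfl⟩ := Quotient.exists_rep b
  exact toOrbits_smul _ y

lemma map_orbitSection (b : Quotient (MulAction.orbitRel Circle Y)) :
    κ (orbitSection κ hκ b) = 1 := by
  obtain ⟨y, rfl⟩ := Quotient.exists_rep b
  refine (hκ _ y).trans (inv_mul_cancel _)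

/-- The product of the real line with a space, on which the real numbers act by translation. -/
def RealCylinder (B : Type v) : Type v := ℝ × B

instance (B : Type v) [TopologicalSpace B] : TopologicalSpace (RealCylinder B) :=
  inferInstanceAs (TopologicalSpace (ℝ × B))

instance (B : Type v) : SMul ℝ (RealCylinder B) := ⟨fun s p => (s + p.1, p.2)⟩

instance (B : Type v) [TopologicalSpace B] : ContinuousSMul ℝ (RealCylinder B) :=
  ⟨by
    have h : Continuous fun p : ℝ × ℝ × B => (p.1 + p.2.1, p.2.2) := by fun_prop
    exact h⟩

namespace RealCylinder
variable (B : Type v) [TopologicalSpace B]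

/-- The projection of the cylinder. -/
def proj : C(RealCylinder B, B) := (ContinuousMap.snd : C(ℝ × B, B))

/-- The zero section of the cylinder. -/
def zero : C(B, RealCylinder B) := ⟨fun b => ((0 : ℝ), b), by
  have h : Continuous fun b : B => ((0 : ℝ), b) := by fun_prop
  exact h⟩

/-- The translation of the cylinder by the period. -/
def shift : C(RealCylinder B, RealCylinder B) := ⟨fun p => (2 * Real.pi) • p, by fun_prop⟩

variable {B} (k : Type u) [CommRing k]

/-- Scaling the real coordinate contracts the cylinder onto its zero section. -/
lemma exists_boundary_eq (n : ℕ) (c : Chain k (RealCylinder B) n)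
    (hc : ∀ m, (singularChains k (RealCylinder B)).d n m c = 0) :
    ∃ e : Chain k (RealCylinder B) (n + 1), c = push k (zero B) n (push k (proj B) n c) +
      boundary k (RealCylinder B) n e := by
  have h : Continuous fun p : unitInterval × ℝ × B => ((p.1 : ℝ) * p.2.1, p.2.2) := by fun_prop
  let H : C(unitInterval × RealCylinder B, RealCylinder B) :=
    ⟨fun p => ((p.1 : ℝ) * p.2.1, p.2.2), h⟩
  obtain ⟨e, he⟩ := exists_boundary_eq_of_homotopy k H ((zero B).comp (proj B)) (ContinuousMap.id _)
    (fun y => Prod.ext (zero_mul _) rfl) (fun y => Prod.ext (one_mul _) rfl) n c hc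
  refine ⟨e, ?_⟩
  rw [he, push_id, push_push, add_sub_cancel]

lemma shift_injective : Function.Injective (shift B) := by
  intro p p' h
  have h' : (2 * Real.pi + p.1, p.2) = (2 * Real.pi + p'.1, p'.2) := h
  rw [Prod.mk.injEq] at h'
  exact Prod.ext (add_left_cancel h'.1) h'.2

/-- This is injectivity of `1 - T` on chains: translation strictly increases the height of the
zeroth vertex, so no nonzero finite chain is invariant. -/
lemma eq_zero_of_push_shift_eq (n : ℕ) (c : Chain k (RealCylinder B) n)
    (hc : push k (shift B) n c = c) : c = 0 := by
  refine eq_zero_of_lmapDomain_eq (compSimplex (shift B)) (fun σ τ h => simplex_ext fun t => ?_)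
    (fun σ : (Sing (RealCylinder B)) _⦋n⦌ =>
      (toMap σ (stdSimplex.vertex (S := ℝ) (0 : Fin (n + 1)))).1) (fun σ => ?_) c hc
  · exact shift_injective (congrArg (fun σ => toMap σ t) h)
  · have h : (0 : ℝ) < 2 * Real.pi := by positivity
    exact lt_add_of_pos_left _ h

end RealCylinder

/-- The infinite cyclic covering of a trivialized principal circle bundle. -/
def realCover : C(RealCylinder (Quotient (MulAction.orbitRel Circle Y)), Y) :=
  ⟨fun p => Circle.exp p.1 • orbitSection κ hκ p.2, by
    have h : Continuous fun p : ℝ × Quotient (MulAction.orbitRel Circle Y) =>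
      Circle.exp p.1 • orbitSection κ hκ p.2 := by fun_prop
    exact h⟩

lemma realCover_smul (s : ℝ) (p : RealCylinder (Quotient (MulAction.orbitRel Circle Y))) :
    realCover κ hκ (s • p) = Circle.exp s • realCover κ hκ p := by
  change Circle.exp (s + p.1) • orbitSection κ hκ p.2 =
    Circle.exp s • Circle.exp p.1 • orbitSection κ hκ p.2
  rw [Circle.exp_add, mul_smul]

lemma toOrbits_realCover (p : RealCylinder (Quotient (MulAction.orbitRel Circle Y))) :
    toOrbits Circle Y (realCover κ hκ p) = RealCylinder.proj _ p :=
  (toOrbits_smul _ _).trans (toOrbits_orbitSection κ hκ _)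

lemma map_realCover (p : RealCylinder (Quotient (MulAction.orbitRel Circle Y))) :
    κ (realCover κ hκ p) = Circle.exp p.1 := by
  refine (hκ _ _).trans ?_
  rw [map_orbitSection, mul_one]

lemma realCover_zero (b : Quotient (MulAction.orbitRel Circle Y)) :
    realCover κ hκ (RealCylinder.zero _ b) = orbitSection κ hκ b := by
  change Circle.exp 0 • orbitSection κ hκ b = _
  rw [Circle.exp_zero, one_smul]

/-- A simplex is determined by its image in the orbit space and its image under `κ`; the latter
lifts to the real line. -/
lemma compSimplex_realCover_surjective (n : ℕ) : Function.Surjective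
    (compSimplex (realCover κ hκ) : _ → (Sing Y) _⦋n⦌) := by
  intro σ
  obtain ⟨ρ, hρ⟩ := exists_exp_lift (ofMap (n := op ⦋n⦌) (κ.comp (toMap σ)))
  have h : Continuous fun t : stdSimplex ℝ (Fin (n + 1)) =>
    (toMap ρ t, toOrbits Circle Y (toMap σ t)) := by fun_prop
  refine ⟨ofMap (n := op ⦋n⦌) ⟨_, h⟩, simplex_ext fun t => ?_⟩
  have h1 : Circle.exp (toMap ρ t) = κ (toMap σ t) := by
    have := congrArg (fun τ => toMap τ t) hρ
    dsimp only at this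
    rwa [toMap_ofMap, toMap_compSimplex] at this
  rw [toMap_compSimplex, toMap_ofMap]
  change Circle.exp (toMap ρ t) • orbitSection κ hκ (toOrbits Circle Y (toMap σ t)) = _
  rw [h1, orbitSection_toOrbits, smul_inv_smul]

lemma RealCylinder.toMap_iterate_shift {B : Type v} [TopologicalSpace B] (m n : ℕ)
    (σ : (Sing (RealCylinder B)) _⦋n⦌) (t : stdSimplex ℝ (Fin (n + 1))) :
    toMap ((compSimplex (shift B))^[m] σ) t =
      ((m * (2 * Real.pi) + (toMap σ t).1, (toMap σ t).2) : ℝ × B) := by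
  induction m with
  | zero => exact Prod.ext (by simp) rfl
  | succ m ih =>
    rw [Function.iterate_succ_apply', toMap_compSimplex, ih]
    refine Prod.ext ?_ rfl
    change 2 * Real.pi + (m * (2 * Real.pi) + (toMap σ t).1) = _
    push_cast
    ring

/-- Two simplices of the cylinder over the same simplex have the same base coordinate, and their
heights differ at each point by an integer multiple of the period. This integer is continuous on a
connected simplex, hence constant. Natural iterates in either direction avoid inverting the
translation. -/
lemma realCover_eq_of_compSimplex_eq (n : ℕ)
    (σ τ : (Sing (RealCylinder (Quotient (MulAction.orbitRel Circle Y)))) _⦋n⦌)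
    (h : compSimplex (realCover κ hκ) σ = compSimplex (realCover κ hκ) τ) :
    ∃ m : ℕ, (compSimplex (RealCylinder.shift _))^[m] σ = τ ∨
      (compSimplex (RealCylinder.shift _))^[m] τ = σ := by
  have h1 (t : stdSimplex ℝ (Fin (n + 1))) :
      realCover κ hκ (toMap σ t) = realCover κ hκ (toMap τ t) :=
    congrArg (fun σ => toMap σ t) h
  have h2 (t : stdSimplex ℝ (Fin (n + 1))) : (toMap σ t).2 = (toMap τ t).2 := by
    have := congrArg (toOrbits Circle Y) (h1 t)
    rwa [toOrbits_realCover, toOrbits_realCover] at this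
  have h3 (t : stdSimplex ℝ (Fin (n + 1))) :
      ∃ m : ℤ, (toMap σ t).1 = (toMap τ t).1 + m * (2 * Real.pi) := by
    have := congrArg κ (h1 t)
    rwa [map_realCover, map_realCover, Circle.exp_eq_exp] at this
  choose m hm using h3
  have hfst : Continuous fun p : RealCylinder (Quotient (MulAction.orbitRel Circle Y)) => p.1 :=
    (continuous_fst : Continuous fun p : ℝ × Quotient (MulAction.orbitRel Circle Y) => p.1)
  have hc : Continuous m := by
    rw [Int.isClosedEmbedding_coe_real.isInducing.continuous_iff]
    have e : (fun m : ℤ => (m : ℝ)) ∘ m =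
        fun t => ((toMap σ t).1 - (toMap τ t).1) / (2 * Real.pi) := by
      funext t
      rw [hm t, Function.comp_apply]
      field_simp
      ring
    rw [e]
    exact ((hfst.comp (toMap σ).continuous).sub (hfst.comp (toMap τ).continuous)).div_const _
  have hm0 (t) : m t = m (stdSimplex.vertex (S := ℝ) (0 : Fin (n + 1))) :=
    PreconnectedSpace.constant inferInstance hc
  generalize m (stdSimplex.vertex (S := ℝ) (0 : Fin (n + 1))) = m₀ at hm0
  obtain ⟨l, rfl | rfl⟩ := m₀.eq_nat_or_neg
  · refine ⟨l, .inr (simplex_ext fun t => ?_)⟩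
    rw [RealCylinder.toMap_iterate_shift]
    refine Prod.ext ?_ (h2 t).symm
    rw [hm t, hm0 t]
    push_cast
    ring
  · refine ⟨l, .inl (simplex_ext fun t => ?_)⟩
    rw [RealCylinder.toMap_iterate_shift]
    refine Prod.ext ?_ (h2 t)
    rw [hm t, hm0 t]
    push_cast
    ring

variable (k : Type u) [CommRing k]

/-- Exactness in the middle of `0 → S_*(ℝ × B) → S_*(ℝ × B) → S_*(Y) → 0`: the kernel is spanned by
differences `σ - T^m σ`, which telescope into elements `τ - T τ`. -/
lemma exists_sub_push_shift (n : ℕ)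
    (c : Chain k (RealCylinder (Quotient (MulAction.orbitRel Circle Y))) n)
    (hc : push k (realCover κ hκ) n c = 0) : ∃ c', c' - push k (RealCylinder.shift _) n c' = c := by
  refine mem_of_lmapDomain_eq_zero _ (LinearMap.range (LinearMap.id -
    push k (RealCylinder.shift _) n)) (fun σ τ h => ?_) c hc
  have key (m : ℕ) (σ) : Finsupp.single σ 1 -
      Finsupp.single ((compSimplex (RealCylinder.shift _))^[m] σ) 1 ∈
      LinearMap.range (LinearMap.id - push k (RealCylinder.shift
        (Quotient (MulAction.orbitRel Circle Y))) n) := by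
    induction m generalizing σ with
    | zero => simp
    | succ m ih =>
      have h1 := Submodule.add_mem _ (LinearMap.mem_range_self (LinearMap.id - push k
        (RealCylinder.shift _) n) (Finsupp.single σ 1)) (ih (compSimplex (RealCylinder.shift _) σ))
      rw [LinearMap.sub_apply, push_single, LinearMap.id_apply, sub_add_sub_cancel] at h1
      exact h1
  obtain ⟨m, rfl | rfl⟩ := realCover_eq_of_compSimplex_eq κ hκ n σ τ h
  · exact key m σ
  · rw [← neg_sub]
    exact Submodule.neg_mem _ (key m τ)

variable {k} {z : Chain k Circle 1} (hz : IsFundamentalCycle z)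

/-- For a trivialized principal circle bundle, the singular chains on the orbit space are the
homotopy orbits. -/
theorem coneAcyclic_orbitsTo_of_trivialized (κ : C(Y, Circle))
    (hκ : ∀ (g : Circle) (y : Y), κ (g • y) = g * κ y) :
    ConeAcyclic (orbitsTo hz (toOrbits Circle Y) toOrbits_smul) := by
  obtain ⟨z', hz', H⟩ := hz.exists_real_lift.{u, v}
  let B := Quotient (MulAction.orbitRel Circle Y)
  let j := RealCylinder.zero B
  let q := realCover κ hκ
  let T := RealCylinder.shift B
  have hi (n : ℕ) (c : Chain k B n) : push k q n (push k j n c) = push k (orbitSection κ hκ) n c := by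
    rw [push_push]
    exact congrArg (fun f => push k f n c) (ContinuousMap.ext (realCover_zero κ hκ))
  have hj (n : ℕ) (c : Chain k B n) : push k (RealCylinder.proj B) n (push k j n c) = c :=
    (push_push k _ _ n c).trans (push_id k n c)
  have hB (n : ℕ) (c) : push k q (n + 1) (cross k n z' c) = cross k n z (push k q n c) := by
    rw [push_cross_of_equivariant k Circle.exp q (realCover_smul κ hκ), hz']
  -- By the Leibniz rule, `z' × y` for a cycle `y` of the cylinder therefore has boundary `y - T y`.
  -- This identity links `B` with the connecting map of the exact sequence.
  have hT (n : ℕ) (c) : cross₀ k n (boundary k ℝ 0 z') c = c - push k T n c :=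
    H (RealCylinder B) T (fun x => Prod.ext (zero_add x.1) rfl) (fun x => rfl) n c
  have hs (n : ℕ) (c : Chain k Y n) : ∃ c', push k q n c' = c :=
    lmapDomain_surjective _ (compSimplex_realCover_surjective κ hκ n) c
  have hinj (n : ℕ) (c : Chain k (RealCylinder B) n) (hc : c - push k T n c = 0) : c = 0 :=
    RealCylinder.eq_zero_of_push_shift_eq k n c (sub_eq_zero.1 hc).symm
  refine TModule.coneAcyclic_of_section (M := chainsTModule hz Y) _ (pushHom k (orbitSection κ hκ))
    (fun n a ha => ?_) (fun x => ?_) (fun n x hx => ?_) fun n a e ha he => ?_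
  -- Pushing `i a` down to the orbit space gives back `a`, so the comparison map sends `u⁰ i(a)` to
  -- the normalization of `a`, which is homologous to `a`.
  · obtain ⟨e, he⟩ := exists_boundary_eq_normalize_sub k n a ha
    refine ⟨e, (singularChains_d_apply k n e).trans (he.trans (congrArg (· - a) ?_))⟩
    rw [orbitsTo_apply, TModule.monomial_same]
    refine congrArg _ (Eq.symm ((push_push k _ _ n a).trans (Eq.trans ?_ (push_id k n a))))
    exact congrArg (fun f => push k f n a) (ContinuousMap.ext (toOrbits_orbitSection κ hκ))
  · obtain ⟨c, rfl⟩ := hs 0 x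
    obtain ⟨e, he⟩ := RealCylinder.exists_boundary_eq k 0 c (cycle_zero _ _)
    refine ⟨push k (RealCylinder.proj B) 0 c, push k q 1 e, ?_⟩
    refine Eq.trans ?_ (congrArg₂ (· + ·) (hi 0 _) ((singularChains_d_apply k 0 _).trans
      (boundary_push k q 0 e)).symm)
    conv_lhs => rw [he, map_add]
    rfl
  · change Chain k Y (n + 1) at x
    have hx' : boundary k Y n x = 0 := (singularChains_d_apply k n x).symm.trans (hx n)
    obtain ⟨c, rfl⟩ := hs (n + 1) x
    rw [boundary_push] at hx'
    -- Lift the cycle `x` to a chain `c` on the cylinder. Its boundary dies in `Y`, hence is `y - T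
    -- y`. Injectivity of `1 - T` makes `y` a cycle, and then `c - z' × y` is a cycle too. Pushing
    -- forward splits `x` into the image of this cycle and `B` of the image of `y`; the contraction
    -- of the cylinder moves both cycles to the zero section.
    obtain ⟨y, hy⟩ := exists_sub_push_shift κ hκ k n _ hx'
    have hy' (m : ℕ) : (singularChains k (RealCylinder B)).d n m y = 0 := by
      cases n with
      | zero => exact cycle_zero _ _ _
      | succ n =>
        refine cycle_succ _ ((singularChains_d_apply k n y).trans (hinj n _ ?_)) m
        rw [← boundary_push, ← map_sub, hy, boundary_boundary]
    obtain ⟨e₁, he₁⟩ := RealCylinder.exists_boundary_eq k n y hy'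
    have hc : ∀ m, (singularChains k (RealCylinder B)).d (n + 1) m (c - cross k n z' y) = 0 := by
      refine cycle_succ _ ((singularChains_d_apply k n _).trans ?_)
      rw [map_sub, boundary_cross_of_cycle k n z' y hy', hT, hy, sub_self]
      rfl
    obtain ⟨e₂, he₂⟩ := RealCylinder.exists_boundary_eq k (n + 1) _ hc
    refine ⟨push k (RealCylinder.proj B) (n + 1) (c - cross k n z' y),
      push k (RealCylinder.proj B) n y, push k q (n + 2) e₂ - cross k (n + 1) z (push k q (n + 1) e₁),
      fun m => ?_, fun m => ?_, ?_⟩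
    · refine (f_d_apply (pushHom k (RealCylinder.proj B)) (n + 1) m _).symm.trans ?_
      rw [hc, map_zero]
    · refine (f_d_apply (pushHom k (RealCylinder.proj B)) n m _).symm.trans ?_
      rw [hy', map_zero]
    · have h1 : push k q (n + 1) c = push k q (n + 1) (c - cross k n z' y) +
          cross k n z (push k q n y) := by
        rw [map_sub, hB, sub_add_cancel]
      have h2 : cross k n z (push k q n y) = cross k n z (push k (orbitSection κ hκ) n
          (push k (RealCylinder.proj B) n y)) - boundary k Y (n + 1) (cross k (n + 1) z
            (push k q (n + 1) e₁)) := by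
        rw [boundary_cross, hz.boundary_eq_zero, map_zero, LinearMap.zero_apply, zero_sub,
          sub_neg_eq_add, boundary_push, ← map_add, ← hi, ← map_add, ← he₁]
      have h3 : push k q (n + 1) (c - cross k n z' y) = push k (orbitSection κ hκ) (n + 1)
          (push k (RealCylinder.proj B) (n + 1) (c - cross k n z' y)) +
            boundary k Y (n + 1) (push k q (n + 2) e₂) := by
        rw [← hi, boundary_push, ← map_add, ← he₂]
      refine Eq.trans ?_ (congrArg (fun w : Chain k Y (n + 1) => push k (orbitSection κ hκ) (n + 1)
        (push k (RealCylinder.proj B) (n + 1) (c - cross k n z' y)) + cross k n z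
          (push k (orbitSection κ hκ) n (push k (RealCylinder.proj B) n y)) + w)
            (singularChains_d_apply k (n + 1) _).symm)
      rw [map_sub (boundary k Y (n + 1)), h1, h2, h3]
      abel
  · change Chain k B n at a
    have he' : cross k n z (push k (orbitSection κ hκ) n a) = boundary k Y (n + 1) e :=
      Eq.trans he (singularChains_d_apply k (n + 1) e)
    obtain ⟨e, rfl⟩ := hs (n + 2) e
    rw [← hi, ← hB, boundary_push, ← sub_eq_zero, ← map_sub] at he'
    -- If `B i(a)` bounds, then `z' × j(a)` minus a boundary maps to zero in `Y` and so equals `y -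
    -- T y`. Taking boundaries and cancelling `1 - T` gives `∂y = j(a)`, and projecting to the base
    -- shows that `a` bounds.
    obtain ⟨y, hy⟩ := exists_sub_push_shift κ hκ k (n + 1) _ he'
    have hja (m : ℕ) : (singularChains k (RealCylinder B)).d n m (push k j n a) = 0 := by
      refine (f_d_apply (pushHom k j) n m a).symm.trans ?_
      rw [ha, map_zero]
    have h1 := congrArg (boundary k (RealCylinder B) n) hy
    rw [map_sub, map_sub, boundary_boundary, sub_zero, boundary_cross_of_cycle k n z' _ hja, hT,
      boundary_push] at h1
    have h2 : boundary k (RealCylinder B) n y = push k j n a := by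
      refine sub_eq_zero.1 (hinj n _ ?_)
      rw [map_sub, sub_sub_sub_comm, h1, sub_self]
    refine ⟨push k (RealCylinder.proj B) (n + 1) y, (singularChains_d_apply k n _).trans ?_⟩
    rw [boundary_push, h2, hj]

end Trivialized

end HomotopyOrbits
end

noncomputable section
namespace HomotopyOrbits

/-! ### Double complexes and resolutions of chain maps -/

section Resolution

/-- In a first-quadrant double complex with exact rows, in which all columns but the zeroth are
exact, the zeroth column is exact. -/
lemma exact_column_of_exact_rows {E : ℕ → ℕ → Type*} [∀ p n, AddCommGroup (E p n)]
    (d : ∀ p n, E p (n + 1) →+ E p n) (D : ∀ p n, E (p + 1) n →+ E p n)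
    (d_d : ∀ p n x, d p n (d p (n + 1) x) = 0) (D_D : ∀ p n x, D p n (D (p + 1) n x) = 0)
    (d_D : ∀ p n x, d p n (D p (n + 1) x) = D p n (d (p + 1) n x))
    (surj : ∀ n x, ∃ y, D 0 n y = x) (exact : ∀ p n x, D p n x = 0 → ∃ y, D (p + 1) n y = x)
    (col_zero : ∀ p x, ∃ y, d (p + 1) 0 y = x)
    (col_succ : ∀ p n x, d (p + 1) n x = 0 → ∃ y, d (p + 1) (n + 1) y = x) :
    (∀ x, ∃ y, d 0 0 y = x) ∧ ∀ n x, d 0 n x = 0 → ∃ y, d 0 (n + 1) y = x := by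
  -- If `y` becomes a vertical cycle after applying `D`, then `D y` is `D` of a vertical boundary.
  -- By exactness of the row, `d y = D y₂` with `y₂` one column further and one degree lower. The
  -- induction hypothesis replaces `y₂` by a vertical boundary `d w₂`, and then `y - D w₂` is a
  -- vertical cycle in an exact column.
  have key : ∀ n p (y : E (p + 1) (n + 1)), D p n (d (p + 1) n y) = 0 →
      ∃ w, D p (n + 1) y = D p (n + 1) (d (p + 1) (n + 1) w) := by
    intro n
    have step (n p) (y : E (p + 1) (n + 1)) (y₂ : E (p + 2) n) (w₂) (h : D (p + 1) n y₂ =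
        d (p + 1) n y) (h₂ : D (p + 1) n y₂ = D (p + 1) n (d (p + 2) n w₂)) :
        ∃ w, D p (n + 1) y = D p (n + 1) (d (p + 1) (n + 1) w) := by
      obtain ⟨w, hw⟩ := col_succ p n (y - D (p + 1) (n + 1) w₂) (by
        rw [map_sub, d_D, ← h₂, h, sub_self])
      exact ⟨w, by rw [hw, map_sub, D_D, sub_zero]⟩
    induction n with
    | zero =>
      intro p y hy
      obtain ⟨y₂, h⟩ := exact p 0 _ hy
      obtain ⟨w₂, rfl⟩ := col_zero (p + 1) y₂
      exact step 0 p y _ w₂ h rfl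
    | succ n ih =>
      intro p y hy
      obtain ⟨y₂, h⟩ := exact p (n + 1) _ hy
      obtain ⟨w₂, hw₂⟩ := ih (p + 1) y₂ (by rw [← d_D, h, d_d])
      exact step (n + 1) p y y₂ w₂ h hw₂
  refine ⟨fun x => ?_, fun n x hx => ?_⟩
  · obtain ⟨y, rfl⟩ := surj 0 x
    obtain ⟨w, rfl⟩ := col_zero 0 y
    exact ⟨D 0 1 w, d_D _ _ _⟩
  · obtain ⟨y, rfl⟩ := surj (n + 1) x
    obtain ⟨w, hw⟩ := key n 0 y (by rw [← d_D, hx])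
    exact ⟨D 0 (n + 2) w, (d_D _ _ _).trans hw.symm⟩

variable {k : Type u} [CommRing k]

/-- The mapping cone of a chain map, in each degree. -/
def ConeX (C D : ChainComplex (ModuleCat.{w} k) ℕ) : ℕ → Type w
  | 0 => D.X 0
  | n + 1 => C.X n × D.X (n + 1)

instance (C D : ChainComplex (ModuleCat.{w} k) ℕ) : ∀ n, AddCommGroup (ConeX C D n)
  | 0 => inferInstanceAs (AddCommGroup (D.X 0))
  | n + 1 => inferInstanceAs (AddCommGroup (C.X n × D.X (n + 1)))

/-- The differential of the mapping cone. -/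
def coneD {C D : ChainComplex (ModuleCat.{w} k) ℕ} (f : C ⟶ D) :
    ∀ n, ConeX C D (n + 1) →+ ConeX C D n
  | 0 => ((f.f 0).hom ∘ₗ LinearMap.fst k _ _ - (D.d 1 0).hom ∘ₗ LinearMap.snd k _ _).toAddMonoidHom
  | n + 1 => ((C.d (n + 1) n).hom ∘ₗ LinearMap.fst k _ _).toAddMonoidHom.prod
      ((f.f (n + 1)).hom ∘ₗ LinearMap.fst k _ _ -
        (D.d (n + 2) (n + 1)).hom ∘ₗ LinearMap.snd k _ _).toAddMonoidHom

/-- The map of mapping cones induced by a commutative square. -/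
def coneMap {C D C' D' : ChainComplex (ModuleCat.{w} k) ℕ} (g : C ⟶ C') (h : D ⟶ D') :
    ∀ n, ConeX C D n →+ ConeX C' D' n
  | 0 => (h.f 0).hom.toAddMonoidHom
  | n + 1 => AddMonoidHom.prodMap (g.f n).hom.toAddMonoidHom (h.f (n + 1)).hom.toAddMonoidHom

lemma coneD_coneD {C D : ChainComplex (ModuleCat.{w} k) ℕ} (f : C ⟶ D) (n : ℕ)
    (x : ConeX C D (n + 2)) : coneD f n (coneD f (n + 1) x) = 0 := by
  obtain ⟨c, d⟩ := x
  have h : f.f n (C.d (n + 1) n c) - D.d (n + 1) n (f.f (n + 1) c - D.d (n + 2) (n + 1) d) = 0 := by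
    rw [map_sub, f_d_apply, d_comp_apply, sub_zero, sub_self]
  cases n with
  | zero => exact h
  | succ n => exact Prod.ext (d_comp_apply _ _ _ _ _) h

lemma coneD_coneMap {C D C' D' : ChainComplex (ModuleCat.{w} k) ℕ} (f : C ⟶ D) (f' : C' ⟶ D')
    (g : C ⟶ C') (h : D ⟶ D') (e : ∀ n c, h.f n (f.f n c) = f'.f n (g.f n c)) (n : ℕ)
    (x : ConeX C D (n + 1)) : coneD f' n (coneMap g h (n + 1) x) = coneMap g h n (coneD f n x) := by
  obtain ⟨c, d⟩ := x
  have e' : f'.f n (g.f n c) - D'.d (n + 1) n (h.f (n + 1) d) =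
      h.f n (f.f n c - D.d (n + 1) n d) := by
    rw [map_sub, e, f_d_apply]
  cases n with
  | zero => exact e'
  | succ n => exact Prod.ext (f_d_apply _ _ _ _).symm e'

lemma ConeAcyclic.iff_coneD {C D : ChainComplex (ModuleCat.{w} k) ℕ} (f : C ⟶ D) :
    ConeAcyclic f ↔ (∀ x, ∃ y, coneD f 0 y = x) ∧
      ∀ n x, coneD f n x = 0 → ∃ y, coneD f (n + 1) y = x := by
  constructor
  · refine fun hf => ⟨fun d => ?_, fun n x hx => ?_⟩
    · obtain ⟨c, d', h⟩ := hf.zero d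
      exact ⟨(c, d'), sub_eq_iff_eq_add.2 (sub_eq_iff_eq_add'.1 h)⟩
    · obtain ⟨c, d⟩ := x
      obtain ⟨c', d', h, h'⟩ := hf.pair n c d (by
          cases n with
          | zero => exact cycle_zero _ _
          | succ n => exact cycle_succ _ (congrArg Prod.fst hx)) (by
          cases n with
          | zero => exact sub_eq_zero.1 hx
          | succ n => exact sub_eq_zero.1 (congrArg Prod.snd hx))
      exact ⟨(c', d'), Prod.ext h (sub_eq_iff_eq_add.2 (sub_eq_iff_eq_add'.1 h'))⟩
  · refine fun ⟨h₀, h₁⟩ => ⟨fun d => ?_, fun n c d hc h => ?_⟩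
    · obtain ⟨⟨c, d'⟩, h⟩ := h₀ d
      exact ⟨c, d', sub_eq_iff_eq_add.2 (sub_eq_iff_eq_add'.1 h)⟩
    · obtain ⟨⟨c', d'⟩, h'⟩ := h₁ n (c, d) (by
        cases n with
        | zero => exact sub_eq_zero.2 h
        | succ n => exact Prod.ext (hc n) (sub_eq_zero.2 h))
      exact ⟨c', d', congrArg Prod.fst h', sub_eq_iff_eq_add.2 (sub_eq_iff_eq_add'.1
        (congrArg Prod.snd h'))⟩

/-- A chain map is acyclic if it is resolved by acyclic chain maps. -/
theorem ConeAcyclic.of_resolution {P A : ℕ → ChainComplex (ModuleCat.{w} k) ℕ}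
    (f : ∀ p, P p ⟶ A p) (D : ∀ p, P (p + 1) ⟶ P p) (D' : ∀ p, A (p + 1) ⟶ A p)
    (comm : ∀ p n c, (D' p).f n ((f (p + 1)).f n c) = (f p).f n ((D p).f n c))
    (D_D : ∀ p n c, (D p).f n ((D (p + 1)).f n c) = 0)
    (D_D' : ∀ p n c, (D' p).f n ((D' (p + 1)).f n c) = 0)
    (surj : ∀ n c, ∃ c', (D 0).f n c' = c) (surj' : ∀ n c, ∃ c', (D' 0).f n c' = c)
    (exact : ∀ p n c, (D p).f n c = 0 → ∃ c', (D (p + 1)).f n c' = c)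
    (exact' : ∀ p n c, (D' p).f n c = 0 → ∃ c', (D' (p + 1)).f n c' = c)
    (h : ∀ p, ConeAcyclic (f (p + 1))) : ConeAcyclic (f 0) := by
  refine (ConeAcyclic.iff_coneD (f 0)).2 (exact_column_of_exact_rows
    (E := fun p n => ConeX (P p) (A p) n) (fun p n => coneD (f p) n)
    (fun p n => coneMap (D p) (D' p) n) (fun p => coneD_coneD (f p)) (fun p n x => ?_)
    (fun p => coneD_coneMap _ _ _ _ (comm p)) (fun n x => ?_) (fun p n x hx => ?_)
    (fun p => ((ConeAcyclic.iff_coneD _).1 (h p)).1) (fun p => ((ConeAcyclic.iff_coneD _).1 (h p)).2))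
  · cases n with
    | zero => exact D_D' p 0 x
    | succ n => exact Prod.ext (D_D p n x.1) (D_D' p (n + 1) x.2)
  · cases n with
    | zero => exact surj' 0 x
    | succ n =>
      obtain ⟨c, hc⟩ := surj n x.1
      obtain ⟨d, hd⟩ := surj' (n + 1) x.2
      exact ⟨(c, d), Prod.ext hc hd⟩
  · cases n with
    | zero => exact exact' p 0 x hx
    | succ n =>
      obtain ⟨c, hc⟩ := exact p n x.1 (congrArg Prod.fst hx)
      obtain ⟨d, hd⟩ := exact' p (n + 1) x.2 (congrArg Prod.snd hx)
      exact ⟨(c, d), Prod.ext hc hd⟩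

/-- A retract of an acyclic chain map is acyclic. -/
lemma ConeAcyclic.of_retract {C D C' D' : ChainComplex (ModuleCat.{w} k) ℕ} {f : C ⟶ D}
    {f' : C' ⟶ D'} (i : C ⟶ C') (r : C' ⟶ C) (j : D ⟶ D') (s : D' ⟶ D)
    (hi : ∀ n c, j.f n (f.f n c) = f'.f n (i.f n c))
    (hr : ∀ n c, s.f n (f'.f n c) = f.f n (r.f n c))
    (hri : ∀ n c, r.f n (i.f n c) = c) (hsj : ∀ n c, s.f n (j.f n c) = c) (h : ConeAcyclic f') :
    ConeAcyclic f where
  zero d := by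
    obtain ⟨c, d', e⟩ := h.zero (j.f 0 d)
    exact ⟨r.f 0 c, s.f 1 d', by rw [← hr, ← f_d_apply, ← e, map_sub, hsj]⟩
  pair n c d hc e := by
    obtain ⟨c', d', e₁, e₂⟩ := h.pair n (i.f n c) (j.f (n + 1) d)
      (fun m => by rw [← f_d_apply, hc, map_zero]) (by rw [← hi, e, f_d_apply])
    exact ⟨r.f (n + 1) c', s.f (n + 2) d', by rw [← f_d_apply, e₁, hri],
      by rw [← hr, ← f_d_apply, ← e₂, map_sub, hsj]⟩

end Resolution

end HomotopyOrbits
end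

noncomputable section
namespace HomotopyOrbits
open Simplicial

/-! ### Alternating sums of induced maps, and products with tori -/

section AlternatingPush
variable (k : Type u) [CommRing k] {X Z X' Z' : Type v} [TopologicalSpace X] [TopologicalSpace Z]
  [TopologicalSpace X'] [TopologicalSpace Z'] {m : ℕ}

/-- The alternating sum of the maps of singular chains induced by finitely many maps. -/
def altPush (F : Fin m → C(X, Z)) (n : ℕ) : Chain k X n →ₗ[k] Chain k Z n :=
  ∑ i : Fin m, (-1 : ℤ) ^ (i : ℕ) • push k (F i) n

lemma altPush_apply (F : Fin m → C(X, Z)) (n : ℕ) (c : Chain k X n) :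
    altPush k F n c = ∑ i : Fin m, (-1 : ℤ) ^ (i : ℕ) • push k (F i) n c := by
  simp [altPush]

lemma boundary_altPush (F : Fin m → C(X, Z)) (n : ℕ) (c : Chain k X (n + 1)) :
    boundary k Z n (altPush k F (n + 1) c) = altPush k F n (boundary k X n c) := by
  simp only [altPush_apply, map_sum, map_zsmul, boundary_push]

lemma normalize_altPush (F : Fin m → C(X, Z)) (n : ℕ) (c : Chain k X n) :
    normalize k Z n (altPush k F n c) = altPush k F n (normalize k X n c) := by
  simp only [altPush_apply, map_sum, map_zsmul, normalize_push]

lemma push_altPush (F : Fin m → C(X, Z)) (F' : Fin m → C(X', Z')) (f : C(X, X')) (g : C(Z, Z'))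
    (h : ∀ i x, g (F i x) = F' i (f x)) (n : ℕ) (c : Chain k X n) :
    push k g n (altPush k F n c) = altPush k F' n (push k f n c) := by
  simp only [altPush_apply, map_sum, map_zsmul, push_push]
  refine Finset.sum_congr rfl fun i _ => congrArg _ ?_
  exact congrArg (fun f => push k f n c) (ContinuousMap.ext (h i))

lemma altPush_cross {G : Type w} [TopologicalSpace G] [SMul G X] [ContinuousSMul G X] [SMul G Z]
    [ContinuousSMul G Z] (F : Fin m → C(X, Z)) (h : ∀ i (g : G) x, F i (g • x) = g • F i x) (n : ℕ)
    (z : Chain k G 1) (c : Chain k X n) :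
    altPush k F (n + 1) (cross k n z c) = cross k n z (altPush k F n c) := by
  simp only [altPush_apply, map_sum, map_zsmul]
  refine Finset.sum_congr rfl fun i _ => congrArg _ ?_
  rw [push_cross_of_equivariant k (ContinuousMap.id G) (F i) (h i), push_id]

/-- The map `altPush` as a chain map. -/
def altPushHom (F : Fin m → C(X, Z)) : singularChains k X ⟶ singularChains k Z where
  f n := ModuleCat.ofHom (altPush k F n)
  comm' i j hij := by
    obtain rfl : j + 1 = i := hij
    rw [singularChains_d, singularChains_d]
    exact ModuleCat.hom_ext (LinearMap.ext fun x => boundary_altPush k F j x)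

variable {k} {z : Chain k Circle 1} (hz : IsFundamentalCycle z)

/-- The map `altPush` for equivariant maps as a morphism of differential graded modules. -/
def altPushTHom [MulAction Circle X] [ContinuousSMul Circle X] [MulAction Circle Z]
    [ContinuousSMul Circle Z] (F : Fin m → C(X, Z)) (h : ∀ i (g : Circle) x, F i (g • x) = g • F i x) :
    TModule.Hom (chainsTModule hz X) (chainsTModule hz Z) where
  f := altPushHom k F
  f_B n x := altPush_cross k F h n z x

end AlternatingPush

section OrbitMap
variable {G : Type} [Group G] [TopologicalSpace G] {X Z : Type v} [TopologicalSpace X]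
  [TopologicalSpace Z] [MulAction G X] [MulAction G Z]

/-- The map of orbit spaces induced by an equivariant map. -/
def orbitMap (f : C(X, Z)) (hf : ∀ (g : G) x, f (g • x) = g • f x) :
    C(Quotient (MulAction.orbitRel G X), Quotient (MulAction.orbitRel G Z)) :=
  ⟨Quotient.lift (fun x => toOrbits G Z (f x)) (by
    rintro _ x ⟨g, rfl⟩
    exact (congrArg _ (hf g x)).trans (toOrbits_smul _ _)),
    Continuous.quotient_lift ((toOrbits G Z).continuous.comp f.continuous) _⟩

lemma orbitMap_toOrbits (f : C(X, Z)) (hf : ∀ (g : G) x, f (g • x) = g • f x) (x : X) :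
    orbitMap f hf (toOrbits G X x) = toOrbits G Z (f x) := rfl

end OrbitMap

section Torus
variable (Y : Type v) [TopologicalSpace Y]

/-- The product of a space with a torus. -/
def TorusProd (p : ℕ) : Type v := (Fin p → Circle) × Y

namespace TorusProd

instance (p : ℕ) : TopologicalSpace (TorusProd Y p) :=
  inferInstanceAs (TopologicalSpace ((Fin p → Circle) × Y))

variable {Y}

/-- The projection to the torus. -/
def coord (p : ℕ) : C(TorusProd Y p, Fin p → Circle) :=
  (ContinuousMap.fst : C((Fin p → Circle) × Y, Fin p → Circle))

/-- The projection to the given space. -/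
def base (p : ℕ) : C(TorusProd Y p, Y) := (ContinuousMap.snd : C((Fin p → Circle) × Y, Y))

/-- The projection omitting a coordinate of the torus. -/
def face {p : ℕ} (i : Fin (p + 1)) : C(TorusProd Y (p + 1), TorusProd Y p) :=
  ⟨fun x => (fun j => coord _ x (i.succAbove j), base _ x), by
    refine Continuous.prodMk ?_ ?_ <;> fun_prop⟩

/-- The insertion of a coordinate of the torus, on singular simplices. -/
def insert {p n : ℕ} (γ : (Sing Circle) _⦋n⦌) (x : (Sing (TorusProd Y p)) _⦋n⦌) :
    (Sing (TorusProd Y (p + 1))) _⦋n⦌ :=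
  ofMap (n := op ⦋n⦌) ⟨fun t => (Fin.cons (toMap γ t) (coord _ (toMap x t)), base _ (toMap x t)), by
    refine Continuous.prodMk (continuous_pi fun j => ?_) (by fun_prop)
    refine Fin.cases ?_ (fun j => ?_) j
    · simp only [Fin.cons_zero]
      fun_prop
    · simp only [Fin.cons_succ]
      fun_prop⟩

lemma toMap_insert {p n : ℕ} (γ : (Sing Circle) _⦋n⦌) (x : (Sing (TorusProd Y p)) _⦋n⦌) (t) :
    toMap (insert γ x) t = (Fin.cons (toMap γ t) (coord _ (toMap x t)), base _ (toMap x t)) := by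
  rw [insert, toMap_ofMap]
  rfl

lemma face_zero_insert {p n : ℕ} (γ : (Sing Circle) _⦋n⦌) (x : (Sing (TorusProd Y p)) _⦋n⦌) :
    compSimplex (face 0) (insert γ x) = x :=
  simplex_ext fun t => by
    rw [toMap_compSimplex, toMap_insert]
    rfl

lemma face_succ_insert {p n : ℕ} (γ : (Sing Circle) _⦋n⦌) (x : (Sing (TorusProd Y (p + 1))) _⦋n⦌)
    (i : Fin (p + 1)) :
    compSimplex (face i.succ) (insert γ x) = insert γ (compSimplex (face i) x) :=
  simplex_ext fun t => by
    rw [toMap_compSimplex, toMap_insert, toMap_insert]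
    refine Prod.ext (funext fun j => ?_) rfl
    refine Fin.cases ?_ (fun j => ?_) j
    · change Fin.cons (α := fun _ => Circle) (toMap γ t) (coord _ (toMap x t))
        (i.succ.succAbove 0) = toMap γ t
      rw [Fin.succ_succAbove_zero, Fin.cons_zero]
    · change Fin.cons (α := fun _ => Circle) (toMap γ t) (coord _ (toMap x t))
        (i.succ.succAbove j.succ) = coord _ (toMap x t) (i.succAbove j)
      rw [Fin.succ_succAbove_succ, Fin.cons_succ]

lemma exists_insert {p n : ℕ} (x : (Sing (TorusProd Y (p + 1))) _⦋n⦌) :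
    ∃ γ x', x = insert γ x' := by
  refine ⟨ofMap (n := op ⦋n⦌) ⟨fun t => coord _ (toMap x t) 0, by fun_prop⟩, compSimplex (face 0) x,
    simplex_ext fun t => ?_⟩
  rw [toMap_insert, toMap_ofMap, toMap_compSimplex]
  refine Prod.ext (funext fun j => ?_) rfl
  refine Fin.cases ?_ (fun j => ?_) j
  · rfl
  · rfl

variable (k : Type u) [CommRing k]

/-- The insertion of a coordinate that depends on the simplex. -/
def insertHom {p n : ℕ} (h : (Sing (TorusProd Y p)) _⦋n⦌ → (Sing Circle) _⦋n⦌) :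
    Chain k (TorusProd Y p) n →ₗ[k] Chain k (TorusProd Y (p + 1)) n :=
  Finsupp.lmapDomain k k fun x => insert (h x) x

lemma insertHom_single {p n : ℕ} (h : (Sing (TorusProd Y p)) _⦋n⦌ → (Sing Circle) _⦋n⦌) (x) :
    insertHom k h (Finsupp.single x 1) = Finsupp.single (insert (h x) x) 1 :=
  Finsupp.mapDomain_single

lemma altPush_insertHom_zero {n : ℕ} (h : (Sing (TorusProd Y 0)) _⦋n⦌ → (Sing Circle) _⦋n⦌) (c) :
    altPush k (face (Y := Y) (p := 0)) n (insertHom k h c) = c := by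
  refine LinearMap.congr_fun (f := altPush k face n ∘ₗ insertHom k h) (g := LinearMap.id)
    (chain_hom_ext k fun x => ?_) c
  rw [LinearMap.comp_apply, insertHom_single, altPush_apply, Fin.sum_univ_one, push_single]
  simp [face_zero_insert]

/-- Inserting a new first coordinate is a contracting homotopy of the augmented complex: the zeroth
projection undoes it, and the others commute with it up to an index shift that produces the sign.
The inserted simplex may depend on `x`, provided that this dependence is compatible with the
projections. -/
lemma altPush_insertHom_succ {p n : ℕ}
    (h : (Sing (TorusProd Y (p + 1))) _⦋n⦌ → (Sing Circle) _⦋n⦌)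
    (h' : (Sing (TorusProd Y p)) _⦋n⦌ → (Sing Circle) _⦋n⦌)
    (hh : ∀ i x, h' (compSimplex (face i) x) = h x) (c) :
    altPush k (face (Y := Y) (p := p + 1)) n (insertHom k h c) =
      c - insertHom k h' (altPush k face n c) := by
  refine LinearMap.congr_fun (f := altPush k face n ∘ₗ insertHom k h)
    (g := LinearMap.id - insertHom k h' ∘ₗ altPush k face n)
    (chain_hom_ext k fun x => ?_) c
  rw [LinearMap.comp_apply, LinearMap.sub_apply, LinearMap.comp_apply, insertHom_single,
    altPush_apply, altPush_apply, Fin.sum_univ_succ, push_single, face_zero_insert, map_sum]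
  simp only [push_single, face_succ_insert, map_zsmul, insertHom_single, hh, Fin.val_succ, pow_succ,
    Fin.val_zero, pow_zero, one_smul, mul_neg, mul_one, neg_smul, Finset.sum_neg_distrib,
    LinearMap.id_apply, sub_eq_add_neg]

/-- Every simplex is an insertion `s x`, and with `D s = 1 - s D` one gets `D D s x = D x - D s D x
= s D D x`, which vanishes by induction on `p`. For `p = 0` the relation `D s = 1` ends the
induction. -/
lemma altPush_altPush {p n : ℕ} (c : Chain k (TorusProd Y (p + 2)) n) :
    altPush k (face (p := p)) n (altPush k (face (p := p + 1)) n c) = 0 := by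
  induction p with
  | zero =>
    refine LinearMap.congr_fun (f := altPush k face n ∘ₗ altPush k face n) (g := 0)
      (chain_hom_ext k fun x => ?_) c
    obtain ⟨γ, x, rfl⟩ := exists_insert x
    rw [LinearMap.comp_apply, ← insertHom_single k (fun _ => γ), altPush_insertHom_succ k (fun _ => γ)
      (fun _ => γ) (fun _ _ => rfl), map_sub, altPush_insertHom_zero, sub_self]
    rfl
  | succ p ih =>
    refine LinearMap.congr_fun (f := altPush k face n ∘ₗ altPush k face n) (g := 0)
      (chain_hom_ext k fun x => ?_) c
    obtain ⟨γ, x, rfl⟩ := exists_insert x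
    rw [LinearMap.comp_apply, ← insertHom_single k (fun _ => γ), altPush_insertHom_succ k (fun _ => γ)
      (fun _ => γ) (fun _ _ => rfl), map_sub, altPush_insertHom_succ k (fun _ => γ)
      (fun _ => γ) (fun _ _ => rfl), sub_sub_cancel, ih, map_zero]
    rfl

lemma exists_altPush_eq_zero {n : ℕ} (c : Chain k (TorusProd Y 0) n) :
    ∃ c', altPush k face n c' = c :=
  ⟨_, altPush_insertHom_zero k (fun _ => ofMap (n := op ⦋n⦌) (ContinuousMap.const _ 1)) c⟩

lemma exists_altPush_eq_succ {p n : ℕ} (c : Chain k (TorusProd Y (p + 1)) n)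
    (hc : altPush k face n c = 0) : ∃ c', altPush k face n c' = c := by
  refine ⟨_, (altPush_insertHom_succ k
    (fun _ => ofMap (n := op ⦋n⦌) (ContinuousMap.const _ 1)) (fun _ => ofMap (n := op ⦋n⦌) (ContinuousMap.const _ 1)) (fun _ _ => rfl) c).trans ?_⟩
  rw [hc, map_zero, sub_zero]

section Action
variable [MulAction Circle Y]

instance (p : ℕ) : MulAction Circle (TorusProd Y p) where
  smul g x := (fun j => g * coord p x j, g • base p x)
  one_smul _ := Prod.ext (funext fun _ => one_mul _) (one_smul _ _)
  mul_smul _ _ _ := Prod.ext (funext fun _ => mul_assoc _ _ _) (mul_smul _ _ _)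

instance [ContinuousSMul Circle Y] (p : ℕ) : ContinuousSMul Circle (TorusProd Y p) :=
  ⟨by
    have h1 : Continuous fun x : Circle × TorusProd Y p => fun j => x.1 * coord p x.2 j := by
      fun_prop
    have h2 : Continuous fun x : Circle × TorusProd Y p => x.1 • base p x.2 := by fun_prop
    exact h1.prodMk h2⟩

lemma base_smul {p : ℕ} (g : Circle) (x : TorusProd Y p) : base p (g • x) = g • base p x := rfl

lemma face_smul {p : ℕ} (i : Fin (p + 1)) (g : Circle) (x : TorusProd Y (p + 1)) :
    face i (g • x) = g • face i x := rfl

lemma locallyTrivial (hY : LocallyTrivial Circle Y) (p : ℕ) :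
    LocallyTrivial Circle (TorusProd Y p) :=
  hY.comap (base p) (base p).continuous base_smul

/-- The maps of orbit spaces induced by the projections `face`. -/
def orbitFace (Y : Type v) [TopologicalSpace Y] [MulAction Circle Y] {p : ℕ} (i : Fin (p + 1)) :
    C(Quotient (MulAction.orbitRel Circle (TorusProd Y (p + 1))),
      Quotient (MulAction.orbitRel Circle (TorusProd Y p))) :=
  orbitMap (face i) (face_smul i)

lemma push_toOrbits_altPush {p n : ℕ} (c : Chain k (TorusProd Y (p + 1)) n) :
    push k (toOrbits Circle (TorusProd Y p)) n (altPush k face n c) =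
      altPush k (orbitFace Y) n (push k (toOrbits Circle (TorusProd Y (p + 1))) n c) :=
  push_altPush k face (orbitFace Y) (toOrbits Circle (TorusProd Y (p + 1)))
    (toOrbits Circle (TorusProd Y p)) (fun i x => (orbitMap_toOrbits (face i) (face_smul i) x).symm)
    n c

end Action

end TorusProd
end Torus

end HomotopyOrbits
end

noncomputable section
namespace HomotopyOrbits
open Simplicial

/-! ### The resolution of a principal circle bundle -/

section Rows
variable {Y : Type v} [TopologicalSpace Y] [MulAction Circle Y] [ContinuousSMul Circle Y]

/-- Choose a lift of each simplex of the orbit space and let `φ σ` be the unique simplex of the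
circle carrying the chosen lift to `σ`. The choice is made for each `n` separately and need not
respect faces, which is enough for exactness of the rows degree by degree. -/
lemma LocallyTrivial.exists_equivariant_simplex (hY : LocallyTrivial Circle Y) (n : ℕ) :
    ∃ φ : (Sing Y) _⦋n⦌ → (Sing Circle) _⦋n⦌, ∀ (γ : (Sing Circle) _⦋n⦌) σ, φ (act γ σ) = act γ (φ σ) := by
  choose ℓ hℓ using fun b => hY.exists_lift (n := n) b
  choose φ hφ using fun σ : (Sing Y) _⦋n⦌ =>
    hY.exists_act_eq (hℓ (compSimplex (toOrbits Circle Y) σ))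
  refine ⟨φ, fun γ σ => hY.act_injective (τ := ℓ (compSimplex (toOrbits Circle Y) σ)) ?_⟩
  have h := hφ (act γ σ)
  rw [compSimplex_toOrbits_act] at h
  rw [h]
  refine simplex_ext fun t => ?_
  rw [toMap_act, toMap_act, toMap_act, smul_assoc]
  nth_rewrite 1 [← hφ σ]
  rw [toMap_act]

lemma LocallyTrivial.push_toOrbits_surjective (hY : LocallyTrivial Circle Y) (k : Type u) [CommRing k]
    (n : ℕ) : Function.Surjective (push k (toOrbits Circle Y) n) :=
  lmapDomain_surjective _ fun σ => hY.exists_lift σ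

namespace TorusProd

lemma insert_act {p n : ℕ} (γ δ : (Sing Circle) _⦋n⦌) (x : (Sing (TorusProd Y p)) _⦋n⦌) :
    insert (act γ δ) (act γ x) = act γ (insert δ x) :=
  simplex_ext fun t => by
    rw [toMap_insert, toMap_act, toMap_act, toMap_act, toMap_insert]
    refine Prod.ext (funext fun j => ?_) rfl
    refine Fin.cases ?_ (fun j => ?_) j
    · rfl
    · rfl

variable (k : Type u) [CommRing k]

/-- An equivariant insertion descends to the orbit spaces. As simplices with the same image differ
by a simplex of the circle, checking differences of two such simplices is enough. -/
lemma push_insertHom_eq_zero (hY : LocallyTrivial Circle Y) {p n : ℕ}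
    (h : (Sing (TorusProd Y p)) _⦋n⦌ → (Sing Circle) _⦋n⦌) (hh : ∀ (γ : (Sing Circle) _⦋n⦌) x, h (act γ x) = act γ (h x))
    (c : Chain k (TorusProd Y p) n) (hc : push k (toOrbits Circle _) n c = 0) :
    push k (toOrbits Circle _) n (insertHom k h c) = 0 := by
  refine mem_of_lmapDomain_eq_zero _ (LinearMap.ker (push k (toOrbits Circle _) n ∘ₗ
    insertHom k h)) (fun x y e => ?_) c hc
  obtain ⟨γ, rfl⟩ := (locallyTrivial hY p).exists_act_eq e
  rw [LinearMap.mem_ker, map_sub, LinearMap.comp_apply, LinearMap.comp_apply, insertHom_single,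
    insertHom_single, push_single, push_single, hh, insert_act, compSimplex_toOrbits_act, sub_self]

lemma altPush_orbitFace_altPush (hY : LocallyTrivial Circle Y) {p n : ℕ} (c) :
    altPush k (orbitFace Y (p := p)) n (altPush k (orbitFace Y) n c) = 0 := by
  obtain ⟨c, rfl⟩ := (locallyTrivial hY (p + 2)).push_toOrbits_surjective k n c
  rw [← push_toOrbits_altPush, ← push_toOrbits_altPush, altPush_altPush, map_zero]

lemma exists_altPush_orbitFace_eq_zero (hY : LocallyTrivial Circle Y) {n : ℕ} (c) :
    ∃ c', altPush k (orbitFace Y (p := 0)) n c' = c := by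
  obtain ⟨c, rfl⟩ := (locallyTrivial hY 0).push_toOrbits_surjective k n c
  obtain ⟨c, rfl⟩ := exists_altPush_eq_zero k c
  exact ⟨_, (push_toOrbits_altPush k c).symm⟩

/-- A constant insertion is not equivariant, so it gives no contraction on orbit spaces. The
inserted coordinate is instead `φ` of the component in `Y`, which is equivariant and untouched by
the projections. -/
lemma exists_altPush_orbitFace_eq_succ (hY : LocallyTrivial Circle Y) {p n : ℕ} (c)
    (hc : altPush k (orbitFace Y (p := p)) n c = 0) :
    ∃ c', altPush k (orbitFace Y) n c' = c := by
  obtain ⟨φ, hφ⟩ := LocallyTrivial.exists_equivariant_simplex hY n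
  obtain ⟨c, rfl⟩ := (locallyTrivial hY (p + 1)).push_toOrbits_surjective k n c
  have hs (p : ℕ) (γ : (Sing Circle) _⦋n⦌) (x : (Sing (TorusProd Y p)) _⦋n⦌) :
      φ (compSimplex (base _) (act γ x)) = act γ (φ (compSimplex (base _) x)) := by
    rw [← hφ]
    refine congrArg φ (simplex_ext fun t => ?_)
    rw [toMap_compSimplex, toMap_act, toMap_act]
    rfl
  refine ⟨push k (toOrbits Circle _) n (insertHom k
    (fun x => φ (compSimplex (base _) x)) c), ?_⟩
  rw [← push_toOrbits_altPush, altPush_insertHom_succ k _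
    (fun x => φ (compSimplex (base _) x)) (fun _ _ => rfl), map_sub,
    push_insertHom_eq_zero k hY _ (hs p), sub_zero]
  rwa [push_toOrbits_altPush]

end TorusProd

variable {k : Type u} [CommRing k] {z : Chain k Circle 1} (hz : IsFundamentalCycle z)

/-- The comparison maps for `𝕋^p × Y` form a resolution of the one for `p = 0`. For `p ≥ 1` the
bundles are trivialized by a coordinate, so their comparison maps are acyclic. -/
lemma coneAcyclic_orbitsTo_torusProd_zero (hY : LocallyTrivial Circle Y) :
    ConeAcyclic (orbitsTo hz (toOrbits Circle (TorusProd Y 0)) toOrbits_smul) := by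
  refine ConeAcyclic.of_resolution
    (P := fun p => (chainsTModule hz (TorusProd Y p)).homotopyOrbits)
    (A := fun p => singularChains k (Quotient (MulAction.orbitRel Circle (TorusProd Y p))))
    (fun p => orbitsTo hz (toOrbits Circle (TorusProd Y p)) toOrbits_smul)
    (fun p => (altPushTHom hz TorusProd.face TorusProd.face_smul).orbitsMap)
    (fun p => altPushHom k (TorusProd.orbitFace Y)) (fun p n c => ?_) (fun p n c => ?_)
    (fun p n c => TorusProd.altPush_orbitFace_altPush k hY c) (fun n c => ?_)
    (fun n c => TorusProd.exists_altPush_orbitFace_eq_zero k hY c) (fun p n c hc => ?_)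
    (fun p n c hc => TorusProd.exists_altPush_orbitFace_eq_succ k hY c hc) fun p => ?_
  · refine Eq.trans ?_ (congrArg (normalize k _ n) (TorusProd.push_toOrbits_altPush k _)).symm
    exact (normalize_altPush k _ n _).symm
  · exact funext fun i => TorusProd.altPush_altPush k _
  -- The rows of homotopy orbits are exact because the induced maps act on each coefficient of
  -- `u^{-q}` separately.
  · choose c' hc' using fun i => TorusProd.exists_altPush_eq_zero k
      ((show (chainsTModule hz (TorusProd Y 0)).OrbitsX n from c) i)
    exact ⟨c', funext hc'⟩
  · choose c' hc' using fun i => TorusProd.exists_altPush_eq_succ k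
      ((show (chainsTModule hz (TorusProd Y (p + 1))).OrbitsX n from c) i) (congrFun hc i)
    exact ⟨c', funext hc'⟩
  · exact coneAcyclic_orbitsTo_of_trivialized hz ⟨fun x => TorusProd.coord _ x 0, by fun_prop⟩ fun _ _ => rfl

/-- For a principal circle bundle, the homotopy orbits of the singular chains are quasi-isomorphic
to the singular chains on the orbit space. -/
theorem coneAcyclic_orbitsTo (hY : LocallyTrivial Circle Y) :
    ConeAcyclic (orbitsTo hz (toOrbits Circle Y) toOrbits_smul) := by
  -- The space `𝕋⁰ × Y` is only homeomorphic to `Y`; for transporting acyclicity it is enough that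
  -- one comparison map is a retract of the other.
  let i : C(Y, TorusProd Y 0) := ⟨fun y => (Fin.elim0, y), by
    refine Continuous.prodMk ?_ ?_ <;> fun_prop⟩
  have hi (g : Circle) (y : Y) : i (g • y) = g • i y := Prod.ext (Subsingleton.elim _ _) rfl
  let r : C(TorusProd Y 0, Y) := TorusProd.base 0
  have hr (g : Circle) (y : TorusProd Y 0) : r (g • y) = g • r y := rfl
  refine .of_retract (chainsTHom hz i hi).orbitsMap (chainsTHom hz r hr).orbitsMap
    (pushHom k (orbitMap i hi)) (pushHom k (orbitMap r hr)) (fun n c => ?_) (fun n c => ?_)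
    (fun n c => ?_) (fun n c => ?_) (coneAcyclic_orbitsTo_torusProd_zero hz hY)
  · refine (normalize_push k _ n _).symm.trans (congrArg (normalize k _ n) ?_)
    exact (push_push k _ _ n _).trans (push_push k i (toOrbits Circle (TorusProd Y 0)) n _).symm
  · refine (normalize_push k _ n _).symm.trans (congrArg (normalize k _ n) ?_)
    exact (push_push k _ _ n _).trans (push_push k r (toOrbits Circle Y) n _).symm
  · exact funext fun j => (push_push k _ _ _ _).trans (push_id k _ _)
  · refine (push_push k _ _ _ _).trans (Eq.trans ?_ (push_id k _ _))
    refine congrArg (fun f => push k f n c) (ContinuousMap.ext fun b => ?_)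
    obtain ⟨y, rfl⟩ := Quotient.exists_rep b
    rfl

end Rows

end HomotopyOrbits
end

noncomputable section
namespace HomotopyOrbits
open Simplicial

/-! ### Free involutions of bases -/

section FreeInvolution
variable {k : Type u} [CommRing k] {A A' : Type*} {r : A → A}

lemma lmapDomain_apply_of_involutive (hr : Function.Involutive r) (x : A →₀ k) (a : A) :
    Finsupp.lmapDomain k k r x a = x (r a) := by
  conv_lhs => rw [← hr a]
  exact Finsupp.mapDomain_apply hr.injective x (r a)

/-- A free involution has a fundamental domain. -/
lemma exists_fundamentalDomain (hne : ∀ a, r a ≠ a) (f : A → A')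
    (hfr : ∀ a, f (r a) = f a) (hf : ∀ a b, f a = f b → b = a ∨ b = r a) :
    ∃ S : A → Prop, ∀ a, S (r a) ↔ ¬ S a := by
  -- The domain consists of one chosen representative in each fibre of `f`; each fibre is a pair
  -- `{a, r a}`.
  refine ⟨fun a => ∃ h : Nonempty A, Function.invFun f (f a) = a, fun a => ?_⟩
  have h : Nonempty A := ⟨a⟩
  simp only [h, exists_true_left, hfr]
  obtain e | e := hf a _ (Function.invFun_eq ⟨a, rfl⟩ : f (Function.invFun f (f a)) = f a).symm
  · rw [e]
    simpa using (hne a).symm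
  · rw [e]
    simpa using hne a

/-- An invariant element is recovered from its restriction to the fundamental domain by adding the
translate. No division by two occurs, so the coefficient ring is arbitrary. -/
lemma exists_lmapDomain_add_eq (hr : Function.Involutive r) {S : A → Prop}
    (hS : ∀ a, S (r a) ↔ ¬ S a) (x : A →₀ k) (hx : Finsupp.lmapDomain k k r x - x = 0) :
    ∃ y, Finsupp.lmapDomain k k r y + y = x := by
  classical
  refine ⟨x.filter S, Finsupp.ext fun a => ?_⟩
  have h := DFunLike.congr_fun hx a
  rw [Finsupp.sub_apply, lmapDomain_apply_of_involutive hr, Finsupp.zero_apply, sub_eq_zero] at h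
  rw [Finsupp.add_apply, lmapDomain_apply_of_involutive hr]
  by_cases ha : S a <;> simp [hS, ha, h]

lemma exists_lmapDomain_sub_eq (hr : Function.Involutive r) {S : A → Prop}
    (hS : ∀ a, S (r a) ↔ ¬ S a) (x : A →₀ k) (hx : Finsupp.lmapDomain k k r x + x = 0) :
    ∃ y, Finsupp.lmapDomain k k r y - y = x := by
  classical
  refine ⟨-x.filter S, Finsupp.ext fun a => ?_⟩
  have h := DFunLike.congr_fun hx a
  rw [Finsupp.add_apply, lmapDomain_apply_of_involutive hr, Finsupp.zero_apply,
    add_eq_zero_iff_eq_neg] at h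
  rw [Finsupp.sub_apply, lmapDomain_apply_of_involutive hr, Finsupp.neg_apply, Finsupp.neg_apply]
  by_cases ha : S a <;> simp [hS, ha, h]

/-- Basis elements with the same image are equal or exchanged by `r`, so the kernel is spanned by
elements `a - r a`. -/
lemma exists_lmapDomain_sub_eq_of_map_eq_zero (f : A → A')
    (hf : ∀ a b, f a = f b → b = a ∨ b = r a) (x : A →₀ k) (hx : Finsupp.lmapDomain k k f x = 0) :
    ∃ y, Finsupp.lmapDomain k k r y - y = x := by
  refine mem_of_lmapDomain_eq_zero f (LinearMap.range (Finsupp.lmapDomain k k r - LinearMap.id))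
    (fun a b h => ?_) x hx
  obtain rfl | rfl := hf a b h
  · rw [sub_self]
    exact Submodule.zero_mem _
  · refine ⟨-Finsupp.single a 1, ?_⟩
    rw [LinearMap.sub_apply, map_neg, Finsupp.lmapDomain_apply, Finsupp.mapDomain_single,
      LinearMap.id_apply, sub_neg_eq_add, neg_add_eq_sub]

end FreeInvolution

/-! ### The two components of `O(2)` -/

section Reflection

/-- The determinant of an orthogonal matrix. -/
def orthogonalDet (A : O2) : ℝ := A.1 0 0 * A.1 1 1 - A.1 0 1 * A.1 1 0

lemma continuous_orthogonalDet : Continuous orthogonalDet := by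
  have h (i j : Fin 2) : Continuous fun A : O2 => A.1 i j :=
    (continuous_apply_apply i j).comp continuous_subtype_val
  exact ((h 0 0).mul (h 1 1)).sub ((h 0 1).mul (h 1 0))

lemma eq_rotation_of_orthogonalDet_eq_one {A : O2} (h : orthogonalDet A = 1) :
    A = rotation (column A) := by
  obtain ⟨h1, h2, h3⟩ := Frames.entries A
  unfold orthogonalDet at h
  have e1 : A.1 1 1 = A.1 0 0 := by
    linear_combination A.1 0 0 * h - A.1 1 1 * h1 + A.1 1 0 * h3
  have e2 : A.1 0 1 = -A.1 1 0 := by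
    linear_combination -A.1 0 1 * h + A.1 1 1 * h3 - A.1 1 0 * h2
  ext i j
  fin_cases i <;> fin_cases j <;> simp [rotation, coe_column, e1, e2]

lemma eq_rotation_mul_reflection_of_orthogonalDet_eq_neg_one {A : O2} (h : orthogonalDet A = -1) :
    A = rotation (column A) * reflection := by
  obtain ⟨h1, h2, h3⟩ := Frames.entries A
  unfold orthogonalDet at h
  have e1 : A.1 1 1 = -A.1 0 0 := by
    linear_combination A.1 0 0 * h - A.1 1 1 * h1 + A.1 1 0 * h3
  have e2 : A.1 0 1 = A.1 1 0 := by
    linear_combination A.1 0 1 * h - A.1 1 1 * h3 + A.1 1 0 * h2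
  ext i j
  fin_cases i <;> fin_cases j <;> simp [rotation, reflection, coe_column, e1, e2]

lemma orthogonalDet_rotation (g : Circle) : orthogonalDet (rotation g) = 1 := by
  have h := Circle.normSq_coe g
  rw [Complex.normSq_apply] at h
  simp [orthogonalDet, rotation]
  linarith

lemma orthogonalDet_reflection : orthogonalDet reflection = -1 := by
  simp [orthogonalDet, reflection]

/-- The determinant is continuous with values `±1`, so a simplex of `O(2)` stays within one
component. -/
lemma orthogonalDet_const {K : Type*} [TopologicalSpace K] [PreconnectedSpace K]
    (γ : C(K, O2)) : (∀ t, orthogonalDet (γ t) = 1) ∨ ∀ t, orthogonalDet (γ t) = -1 := by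
  refine (isPreconnected_univ.eq_one_or_eq_neg_one_of_sq_eq
    (f := fun t => orthogonalDet (γ t)) ?_ ?_).imp (fun h t => h (Set.mem_univ t))
    fun h t => h (Set.mem_univ t)
  · exact (continuous_orthogonalDet.comp γ.continuous).continuousOn
  · exact fun t _ => Frames.det_sq (γ t)

end Reflection

/-! ### Orbit spaces for rotations and for `O(2)` -/

section Quotients
variable (Y : Type v) [TopologicalSpace Y] [MulAction O2 Y]

lemma LocallyTrivial.res {Y : Type v} [TopologicalSpace Y] [MulAction O2 Y]
    (h : LocallyTrivial O2 Y) : LocallyTrivial Circle (Res Y) := by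
  intro y
  obtain ⟨U, hU, hy, hs, φ, hφ, hg⟩ := h y
  refine ⟨U, hU, hy, fun g x hx => hs (rotation g) x hx, fun x => column (φ x),
    continuous_column.comp_continuousOn hφ, fun g x hx => ?_⟩
  exact (congrArg column (hg (rotation g) x hx)).trans (column_rotation_mul _ _)

/-- The orbit space of the action of the rotations on an `O(2)`-space. -/
abbrev RotationOrbits : Type v := Quotient (MulAction.orbitRel Circle (Res Y))

/-- The projection from the orbit space for the rotations to the orbit space for `O(2)`. -/
def rotationOrbitsProj : C(RotationOrbits Y, Quotient (MulAction.orbitRel O2 Y)) :=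
  ⟨Quotient.lift (fun y : Res Y => toOrbits O2 Y y) (by
    rintro _ y ⟨g, rfl⟩
    exact toOrbits_smul (rotation g) (show Y from y)),
    Continuous.quotient_lift (toOrbits O2 Y).continuous _⟩

variable [ContinuousSMul O2 Y]

lemma reflectionMap_smul (g : Circle) (y : Res Y) :
    reflectionMap Y (g • y) = g⁻¹ • reflectionMap Y y := by
  have key (y : Y) : reflection • rotation g • y = rotation g⁻¹ • reflection • y := by
    rw [smul_smul, smul_smul, reflection_mul_rotation]
  exact key y

lemma reflectionMap_reflectionMap (y : Res Y) : reflectionMap Y (reflectionMap Y y) = y := by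
  have key (y : Y) : reflection • reflection • y = y := by
    rw [smul_smul, reflection_mul_self, one_smul]
  exact key y

/-- The involution of the orbit space for the rotations. -/
def orbitReflection : C(RotationOrbits Y, RotationOrbits Y) :=
  ⟨Quotient.lift (fun y : Res Y => toOrbits Circle (Res Y) (reflectionMap Y y)) (by
    rintro _ y ⟨g, rfl⟩
    exact (congrArg _ (reflectionMap_smul Y g y)).trans (toOrbits_smul _ _)),
    Continuous.quotient_lift ((toOrbits Circle (Res Y)).continuous.comp
      (reflectionMap Y).continuous) _⟩

lemma orbitReflection_toOrbits (y : Res Y) : orbitReflection Y (toOrbits Circle (Res Y) y) =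
    toOrbits Circle (Res Y) (reflectionMap Y y) := rfl

lemma orbitReflection_orbitReflection (b : RotationOrbits Y) :
    orbitReflection Y (orbitReflection Y b) = b := by
  obtain ⟨y, rfl⟩ := Quotient.exists_rep b
  exact congrArg (toOrbits Circle (Res Y)) (reflectionMap_reflectionMap Y y)

lemma rotationOrbitsProj_orbitReflection (b : RotationOrbits Y) :
    rotationOrbitsProj Y (orbitReflection Y b) = rotationOrbitsProj Y b := by
  obtain ⟨y, rfl⟩ := Quotient.exists_rep b
  exact toOrbits_smul reflection (show Y from y)

variable {Y}

/-- At a fixed point, freeness of the action of `O(2)` would make the reflection equal to a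
rotation, contradicting the determinant. -/
lemma LocallyTrivial.orbitReflection_ne (h : LocallyTrivial O2 Y) (b : RotationOrbits Y) :
    orbitReflection Y b ≠ b := by
  obtain ⟨y, rfl⟩ := Quotient.exists_rep b
  intro e
  obtain ⟨g, hg⟩ := exists_smul_of_toOrbits_eq (G := Circle) (Y := Res Y) e
  have h1 : rotation g = reflection :=
    h.eq_of_smul_eq (y := (show Y from y)) hg
  have h2 := orthogonalDet_rotation g
  rw [h1, orthogonalDet_reflection] at h2
  norm_num at h2

/-- Lifts of the two simplices to `Y` differ by a simplex of `O(2)`. By constancy of its determinant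
it consists of rotations throughout, or of rotations times the reflection throughout, and rotations
disappear in the orbit space. -/
lemma LocallyTrivial.eq_or_eq_orbitReflection (h : LocallyTrivial O2 Y) {n : ℕ}
    (σ τ : (Sing (RotationOrbits Y)) _⦋n⦌)
    (e : compSimplex (rotationOrbitsProj Y) σ = compSimplex (rotationOrbitsProj Y) τ) :
    τ = σ ∨ τ = compSimplex (orbitReflection Y) σ := by
  obtain ⟨σ, rfl⟩ := h.res.exists_lift σ
  obtain ⟨τ, rfl⟩ := h.res.exists_lift τ
  let σ' : (Sing Y) _⦋n⦌ := σ
  let τ' : (Sing Y) _⦋n⦌ := τ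
  obtain ⟨γ, hγ⟩ := h.exists_act_eq (τ := σ') (τ' := τ') e
  have hγ' (t) : toMap γ t • toMap σ' t = toMap τ' t := by rw [← hγ, toMap_act]
  refine (orthogonalDet_const (toMap γ)).imp (fun hd => simplex_ext fun t => ?_)
    fun hd => simplex_ext fun t => ?_
  · rw [toMap_compSimplex, toMap_compSimplex]
    have h1 := hγ' t
    rw [eq_rotation_of_orthogonalDet_eq_one (hd t)] at h1
    refine Eq.trans ?_ (toOrbits_smul (G := Circle) (column (toMap γ t)) (toMap σ t))
    exact congrArg (toOrbits Circle (Res Y)) h1.symm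
  · rw [toMap_compSimplex, toMap_compSimplex, toMap_compSimplex]
    have h1 := hγ' t
    rw [eq_rotation_mul_reflection_of_orthogonalDet_eq_neg_one (hd t), mul_smul] at h1
    refine Eq.trans ?_ (toOrbits_smul (G := Circle) (column (toMap γ t))
      (reflectionMap Y (toMap σ t)))
    exact congrArg (toOrbits Circle (Res Y)) h1.symm

end Quotients

end HomotopyOrbits
end

noncomputable section
namespace HomotopyOrbits
open Simplicial

/-! ### Principal `O(2)`-bundles -/

section Orthogonal
variable (k : Type u) [CommRing k] (Y : Type v) [TopologicalSpace Y] [MulAction O2 Y]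
  [ContinuousSMul O2 Y]

/-- The singular chains on the orbit space for the rotations, with the involution given by the
reflection. -/
def orbitComplex : InvolutiveComplex.{u, max u v} k where
  C := singularChains k (RotationOrbits Y)
  ρ := pushHom k (orbitReflection Y)
  ρ_ρ n x := by
    refine (push_push k _ _ n x).trans (Eq.trans ?_ (push_id k n x))
    exact congrArg (fun f => push k f n x)
      (ContinuousMap.ext (orbitReflection_orbitReflection Y))

lemma push_rotationOrbitsProj_orbitReflection (n : ℕ) (c : Chain k (RotationOrbits Y) n) :
    push k (rotationOrbitsProj Y) n (push k (orbitReflection Y) n c) =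
      push k (rotationOrbitsProj Y) n c := by
  refine (push_push k _ _ n c).trans ?_
  exact congrArg (fun f => push k f n c)
    (ContinuousMap.ext (rotationOrbitsProj_orbitReflection Y))

lemma push_toOrbits_reflectionMap (n : ℕ) (c : Chain k (Res Y) n) :
    push k (toOrbits Circle (Res Y)) n (push k (reflectionMap Y) n c) =
      push k (orbitReflection Y) n (push k (toOrbits Circle (Res Y)) n c) := by
  rw [push_push, push_push]
  exact congrArg (fun f => push k f n c)
    (ContinuousMap.ext fun y => (orbitReflection_toOrbits Y y).symm)

/-- The map from the homotopy orbits of the singular chains on the orbit space for the rotations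
to the singular chains on the orbit space for `O(2)`. -/
def orbitAugmentation : (orbitComplex k Y).homotopyOrbits ⟶
    singularChains k (Quotient (MulAction.orbitRel O2 Y)) :=
  InvolutiveComplex.augmentation (M := orbitComplex k Y) (pushHom k (rotationOrbitsProj Y))
    (push_rotationOrbitsProj_orbitReflection k Y)

variable {Y}

/-- Reflection permutes the simplices of `Y/𝕋` without fixed points, since it moves the zeroth
vertex. The chains are thus degreewise free over the group ring of `C₂`, and their coinvariants are
the chains of `Y/O(2)`. -/
lemma coneAcyclic_orbitAugmentation (h : LocallyTrivial O2 Y) :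
    ConeAcyclic (orbitAugmentation k Y) := by
  have hr (n : ℕ) : Function.Involutive
      (compSimplex (orbitReflection Y) : (Sing (RotationOrbits Y)) _⦋n⦌ → _) :=
    fun σ => simplex_ext fun t => orbitReflection_orbitReflection Y _
  have hS (n : ℕ) := exists_fundamentalDomain
    (r := (compSimplex (orbitReflection Y) : (Sing (RotationOrbits Y)) _⦋n⦌ → _))
    (fun σ e => h.orbitReflection_ne _
      (congrArg (fun σ => toMap σ (stdSimplex.vertex (S := ℝ) (0 : Fin (n + 1)))) e))
    (compSimplex (rotationOrbitsProj Y))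
    (fun σ => simplex_ext fun t => rotationOrbitsProj_orbitReflection Y _)
    h.eq_or_eq_orbitReflection
  refine InvolutiveComplex.coneAcyclic_augmentation (M := orbitComplex k Y) _ _
    (fun n => lmapDomain_surjective _ fun σ => ?_)
    (fun n x hx => exists_lmapDomain_sub_eq_of_map_eq_zero _ h.eq_or_eq_orbitReflection x hx)
    (fun n x hx => ?_) fun n x hx => ?_
  · obtain ⟨τ, hτ⟩ := h.exists_lift σ
    let τ' : (Sing (Res Y)) _⦋n⦌ := τ
    exact ⟨compSimplex (toOrbits Circle (Res Y)) τ', hτ⟩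
  · obtain ⟨S, hS⟩ := hS n
    exact exists_lmapDomain_add_eq (hr n) hS x hx
  · obtain ⟨S, hS⟩ := hS n
    exact exists_lmapDomain_sub_eq (hr n) hS x hx

variable {k} {z : Chain k Circle 1} (hz : IsFundamentalCycle z)
  (hz' : push k conjugation 1 z = -z)

/-- The map from the homotopy orbits for the circle to the singular chains on the orbit space is
compatible with the involutions. -/
def orbitsToHom (Y : Type v) [TopologicalSpace Y] [MulAction O2 Y] [ContinuousSMul O2 Y] :
    InvolutiveComplex.Hom (chainsOModule hz hz' Y).circleOrbits (orbitComplex k Y) where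
  f := orbitsTo hz (toOrbits Circle (Res Y)) toOrbits_smul
  f_ρ n x := by
    let c : Chain k (Res Y) n :=
      (show (chainsOModule hz hz' Y).toTModule.OrbitsX n from x) ⟨(0, n), by simp⟩
    have e : normalize k _ n (push k (toOrbits Circle (Res Y)) n
        ((-1 : ℤ) ^ 0 • push k (reflectionMap Y) n c)) = push k (orbitReflection Y) n
          (normalize k _ n (push k (toOrbits Circle (Res Y)) n c)) := by
      rw [pow_zero, one_smul, ← normalize_push, push_toOrbits_reflectionMap]
    exact e

/-- For a principal `O(2)`-bundle, the homotopy orbits of the singular chains are quasi-isomorphic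
to the singular chains on the orbit space. -/
theorem exists_quasiIso_orbits (h : LocallyTrivial O2 Y) :
    ∃ f : (chainsOModule hz hz' Y).homotopyOrbits ⟶
      singularChains k (Quotient (MulAction.orbitRel O2 Y)), QuasiIso f := by
  have h1 : QuasiIso (orbitsToHom hz hz' Y).orbitsMap :=
    (InvolutiveComplex.Hom.coneAcyclic_orbitsMap _ (coneAcyclic_orbitsTo hz h.res)).quasiIso
  have h2 : QuasiIso (orbitAugmentation k Y) := (coneAcyclic_orbitAugmentation k h).quasiIso
  -- First pass to iterated orbits, then replace `S_*(Y)_{h𝕋}` by `S_*(Y/𝕋)`, and finally replace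
  -- homotopy orbits of the free involution by honest chains on the quotient.
  exact ⟨(chainsOModule hz hz' Y).homotopyOrbitsIso.hom ≫
    (orbitsToHom hz hz' Y).orbitsMap ≫ orbitAugmentation k Y, inferInstance⟩

end Orthogonal

/-! ### Projectivity of the homotopy orbits -/

section Projective
variable {k : Type u} [CommRing k]

lemma finite_pairs (n : ℕ) : Finite {i : ℕ × ℕ // 2 * i.1 + i.2 = n} :=
  Set.Finite.subset ((Set.finite_Iic n).prod (Set.finite_Iic n)) fun i (hi : 2 * i.1 + i.2 = n) =>
    ⟨by simp only [Set.mem_Iic]; omega, by simp only [Set.mem_Iic]; omega⟩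

lemma finite_triples (n : ℕ) : Finite {i : ℕ × ℕ × ℕ // i.1 + 2 * i.2.1 + i.2.2 = n} :=
  Set.Finite.subset ((Set.finite_Iic n).prod ((Set.finite_Iic n).prod (Set.finite_Iic n)))
    fun i (hi : i.1 + 2 * i.2.1 + i.2.2 = n) =>
      ⟨by simp only [Set.mem_Iic]; omega, by simp only [Set.mem_Iic]; omega,
        by simp only [Set.mem_Iic]; omega⟩

lemma TModule.projective_homotopyOrbits (M : TModule.{u, w} k) [∀ n, Module.Free k (M.C.X n)]
    (n : ℕ) : Module.Projective k (M.homotopyOrbits.X n) :=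
  have := finite_pairs n
  have : Module.Free k (M.OrbitsX n) := inferInstance
  inferInstanceAs (Module.Projective k (M.OrbitsX n))

lemma OModule.projective_homotopyOrbits (M : OModule.{u, w} k) [∀ n, Module.Free k (M.C.X n)]
    (n : ℕ) : Module.Projective k (M.homotopyOrbits.X n) :=
  have := finite_triples n
  have : Module.Free k (M.OrbitsX n) := inferInstance
  inferInstanceAs (Module.Projective k (M.OrbitsX n))

end Projective

/-! ### The Borel construction -/

section Borel
variable {k : Type u} [CommRing k] {z : Chain k Circle 1} (hz : IsFundamentalCycle z)

/-- The homotopy orbits for the circle of the singular chains are quasi-isomorphic to the singular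
chains on the Borel construction. -/
theorem exists_quasiIso_borel_circle (X E : Type v) [TopologicalSpace X] [MulAction Circle X]
    [ContinuousSMul Circle X] [TopologicalSpace E] [MulAction Circle E]
    (hE : IsUniversalSpace Circle E) :
    ∃ f : (chainsTModule hz X).homotopyOrbits ⟶ singularChains k (Borel Circle E X),
      QuasiIso f := by
  have := hE.continuousSMul
  have := hE.contractibleSpace
  have free (Y : Type v) [TopologicalSpace Y] [MulAction Circle Y] [ContinuousSMul Circle Y]
      (n : ℕ) : Module.Free k ((chainsTModule hz Y).C.X n) :=
    inferInstanceAs (Module.Free k (Chain k Y n))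
  have := TModule.projective_homotopyOrbits (chainsTModule hz X)
  have := TModule.projective_homotopyOrbits (chainsTModule hz (E × X))
  have hY : LocallyTrivial Circle (E × X) :=
    LocallyTrivial.comap (Y := E) hE.exists_equivariant Prod.fst continuous_fst fun _ _ => rfl
  -- The geometry gives a zigzag `S_*(X)_{h𝕋} ← S_*(E × X)_{h𝕋} → S_*(E ×_𝕋 X)`. Projectivity turns
  -- the left arrow around and produces a single map.
  obtain ⟨s, hs⟩ := exists_quasiIso_inv
    (chainsTHom hz (ContinuousMap.snd : C(E × X, X)) fun _ _ => rfl).orbitsMap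
    (TModule.Hom.coneAcyclic_orbitsMap _ (coneAcyclic_pushHom_snd k X E)).quasiIso
  have := (coneAcyclic_orbitsTo hz hY).quasiIso
  exact ⟨s ≫ orbitsTo hz (toOrbits Circle (E × X)) toOrbits_smul, inferInstance⟩

variable (hz' : push k conjugation 1 z = -z)

/-- The morphism of `H_*(O(2); k)`-modules induced by an equivariant map. -/
def chainsOHom {X Y : Type v} [TopologicalSpace X] [MulAction O2 X] [ContinuousSMul O2 X]
    [TopologicalSpace Y] [MulAction O2 Y] [ContinuousSMul O2 Y] (f : C(X, Y))
    (hf : ∀ (g : O2) (x : X), f (g • x) = g • f x) :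
    OModule.Hom (chainsOModule hz hz' X) (chainsOModule hz hz' Y) where
  toHom := chainsTHom hz (X := Res X) (Y := Res Y) f fun g x => hf (rotation g) x
  f_R n x := by
    let f' : C(Res X, Res Y) := f
    refine (push_push k (reflectionMap X) f' n x).trans
      (Eq.trans ?_ (push_push k f' (reflectionMap Y) n x).symm)
    exact congrArg (fun f => push k f n x) (ContinuousMap.ext fun x => hf reflection x)

/-- The homotopy orbits for `O(2)` of the singular chains are quasi-isomorphic to the singular
chains on the Borel construction. -/
theorem exists_quasiIso_borel_orthogonal (X E : Type v) [TopologicalSpace X] [MulAction O2 X]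
    [ContinuousSMul O2 X] [TopologicalSpace E] [MulAction O2 E]
    (hE : IsUniversalSpace O2 E) :
    ∃ f : (chainsOModule hz hz' X).homotopyOrbits ⟶ singularChains k (Borel O2 E X),
      QuasiIso f := by
  have := hE.continuousSMul
  have := hE.contractibleSpace
  have free (Y : Type v) [TopologicalSpace Y] [MulAction O2 Y] [ContinuousSMul O2 Y]
      (n : ℕ) : Module.Free k ((chainsOModule hz hz' Y).C.X n) :=
    inferInstanceAs (Module.Free k (Chain k (Res Y) n))
  have := OModule.projective_homotopyOrbits (chainsOModule hz hz' X)
  have := OModule.projective_homotopyOrbits (chainsOModule hz hz' (E × X))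
  have hY : LocallyTrivial O2 (E × X) :=
    LocallyTrivial.comap (Y := E) hE.exists_equivariant Prod.fst continuous_fst fun _ _ => rfl
  let φ := chainsOHom hz hz' (ContinuousMap.snd : C(E × X, X)) fun _ _ => rfl
  have hφ : QuasiIso φ.circleOrbitsHom.orbitsMap :=
    (InvolutiveComplex.Hom.coneAcyclic_orbitsMap _
      (TModule.Hom.coneAcyclic_orbitsMap φ.toHom (coneAcyclic_pushHom_snd k X E))).quasiIso
  -- The map to be inverted is defined on iterated orbits and is conjugated by `homotopyOrbitsIso`
  -- into a map between the `O(2)`-orbits, whose projectivity is at hand.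
  obtain ⟨s, hs⟩ := exists_quasiIso_inv
    ((chainsOModule hz hz' (E × X)).homotopyOrbitsIso.hom ≫ φ.circleOrbitsHom.orbitsMap ≫
      (chainsOModule hz hz' X).homotopyOrbitsIso.inv) inferInstance
  obtain ⟨f, hf⟩ := exists_quasiIso_orbits hz hz' hY
  exact ⟨s ≫ f, inferInstance⟩

end Borel

end HomotopyOrbits
end

/-- For a left `O(2)`-space `X`, the algebraic homotopy orbits of `S_*(X)` over `H_*(𝕋; k)` and over
`H_*(O(2); k)` are quasi-isomorphic to the singular chains on the Borel constructions `X_{h𝕋}` and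
`X_{hO(2)}`, for every choice of fundamental cycle and every choice of universal space. -/
theorem mainTheorem9 (k : Type u) [CommRing k] (X : Type v) [TopologicalSpace X]
    [MulAction O2 X] [ContinuousSMul O2 X] :
    (∀ (z : Chain k Circle 1) (hz : IsFundamentalCycle z)
        (E : Type v) [TopologicalSpace E] [MulAction Circle E], IsUniversalSpace Circle E →
      ∃ f : (chainsTModule hz (Res X)).homotopyOrbits ⟶ singularChains k (Borel Circle E (Res X)),
        QuasiIso f) ∧
    (∀ (z : Chain k Circle 1) (hz : IsFundamentalCycle z) (hz' : push k conjugation 1 z = -z)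
        (E : Type v) [TopologicalSpace E] [MulAction O2 E], IsUniversalSpace O2 E →
      ∃ f : (chainsOModule hz hz' X).homotopyOrbits ⟶ singularChains k (Borel O2 E X),
        QuasiIso f) := by
  exact ⟨fun z hz E _ _ hE => exists_quasiIso_borel_circle hz (Res X) E hE,
    fun z hz hz' E _ _ hE => exists_quasiIso_borel_orthogonal hz hz' X E hE⟩
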